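/- Let $X$ be a complex Banach space and let $k\in L^1_{loc}([0,\infty))$ be complex valued with $0\in\operatorname{supp}(k)$. Write $(f*g)(t)=\int_0^t f(t-s)g(s)\,ds$, $(k\circ g)(t)=\int_t^\infty k(s-t)g(s)\,ds$ for $t\ge 0$, and $k^{*n}$ for the $n$-fold convolution power. Let $\mathcal D_+$ be the space of restrictions to $[0,\infty)$ of functions in $C_c^\infty(\mathbb R)$, let $\mathcal D_{k^{*n}}=\{k^{*n}\circ g : g\in\mathcal D_+\}$, let $W_{k^{*n}}:\mathcal D_{k^{*n}}\to\mathcal D_+$ be the inverse of $g\mapsto k^{*n}\circ g$, and put $\mathcal D_{k^{*\infty}}=\bigcap_{n\ge1}\mathcal D_{k^{*n}}$. For $b>0$ the functions of $\mathcal D_{k^{*\infty}}$ supported in $[0,b]$ carry the projective limit topology given by uniform convergence on $[0,\infty)$ of $(W_{k^{*n}}f)^{(j)}$ for all $n\ge1$, $j\ge0$; the space $\mathcal D_{k^{*\infty}}$ carries the locally convex inductive limit of these topologies over $b$. Assume that $\mathcal D_{k^{*\infty}}\neq\{0\}$. Let $0<\tau<\infty$, let $A$ be a closed linear operator in $X$,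 and let $(S_k(t))_{t\in[0,\tau]}\subset\mathcal B(X)$ be a non-degenerate local $k$-convoluted semigroup generated by $A$: the family is strongly continuous, $S_k(t)A\subset AS_k(t)$, $\int_0^tS_k(s)x\,ds\in D(A)$ and $A\int_0^tS_k(s)x\,ds=S_k(t)x-\int_0^tk(s)\,ds\,x$ for all $t\in[0,\tau]$ and $x\in X$, and $S_k(t)x=0$ for all $t\in[0,\tau]$ implies $x=0$. Define $S_{k^{*1}}=S_k$ and, for $n\ge1$, $$S_{k^{*(n+1)}}(t)x=\int_0^tk(t-s)S_{k^{*n}}(s)x\,ds,\qquad 0\le t\le n\tau,$$ $$S_{k^{*(n+1)}}(t)x=S_{k^{*n}}(n\tau)S_k(t-n\tau)x+\int_0^{n\tau}k(t-s)S_{k^{*n}}(s)x\,ds+\int_0^{t-n\tau}k^{*n}(t-s)S_k(s)x\,ds,\qquad n\tau<t\le(n+1)\tau.$$ Then there is exactly one map $\mathcal G_k:\mathcal D_{k^{*\infty}}\to\mathcal B(X)$ such that $$\mathcal G_k(f)x=\int_0^{n\tau}W_{k^{*n}}f(t)\,S_{k^{*n}}(t)x\,dt,\qquad x\in X,$$ for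 all $f\in\mathcal D_{k^{*\infty}}$ and all $n\ge1$ with $\operatorname{supp}f\subset[0,n\tau]$. The map $\mathcal G_k$ is a $k$-distribution semigroup: it is linear and continuous (for the operator norm on $\mathcal B(X)$); for all $\phi,\psi\in\mathcal D_{k^{*\infty}}$ one has $\phi*\psi\in\mathcal D_{k^{*\infty}}$ and $\mathcal G_k(\phi*\psi)=\mathcal G_k(\phi)\mathcal G_k(\psi)$; and $\bigcap_{\theta\in\mathcal D_{k^{*\infty}}}\ker\mathcal G_k(\theta)=\{0\}$. Its generator is $A$: the graph of $A$ is the closure in $X\times X$ of the graph of the operator $A'$ with domain $\bigcup_{\theta\in\mathcal D_{k^{*\infty}}}\operatorname{Im}\mathcal G_k(\theta)$ and $A'\mathcal G_k(\theta)x=-\mathcal G_k(\theta')x-\theta(0)x$. -/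

import Mathlib

open MeasureTheory Set Filter Topology
open scoped ContDiff

/-! Functions on `[0, ∞)` are represented by functions on `ℝ`.  The values of a kernel `k` on the
negative half-line are never used; test functions on `[0, ∞)` are extended by zero. -/

namespace KConv

/-- The convolution `(f * g)(t) = ∫₀ᵗ f(t - s) g(s) ds` of functions on `[0, ∞)`. -/
noncomputable def conv (f g : ℝ → ℂ) (t : ℝ) : ℂ := ∫ s in (0 : ℝ)..t, f (t - s) * g s

/-- The convolution powers `k^{*n}`, `n ≥ 1` (the value at `n = 0` is a dummy). -/
noncomputable def convPow (k : ℝ → ℂ) : ℕ → ℝ → ℂ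
  | 0 => 0
  | 1 => k
  | n + 2 => conv k (convPow k (n + 1))

/-- The origin belongs to the support of the (class of the) function `k` on `[0, ∞)`. -/
def ZeroMemSupp (k : ℝ → ℂ) : Prop :=
  ∀ ε > (0 : ℝ), ¬ ∀ᵐ t ∂(volume.restrict (Ioo 0 ε)), k t = 0

/-- The dual convolution `(k ∘ g)(t) = ∫ₜ^∞ k(s - t) g(s) ds`, `t ≥ 0`, extended by zero. -/
noncomputable def dualConv (k g : ℝ → ℂ) : ℝ → ℂ :=
  (Ici (0 : ℝ)).indicator fun t => ∫ s in Ioi t, k (s - t) * g s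

/-- `𝓓₊`: restrictions to `[0, ∞)` of smooth compactly supported functions on `ℝ`. -/
def TestPlus : Submodule ℂ (ℝ → ℂ) where
  carrier := {f | ∃ φ : ℝ → ℂ, ContDiff ℝ ∞ φ ∧ HasCompactSupport φ ∧ f = (Ici (0 : ℝ)).indicator φ}
  zero_mem' := ⟨0, contDiff_const, HasCompactSupport.zero, by simp⟩
  add_mem' := by
    rintro _ _ ⟨φ, hφ, hφ', rfl⟩ ⟨ψ, hψ, hψ', rfl⟩
    exact ⟨φ + ψ, hφ.add hψ, hφ'.add hψ', by rw [indicator_add']⟩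
  smul_mem' := by
    rintro c _ ⟨φ, hφ, hφ', rfl⟩
    exact ⟨c • φ, contDiff_const.smul hφ, hφ'.smul_left (f := fun _ => c),
      (indicator_const_smul (Ici (0 : ℝ)) c φ).symm⟩

theorem conv_locallyIntegrableOn {f g : ℝ → ℂ} (hf : LocallyIntegrableOn f (Ici 0))
    (hg : LocallyIntegrableOn g (Ici 0)) : LocallyIntegrableOn (conv f g) (Ici 0) := by
  have key : ∀ T : ℝ, IntegrableOn (conv f g) (Icc 0 T) := by
    intro T
    have hfT : IntegrableOn f (Icc 0 T) :=
      hf.integrableOn_compact_subset (fun x hx => hx.1) isCompact_Icc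
    have hgT : IntegrableOn g (Icc 0 T) :=
      hg.integrableOn_compact_subset (fun x hx => hx.1) isCompact_Icc
    have hF : Integrable ((Ico (0 : ℝ) T).indicator f) :=
      (hfT.mono_set Ico_subset_Icc_self).integrable_indicator measurableSet_Ico
    have hG : Integrable ((Ioc (0 : ℝ) T).indicator g) :=
      (hgT.mono_set Ioc_subset_Icc_self).integrable_indicator measurableSet_Ioc
    have hc := (hG.integrable_convolution (ContinuousLinearMap.mul ℝ ℂ) hF).integrableOn
      (s := Icc 0 T)
    refine hc.congr_fun (fun t ht => ?_) measurableSet_Icc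
    simp only [convolution, ContinuousLinearMap.mul_apply', conv]
    rw [intervalIntegral.integral_of_le ht.1, ← integral_indicator measurableSet_Ioc]
    congr 1
    ext s
    have h0 := ht.1
    have h1 := ht.2
    simp only [indicator, mem_Ioc, mem_Ico]
    by_cases a : 0 < s
    · by_cases b : s ≤ t
      · rw [if_pos ⟨a, by linarith⟩, if_pos ⟨by linarith, by linarith⟩, if_pos ⟨a, b⟩, mul_comm]
      · rw [if_neg (c := 0 ≤ t - s ∧ t - s < T) (fun h => b (by linarith [h.1])),
          if_neg (c := 0 < s ∧ s ≤ t) (fun h => b h.2), mul_zero]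
    · rw [if_neg (c := 0 < s ∧ s ≤ T) (fun h => a h.1), if_neg (c := 0 < s ∧ s ≤ t) (fun h => a h.1),
        zero_mul]
  intro x hx
  refine ⟨Icc 0 (x + 1), ?_, key _⟩
  have : Iic (x + 1) ∈ 𝓝[Ici 0] x := mem_nhdsWithin_of_mem_nhds (Iic_mem_nhds (by linarith))
  filter_upwards [this, self_mem_nhdsWithin] with y hy hy' using ⟨hy', hy⟩

theorem convPow_locallyIntegrableOn {k : ℝ → ℂ} (hk : LocallyIntegrableOn k (Ici 0)) :
    ∀ n, LocallyIntegrableOn (convPow k n) (Ici 0)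
  | 0 => locallyIntegrableOn_zero
  | 1 => hk
  | n + 2 => conv_locallyIntegrableOn hk (convPow_locallyIntegrableOn hk (n + 1))

theorem integrableOn_dualConv {k g : ℝ → ℂ} (hk : LocallyIntegrableOn k (Ici 0))
    (hg : g ∈ TestPlus) {t : ℝ} (ht : 0 ≤ t) :
    IntegrableOn (fun s => k (s - t) * g s) (Ioi t) := by
  obtain ⟨φ, hφ, hφc, rfl⟩ := hg
  obtain ⟨C, hC⟩ := hφc.exists_bound_of_continuous hφ.continuous
  obtain ⟨b, hb⟩ := hφc.isCompact.bddAbove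
  have hkt : IntegrableOn k (Icc 0 (b - t)) :=
    hk.integrableOn_compact_subset (fun x hx => hx.1) isCompact_Icc
  have h1 : Integrable (fun s => (Icc 0 (b - t)).indicator k (s - t)) :=
    (hkt.integrable_indicator measurableSet_Icc).comp_sub_right t
  have h2 : Integrable (fun s => φ s * (Icc 0 (b - t)).indicator k (s - t)) :=
    h1.bdd_mul hφ.continuous.aestronglyMeasurable (Eventually.of_forall hC)
  refine h2.integrableOn.congr_fun (fun s hs => ?_) measurableSet_Ioi
  have hs' : t < s := hs
  by_cases hsb : s ≤ b
  · have m : s - t ∈ Icc 0 (b - t) := ⟨by linarith, by linarith⟩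
    have m' : s ∈ Ici (0 : ℝ) := le_trans ht hs'.le
    simp only [indicator_of_mem m, indicator_of_mem m', mul_comm]
  · have z : φ s = 0 := by
      by_contra h
      exact hsb (hb (subset_tsupport φ h))
    simp [indicator, z]

/-- `𝓓ₖ = {k ∘ g | g ∈ 𝓓₊}`. -/
noncomputable def TestK (k : ℝ → ℂ) (hk : LocallyIntegrableOn k (Ici 0)) : Submodule ℂ (ℝ → ℂ) where
  carrier := {f | ∃ g ∈ TestPlus, dualConv k g = f}
  zero_mem' := ⟨0, TestPlus.zero_mem, by ext t; simp [dualConv]⟩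
  add_mem' := by
    rintro _ _ ⟨g, hg, rfl⟩ ⟨h, hh, rfl⟩
    refine ⟨g + h, TestPlus.add_mem hg hh, ?_⟩
    ext t
    by_cases ht : t ∈ Ici (0 : ℝ)
    · simp only [dualConv, Pi.add_apply, indicator_of_mem ht, mul_add]
      exact integral_add (integrableOn_dualConv hk hg ht) (integrableOn_dualConv hk hh ht)
    · simp [dualConv, indicator_of_notMem ht]
  smul_mem' := by
    rintro c _ ⟨g, hg, rfl⟩
    refine ⟨c • g, TestPlus.smul_mem c hg, ?_⟩
    ext t
    by_cases ht : t ∈ Ici (0 : ℝ)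
    · simp only [dualConv, Pi.smul_apply, indicator_of_mem ht, smul_eq_mul, mul_left_comm]
      exact integral_const_mul c _
    · simp [dualConv, indicator_of_notMem ht]

/-- `𝓓_{k^{*∞}} = ⋂_{n ≥ 1} 𝓓_{k^{*n}}`. -/
noncomputable def TestKInf (k : ℝ → ℂ) (hk : LocallyIntegrableOn k (Ici 0)) : Submodule ℂ (ℝ → ℂ) :=
  ⨅ (n : ℕ) (_ : 1 ≤ n), TestK (convPow k n) (convPow_locallyIntegrableOn hk n)

open Classical in
/-- `Wₖ f`: the function `g ∈ 𝓓₊` with `k ∘ g = f`, for `f ∈ 𝓓ₖ`. -/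
noncomputable def W (k f : ℝ → ℂ) : ℝ → ℂ :=
  if h : ∃ g ∈ TestPlus, dualConv k g = f then h.choose else 0

/-- The elements of `𝓓_{k^{*∞}}` with support in `[0, b]`. -/
abbrev TestKInfOn (k : ℝ → ℂ) (hk : LocallyIntegrableOn k (Ici 0)) (b : ℝ) : Type :=
  {f : TestKInf k hk // tsupport (f : ℝ → ℂ) ⊆ Icc 0 b}

/-- The topology on the functions of `𝓓_{k^{*∞}}` supported in `[0, b]` as a projective limit of the
corresponding parts of the spaces `𝓓_{k^{*n}}`: for all `n ≥ 1` and `j ≥ 0`, uniform convergence on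
`[0, ∞)` of the `j`-th derivatives of `W_{k^{*n}} f`. -/
@[reducible] noncomputable def topOn (k : ℝ → ℂ) (hk : LocallyIntegrableOn k (Ici 0)) (b : ℝ) :
    TopologicalSpace (TestKInfOn k hk b) :=
  TopologicalSpace.induced
    (fun (f : TestKInfOn k hk b) (p : ℕ × ℕ) => UniformFun.ofFun fun t : Ici (0 : ℝ) =>
      iteratedDerivWithin p.2 (W (convPow k (p.1 + 1)) (f.1 : ℝ → ℂ)) (Ici 0) t)
    (inferInstance : TopologicalSpace (ℕ × ℕ → UniformFun (Ici (0 : ℝ)) ℂ))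

/-- The inductive limit topology on `𝓓_{k^{*∞}}`: the finest locally convex vector space topology
for which the inclusions of the functions supported in `[0, b]` are continuous for all `b`. -/
@[reducible] noncomputable def testTop (k : ℝ → ℂ) (hk : LocallyIntegrableOn k (Ici 0)) :
    TopologicalSpace (TestKInf k hk) :=
  sInf {t | @IsTopologicalAddGroup _ t _ ∧ @ContinuousSMul ℂ _ _ _ t ∧
    @LocallyConvexSpace ℝ (TestKInf k hk) _ _ _ _ t ∧
    ∀ b : ℝ, Continuous[topOn k hk b, t] (Subtype.val : TestKInfOn k hk b → TestKInf k hk)}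

variable {X : Type*} [NormedAddCommGroup X] [NormedSpace ℂ X]

/-- `(S(t))_{t ∈ [0, τ]}` is a local `k`-convoluted semigroup generated by the closed operator `A`.
Membership `(x, y) ∈ A.graph` means `x ∈ D(A)` and `A x = y`. -/
structure IsLocalConvolutedSemigroup (k : ℝ → ℂ) (τ : ℝ) (S : ℝ → X →L[ℂ] X)
    (A : X →ₗ.[ℂ] X) : Prop where
  isClosed : A.IsClosed
  strongly_continuous : ∀ x, ContinuousOn (fun t => S t x) (Icc 0 τ)
  commutes : ∀ t ∈ Icc 0 τ, ∀ x : A.domain, (S t x, S t (A x)) ∈ A.graph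
  duhamel : ∀ t ∈ Icc 0 τ, ∀ x,
    (∫ s in (0 : ℝ)..t, S s x, S t x - (∫ s in (0 : ℝ)..t, k s) • x) ∈ A.graph

/-- Non-degeneracy of the family `(S(t))_{t ∈ [0, τ]}`. -/
def NonDegenerate (τ : ℝ) (S : ℝ → X →L[ℂ] X) : Prop :=
  ∀ x, (∀ t ∈ Icc 0 τ, S t x = 0) → x = 0

/-- The extensions `S_{k^{*n}}(t) x`, `t ∈ [0, n τ]`, `n ≥ 1`, of a local `k`-convoluted semigroup
`S` on `[0, τ]` (the value at `n = 0` is a dummy). -/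
noncomputable def extend (k : ℝ → ℂ) (τ : ℝ) (S : ℝ → X →L[ℂ] X) : ℕ → ℝ → X → X
  | 0 => fun _ _ => 0
  | 1 => fun t x => S t x
  | n + 2 => fun t x =>
      if t ≤ (n + 1) * τ then ∫ s in (0 : ℝ)..t, k (t - s) • extend k τ S (n + 1) s x
      else extend k τ S (n + 1) ((n + 1) * τ) (S (t - (n + 1) * τ) x)
        + (∫ s in (0 : ℝ)..((n + 1) * τ), k (t - s) • extend k τ S (n + 1) s x)
        + ∫ s in (0 : ℝ)..(t - (n + 1) * τ), convPow k (n + 1) (t - s) • S s x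

/-- `G` is the map `𝒢ₖ : 𝓓_{k^{*∞}} → 𝓑(X)`,
`𝒢ₖ(f) x = ∫₀^{nτ} W_{k^{*n}} f(t) S_{k^{*n}}(t) x dt` whenever `n ≥ 1` and `supp f ⊆ [0, n τ]`. -/
def IsInducedMap (k : ℝ → ℂ) (hk : LocallyIntegrableOn k (Ici 0)) (τ : ℝ) (S : ℝ → X →L[ℂ] X)
    (G : TestKInf k hk → X →L[ℂ] X) : Prop :=
  ∀ (f : TestKInf k hk) (n : ℕ), 1 ≤ n → tsupport (f : ℝ → ℂ) ⊆ Icc 0 (n * τ) →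
    ∀ x, G f x = ∫ t in (0 : ℝ)..(n * τ), W (convPow k n) f t • extend k τ S n t x

/-- `k`-distribution semigroups. The convolution of two elements of `𝓓_{k^{*∞}}` is
again one, which is part of the multiplicativity here. -/
structure IsKDistributionSemigroup (k : ℝ → ℂ) (hk : LocallyIntegrableOn k (Ici 0))
    (G : TestKInf k hk → X →L[ℂ] X) : Prop where
  linear : IsLinearMap ℂ G
  continuous : Continuous[testTop k hk, inferInstance] G
  map_conv : ∀ φ ψ : TestKInf k hk, ∃ h : conv φ ψ ∈ TestKInf k hk, G ⟨conv φ ψ, h⟩ = G φ ∘L G ψ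
  ker_inter : ⋂ θ : TestKInf k hk, {x : X | G θ x = 0} = {0}

/-- The graph of the operator `A'` with domain `⋃_θ Im G(θ)` and
`A' G(θ) x = - G(θ') x - θ(0) x`; here `θ'` is the derivative of `θ` on `[0, ∞)`. -/
def preGeneratorGraph {k : ℝ → ℂ} {hk : LocallyIntegrableOn k (Ici 0)}
    (G : TestKInf k hk → X →L[ℂ] X) : Set (X × X) :=
  {p | ∃ (θ θ' : TestKInf k hk) (x : X), (θ' : ℝ → ℂ) = derivWithin (θ : ℝ → ℂ) (Ici 0) ∧
    p = (G θ x, - G θ' x - (θ : ℝ → ℂ) 0 • x)}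

/-- `A` is the generator of `G`, i.e. the closure of `A'`. -/
def IsGenerator {k : ℝ → ℂ} {hk : LocallyIntegrableOn k (Ici 0)}
    (G : TestKInf k hk → X →L[ℂ] X) (A : X →ₗ.[ℂ] X) : Prop :=
  (A.graph : Set (X × X)) = closure (preGeneratorGraph G)

end KConv

/-!
Reversing the time turns the dual convolution `k ∘ g` into the ordinary convolution
(`dualConv_sub_left`), and `∫ g (k * u) = ∫ (k ∘ g) u` (`integral_smul_vconv`).  Therefore everything
rests on **Titchmarsh's convolution theorem**: if the origin belongs to the support of `k` and `k * f`
vanishes on an interval `(0, T)`, then so does `f` (`ae_eq_zero_of_conv_eq_zero`).  Its core is that one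
of two functions vanishes near `0` if their convolution does.  The product of their (truncated) Laplace
transforms decays exponentially on the right half-plane; comparing the means of the logarithms over
circles tangent to the imaginary axis, Harnack's inequality shows that one of the factors decays
exponentially on the real axis (`exp_decay_of_mul`), and a function whose Laplace transform decays like
`e^{-cx}` vanishes on `(0, c)` by the theorems of Phragmén–Lindelöf and Liouville
(`ae_eq_zero_of_laplace_le`).

*Existence and uniqueness of `𝒢ₖ`.*  The families `S_{k^{*n}}` are local `k^{*n}`-convoluted semigroups
on `[0, nτ]` with the same generator `A` (`exists_convPow_semigroup`).  The integral which defines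
`𝒢ₖ(f)` does not depend on `n`: on `[0, nτ]` one has `S_{k^{*(n+1)}} = k * S_{k^{*n}}`, while
`W_{k^{*n}} f = k ∘ W_{k^{*(n+1)}} f`, and the two convolutions are transposes of each other.

*Continuity.*  The topology induced by `𝒢ₖ` is locally convex and makes the inclusions continuous, so
that it is one of the topologies of which the inductive limit topology is the infimum.

*Multiplicativity.*  The equation `w = A ∫₀ᵗ w` has only the zero solution (`eq_zero_of_volterra`).  This
identifies `U(t) ∫ g(s) U(s) x ds` for a local convoluted semigroup `U` and a test function `g`
(`apply_vconv`).  Integrating against a second test function `f` yields the pairing of `U` with exactly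
the function whose dual convolution is `(k ∘ f) * (k ∘ g)` (`conv_dualConv_dualConv`).

*Injectivity.*  If `𝒢ₖ(θ) x = 0` for all translates of one nonzero test function, then the convolution of
the orbit of `x` with a function whose support contains the origin vanishes near `0`.  By Titchmarsh's
theorem `S(t) x = 0` for small `t`, so that `(∫₀ᵗ k) x = 0` for small `t`, and `x = 0`.

*The generator.*  Integration by parts gives `A 𝒢ₖ(θ) x = -𝒢ₖ(θ') x - θ(0) x` (`integral_smul_mem_graph`),
whence `A' ⊆ A`.  Conversely, a single test function `η` suffices for `D(A) = Im 𝒢ₖ(η)`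
(`exists_range_eq_domain`).  In fact `(c - A) 𝒢ₖ(η) = η(0) + ∫₀ᵇ p(t) S(t) dt` with
`p = c Wₖη + (Wₖη)'`, which is invertible if `|η(0)|` exceeds `‖p‖₁ sup ‖S(t)‖`; as it commutes with
`𝒢ₖ(η)` and `𝒢ₖ(η)` commutes with `A`, each `x ∈ D(A)` lies in the range of `𝒢ₖ(η)`.  For such an `η`
(`exists_dominant_testFunction`), note that `η(0) = -∫ p (k * e^{c·})`; by Titchmarsh's theorem the
translates of a test function are total, so that `p` can be taken close to `1` in `L¹(0, b)`, and
`∫₀ᵇ k * e^{c·}` is as large as desired for suitable `c`, as the Laplace transform of a nonzero function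
does not decay too fast.
-/

set_option linter.unusedSectionVars false


namespace KConv

/-! ### Harnack's inequality for the logarithm of an entire function -/

/-- The real part of a continuous function on the unit circle is uniformly approximated by real parts
of entire functions, since trigonometric polynomials are dense and `re (c z⁻ᵐ) = re (c̄ zᵐ)` for `|z| = 1`. -/
theorem exists_entire_re_approx_circle (v : C(AddCircle (2 * Real.pi), ℂ)) {ε : ℝ} (hε : 0 < ε) :
    ∃ p : ℂ → ℂ, Differentiable ℂ p ∧ ∀ θ : AddCircle (2 * Real.pi),
      |(p (AddCircle.toCircle θ)).re - (v θ).re| < ε := by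
  have : Fact (0 < 2 * Real.pi) := ⟨Real.two_pi_pos⟩
  have hv : v ∈ (Submodule.span ℂ (range (@fourier (2 * Real.pi)))).topologicalClosure := by
    rw [span_fourier_closure_eq_top]; trivial
  obtain ⟨q, hq, hqv⟩ := Metric.mem_closure_iff.1 hv ε hε
  have key : ∀ c : ℂ, ∃ p : ℂ → ℂ, Differentiable ℂ p ∧ ∀ θ : AddCircle (2 * Real.pi),
      (p (AddCircle.toCircle θ)).re = (c * q θ).re := by
    clear hqv
    induction hq using Submodule.span_induction with
    | mem x hx =>
      obtain ⟨n, rfl⟩ := hx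
      intro c
      obtain ⟨m, rfl | rfl⟩ := n.eq_nat_or_neg
      · refine ⟨fun z => c * z ^ m, by fun_prop, fun θ => ?_⟩
        rw [fourier_apply, AddCircle.toCircle_zsmul]
        simp
      · refine ⟨fun z => (starRingEnd ℂ) c * z ^ m, by fun_prop, fun θ => ?_⟩
        rw [fourier_apply, AddCircle.toCircle_zsmul]
        rw [← Complex.conj_re (c * _)]
        simp only [zpow_neg, zpow_natCast, Circle.coe_inv_eq_conj, Circle.coe_pow, map_pow, map_mul,
          Complex.conj_conj]
    | zero => exact fun c => ⟨0, differentiable_const 0, by simp⟩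
    | add x y _ _ hx hy =>
      intro c
      obtain ⟨p, hp, hp'⟩ := hx c
      obtain ⟨r, hr, hr'⟩ := hy c
      exact ⟨p + r, hp.add hr, fun θ => by simp [mul_add, hp', hr', -Complex.mul_re]⟩
    | smul a x _ hx =>
      intro c
      obtain ⟨p, hp, hp'⟩ := hx (c * a)
      exact ⟨p, hp, fun θ => by simp [hp', mul_assoc, -Complex.mul_re]⟩
  obtain ⟨p, hp, hp'⟩ := key 1
  refine ⟨p, hp, fun θ => ?_⟩
  rw [hp', one_mul, ← Complex.sub_re]
  refine (Complex.abs_re_le_norm _).trans_lt ?_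
  have := ContinuousMap.dist_apply_le_dist (f := v) (g := q) θ
  rw [dist_comm, dist_eq_norm] at this
  exact this.trans_lt hqv

/-- A continuous real function on a circle is uniformly approximated by real parts of entire
functions; this replaces the solution of the Dirichlet problem. -/
theorem exists_entire_re_approx_sphere {u : ℂ → ℝ} (hu : Continuous u) (c : ℂ) {R : ℝ}
    (hR : 0 < R) {ε : ℝ} (hε : 0 < ε) :
    ∃ p : ℂ → ℂ, Differentiable ℂ p ∧ ∀ z ∈ Metric.sphere c R, |(p z).re - u z| < ε := by
  let v : C(AddCircle (2 * Real.pi), ℂ) :=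
    ⟨fun θ => (u (c + R * AddCircle.toCircle θ) : ℂ), by
      have : Continuous (fun θ : AddCircle (2 * Real.pi) => (AddCircle.toCircle θ : ℂ)) :=
        continuous_subtype_val.comp AddCircle.continuous_toCircle
      fun_prop⟩
  obtain ⟨p, hp, hp'⟩ := exists_entire_re_approx_circle v hε
  refine ⟨fun z => p ((z - c) / R), by fun_prop, fun z hz => ?_⟩
  have hR' : (R : ℂ) ≠ 0 := by exact_mod_cast hR.ne'
  have hz1 : ‖(z - c) / R‖ = 1 := by
    rw [mem_sphere_iff_norm] at hz
    rw [norm_div, hz, Complex.norm_real, Real.norm_of_nonneg hR.le, div_self hR.ne']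
  have e := hp' (Complex.arg ((z - c) / R) : ℝ)
  have h2 : ((AddCircle.toCircle ((Complex.arg ((z - c) / R) : ℝ) : AddCircle (2 * Real.pi)) :
      Circle) : ℂ) = (z - c) / R := by
    rw [AddCircle.toCircle_apply_mk, Circle.coe_exp]
    have := Complex.norm_mul_exp_arg_mul_I ((z - c) / R)
    rw [hz1] at this
    simpa [Real.pi_ne_zero] using this
  have h3 : v (Complex.arg ((z - c) / R) : ℝ) = u z := by
    change ((u (c + R * _) : ℝ) : ℂ) = _
    rw [h2, mul_div_cancel₀ _ hR']
    simp
  rw [h2, h3] at e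
  simpa using e

/-- A form of Harnack's inequality for `log ‖F‖`, on a disc tangent to the imaginary axis at the
origin: a nonpositive continuous bound for `log ‖F‖` on the circle propagates to the diameter with
a factor that is linear in `x / R`. -/
theorem norm_le_exp_circleAverage {F : ℂ → ℂ} (hF : Differentiable ℂ F) {u : ℂ → ℝ}
    (hu : Continuous u) {R : ℝ} (hR : 0 < R)
    (hu0 : ∀ z ∈ Metric.sphere (R : ℂ) R, u z ≤ 0)
    (hFu : ∀ z ∈ Metric.sphere (R : ℂ) R, ‖F z‖ ≤ Real.exp (u z)) {x : ℝ} (hx : 0 < x)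
    (hxR : x ≤ R) :
    ‖F x‖ ≤ Real.exp (x / (2 * R) * Real.circleAverage u R R) := by
  have main : ∀ ε : ℝ, 0 < ε →
      ‖F x‖ ≤ Real.exp (x / (2 * R) * Real.circleAverage u R R + 2 * ε) := by
    intro ε hε
    obtain ⟨q, hq, hqu⟩ := exists_entire_re_approx_sphere hu (R : ℂ) hR hε
    have hxb : (x : ℂ) ∈ Metric.ball (R : ℂ) R := by
      rw [mem_ball_iff_norm, ← Complex.ofReal_sub, Complex.norm_real, Real.norm_eq_abs, abs_lt]
      constructor <;> linarith
    -- the maximum principle for `F * exp (-(q + ε))`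
    have hmax : ‖F x * Complex.exp (-(q x + ε))‖ ≤ 1 := by
      have hd : Differentiable ℂ (fun z => F z * Complex.exp (-(q z + ε))) := by fun_prop
      refine Complex.norm_le_of_forall_mem_frontier_norm_le Metric.isBounded_ball hd.diffContOnCl
        (fun z hz => ?_) (subset_closure hxb)
      rw [frontier_ball _ hR.ne'] at hz
      rw [norm_mul, Complex.norm_exp]
      calc ‖F z‖ * Real.exp (-(q z + ε)).re
          ≤ Real.exp (u z) * Real.exp (-(q z + ε)).re := by gcongr; exact hFu z hz
        _ = Real.exp (u z + (-(q z + ε)).re) := (Real.exp_add _ _).symm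
        _ ≤ 1 := by
          rw [Real.exp_le_one_iff]
          have := (abs_lt.1 (hqu z hz)).1
          simp only [Complex.neg_re, Complex.add_re, Complex.ofReal_re]
          linarith
    have h1 : ‖F x‖ ≤ Real.exp ((q x).re + ε) := by
      rw [norm_mul, Complex.norm_exp, ← le_div_iff₀ (Real.exp_pos _), one_div, ← Real.exp_neg]
        at hmax
      simpa using hmax
    refine h1.trans (Real.exp_le_exp.2 ?_)
    -- Harnack for the nonpositive harmonic function `re q - ε`
    have hharm : InnerProductSpace.HarmonicOnNhd (fun z => (q z).re - ε) (Metric.closedBall (R : ℂ) R) := by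
      have hd : Differentiable ℂ (fun z => q z - ε) := by fun_prop
      have := fun z => (hd.analyticAt z).harmonicAt_re
      intro z _
      simpa [Function.comp_def] using this z
    have hP := hharm.circleAverage_re_herglotzRieszKernel_smul hxb
    have hker : ∀ z ∈ Metric.sphere (R : ℂ) R,
        x / (2 * R) ≤ (herglotzRieszKernel (R : ℂ) x z).re := by
      intro z hz
      refine le_trans ?_ (le_re_herglotzRieszKernel hz hxb)
      have : ‖(x : ℂ) - R‖ = R - x := by
        rw [← Complex.ofReal_sub, Complex.norm_real, Real.norm_eq_abs, abs_sub_comm,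
          abs_of_nonneg (by linarith)]
      rw [this, div_le_div_iff₀ (by linarith) (by linarith)]
      nlinarith
    have hsub : ∀ z ∈ Metric.sphere (R : ℂ) R, (q z).re - ε ≤ u z := fun z hz => by
      linarith [(abs_lt.1 (hqu z hz)).2]
    have hcomp : Real.circleAverage ((Complex.re ∘ herglotzRieszKernel (R : ℂ) x) •
        fun z => (q z).re - ε) R R ≤ Real.circleAverage (fun z => x / (2 * R) * u z) R R := by
      refine Real.circleAverage_mono ?_ ?_ ?_
      · apply ContinuousOn.circleIntegrable hR.le
        refine ContinuousOn.smul (Complex.continuous_re.comp_continuousOn ?_) ?_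
        · simpa [abs_of_pos hR] using continuousOn_herglotzRieszKernel_sphere hxb
        · exact ((Complex.continuous_re.comp hq.continuous).sub continuous_const).continuousOn
      · exact (by fun_prop : Continuous fun z => x / (2 * R) * u z).continuousOn.circleIntegrable hR.le
      · intro z hz
        rw [abs_of_pos hR] at hz
        have a := hker z hz
        have b := hsub z hz
        have c := hu0 z hz
        have d : 0 ≤ x / (2 * R) := by positivity
        simp only [Pi.smul_apply', Function.comp_apply, smul_eq_mul]
        nlinarith
    rw [hP] at hcomp
    have : Real.circleAverage (fun z => x / (2 * R) * u z) R R
        = x / (2 * R) * Real.circleAverage u R R := by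
      have := Real.circleAverage_smul (a := x / (2 * R)) (f := u) (c := R) (R := R)
      simpa [Pi.smul_def] using this
    linarith
  refine le_of_forall_pos_le_add fun δ hδ => ?_
  have hc : Tendsto (fun ε : ℝ => Real.exp (x / (2 * R) * Real.circleAverage u R R + 2 * ε))
      (𝓝[>] 0) (𝓝 (Real.exp (x / (2 * R) * Real.circleAverage u R R))) := by
    refine Tendsto.mono_left (Continuous.tendsto' (by fun_prop) _ _ (by simp)) nhdsWithin_le_nhds
  refine le_trans (ge_of_tendsto hc ?_) (by linarith)
  filter_upwards [self_mem_nhdsWithin] with ε hε using main ε hε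

/-! ### Decay of Laplace transforms and supports -/

/-- Two bounded analytic functions on the right half-plane whose product decays exponentially: one
of them decays exponentially along the positive real axis.  On each circle about `R` of radius `R` the
mean of `log ‖F‖ + log ‖G‖` is at most `-T R`, so that one of the two means is at most `-T R / 2`. -/
theorem exp_decay_of_mul {F G : ℂ → ℂ} (hF : Differentiable ℂ F) (hG : Differentiable ℂ G)
    (hF1 : ∀ z : ℂ, 0 ≤ z.re → ‖F z‖ ≤ 1) (hG1 : ∀ z : ℂ, 0 ≤ z.re → ‖G z‖ ≤ 1) {T : ℝ}
    (hT : 0 < T) (hFG : ∀ z : ℂ, 0 ≤ z.re → ‖F z‖ * ‖G z‖ ≤ Real.exp (-T * z.re)) :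
    (∀ x : ℝ, 0 < x → ‖F x‖ ≤ Real.exp (-(T / 4) * x)) ∨
      ∀ x : ℝ, 0 < x → ‖G x‖ ≤ Real.exp (-(T / 4) * x) := by
  have key : ∀ R : ℝ, 0 < R → (∀ x : ℝ, 0 < x → x ≤ R → ‖F x‖ ≤ Real.exp (-(T / 4) * x)) ∨
      ∀ x : ℝ, 0 < x → x ≤ R → ‖G x‖ ≤ Real.exp (-(T / 4) * x) := by
    intro R hR
    -- the logarithms truncated from below at a level that `log ‖F G‖` may reach on the circle
    set δ : ℝ := Real.exp (-T * (2 * R)) with hδ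
    have hδ0 : 0 < δ := Real.exp_pos _
    have hδ1 : δ ≤ 1 := Real.exp_le_one_iff.2 (by nlinarith)
    let u : (ℂ → ℂ) → ℂ → ℝ := fun H z => Real.log (max ‖H z‖ δ)
    have hpos : ∀ (H : ℂ → ℂ) z, 0 < max ‖H z‖ δ := fun H z => lt_max_of_lt_right hδ0
    have hcont : ∀ H : ℂ → ℂ, Differentiable ℂ H → Continuous (u H) := fun H hH =>
      Continuous.log (hH.continuous.norm.max continuous_const) fun z => (hpos H z).ne'
    have hre : ∀ z ∈ Metric.sphere (R : ℂ) R, 0 ≤ z.re ∧ z.re ≤ 2 * R := by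
      intro z hz
      rw [mem_sphere_iff_norm] at hz
      have h1 := Complex.abs_re_le_norm (z - R)
      rw [hz, abs_le] at h1
      simp only [Complex.sub_re, Complex.ofReal_re] at h1
      constructor <;> linarith [h1.1, h1.2]
    have hneg : ∀ H : ℂ → ℂ, (∀ z : ℂ, 0 ≤ z.re → ‖H z‖ ≤ 1) →
        ∀ z ∈ Metric.sphere (R : ℂ) R, u H z ≤ 0 := fun H hH z hz =>
      Real.log_nonpos (hpos H z).le (max_le (hH z (hre z hz).1) hδ1)
    have hbd : ∀ H : ℂ → ℂ, ∀ z ∈ Metric.sphere (R : ℂ) R, ‖H z‖ ≤ Real.exp (u H z) := fun H z _ => by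
      rw [Real.exp_log (hpos H z)]; exact le_max_left _ _
    have hsum : ∀ z ∈ Metric.sphere (R : ℂ) R, u F z + u G z ≤ -T * z.re := by
      intro z hz
      have h0 := hre z hz
      have a1 : max ‖F z‖ δ ≤ 1 := max_le (hF1 z h0.1) hδ1
      have b1 : max ‖G z‖ δ ≤ 1 := max_le (hG1 z h0.1) hδ1
      have hδz : δ ≤ Real.exp (-T * z.re) := Real.exp_le_exp.2 (by nlinarith)
      change Real.log _ + Real.log _ ≤ _
      rw [← Real.log_mul (hpos F z).ne' (hpos G z).ne', Real.log_le_iff_le_exp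
        (mul_pos (hpos F z) (hpos G z))]
      rcases le_total ‖F z‖ δ with h | h
      · rw [max_eq_right h]; nlinarith [hpos G z]
      · rcases le_total ‖G z‖ δ with h' | h'
        · rw [max_eq_right h']; nlinarith [hpos F z]
        · rw [max_eq_left h, max_eq_left h']; exact hFG z h0.1
    have havg : Real.circleAverage (u F) R R + Real.circleAverage (u G) R R ≤ -T * R := by
      rw [← Real.circleAverage_add (hcont F hF).continuousOn.circleIntegrable'
        (hcont G hG).continuousOn.circleIntegrable']
      have hd : Differentiable ℂ (fun z : ℂ => (-T : ℂ) * z) := by fun_prop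
      have hh : Real.circleAverage (fun z : ℂ => ((-T : ℂ) * z).re) R R = ((-T : ℂ) * R).re :=
        InnerProductSpace.HarmonicOnNhd.circleAverage_eq fun z _ => (hd.analyticAt z).harmonicAt_re
      have hre' : ∀ z : ℂ, ((-T : ℂ) * z).re = -T * z.re := fun z => by simp
      have : -T * R = Real.circleAverage (fun z : ℂ => ((-T : ℂ) * z).re) R R := by
        rw [hh, hre', Complex.ofReal_re]
      rw [this]
      refine Real.circleAverage_mono
        ((hcont F hF).add (hcont G hG)).continuousOn.circleIntegrable'
        (Complex.continuous_re.comp hd.continuous).continuousOn.circleIntegrable' fun z hz => ?_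
      rw [abs_of_pos hR] at hz
      rw [hre']
      exact hsum z hz
    rcases le_total (Real.circleAverage (u F) R R) (Real.circleAverage (u G) R R) with h | h
    · left
      intro x hx hxR
      refine (norm_le_exp_circleAverage hF (hcont F hF) hR (hneg F hF1) (hbd F) hx hxR).trans
        (Real.exp_le_exp.2 ?_)
      have : x / (2 * R) * Real.circleAverage (u F) R R ≤ x / (2 * R) * (-T * R / 2) := by
        gcongr; linarith
      refine this.trans (le_of_eq ?_)
      field_simp; ring
    · right
      intro x hx hxR
      refine (norm_le_exp_circleAverage hG (hcont G hG) hR (hneg G hG1) (hbd G) hx hxR).trans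
        (Real.exp_le_exp.2 ?_)
      have : x / (2 * R) * Real.circleAverage (u G) R R ≤ x / (2 * R) * (-T * R / 2) := by
        gcongr; linarith
      refine this.trans (le_of_eq ?_)
      field_simp; ring
  by_contra! hcon
  obtain ⟨⟨x, hx, hx'⟩, y, hy, hy'⟩ := hcon
  rcases key (max x y) (lt_max_of_lt_left hx) with h | h
  · exact absurd (h x hx (le_max_left _ _)) (not_le.2 hx')
  · exact absurd (h y hy (le_max_right _ _)) (not_le.2 hy')

theorem differentiable_integral_exp_mul {f φ : ℝ → ℂ} {a b : ℝ} (hf : IntervalIntegrable f volume a b)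
    (hφ : Continuous φ) :
    Differentiable ℂ fun z : ℂ => ∫ t in a..b, Complex.exp (z * φ t) * f t := by
  intro z₀
  obtain ⟨M, hM⟩ := (isCompact_uIcc (a := a) (b := b)).exists_bound_of_continuousOn hφ.continuousOn
  have hM0 : 0 ≤ M := (norm_nonneg _).trans (hM a left_mem_uIcc)
  have hmeas : ∀ z : ℂ, AEStronglyMeasurable (fun t => Complex.exp (z * φ t) * f t)
      (volume.restrict (uIoc a b)) := fun z =>
    (by fun_prop : Continuous fun t => Complex.exp (z * φ t)).aestronglyMeasurable.mul
      hf.aestronglyMeasurable_restrict_uIoc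
  refine (intervalIntegral.hasDerivAt_integral_of_dominated_loc_of_deriv_le
    (F' := fun z t => φ t * Complex.exp (z * φ t) * f t)
    (bound := fun t => M * Real.exp ((‖z₀‖ + 1) * M) * ‖f t‖)
    (Metric.ball_mem_nhds z₀ one_pos) (Eventually.of_forall hmeas) ?_ ?_ ?_ ?_ ?_).2.differentiableAt
  · exact hf.continuousOn_mul (by fun_prop)
  · exact (by fun_prop : Continuous fun t => φ t * Complex.exp (z₀ * φ t)).aestronglyMeasurable.mul
      hf.aestronglyMeasurable_restrict_uIoc
  · refine Eventually.of_forall fun t ht z hz => ?_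
    have h1 := hM t (uIoc_subset_uIcc ht)
    have h2 : ‖z‖ ≤ ‖z₀‖ + 1 := by
      have := norm_le_norm_add_norm_sub' z z₀
      rw [mem_ball_iff_norm] at hz
      linarith
    rw [norm_mul, norm_mul]
    gcongr
    refine (Complex.norm_exp_le_exp_norm _).trans (Real.exp_le_exp.2 ?_)
    rw [norm_mul]
    gcongr
  · exact hf.norm.const_mul _
  · refine Eventually.of_forall fun t _ z _ => ?_
    have := ((hasDerivAt_id z).mul_const (φ t)).cexp.mul_const (f t)
    simpa [mul_comm, mul_left_comm, mul_assoc] using this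

/-- An integrable function on `(0, c)` that is orthogonal to all exponentials vanishes, by the density
of trigonometric polynomials. -/
theorem ae_eq_zero_of_integral_exp_eq_zero {f : ℝ → ℂ} {c : ℝ} (hf : IntervalIntegrable f volume 0 c)
    (h : ∀ z : ℂ, ∫ t in (0 : ℝ)..c, Complex.exp (z * t) * f t = 0) :
    ∀ᵐ t ∂(volume.restrict (Ioo 0 c)), f t = 0 := by
  rcases le_or_gt c 0 with hc | hc
  · simp [Ioo_eq_empty (not_lt.2 hc)]
  have : Fact (0 < c) := ⟨hc⟩
  have hfI : IntegrableOn f (Ioo 0 c) :=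
    ((intervalIntegrable_iff_integrableOn_Ioc_of_le hc.le).1 hf).mono_set Ioo_subset_Ioc_self
  rw [ae_restrict_iff' measurableSet_Ioo]
  refine isOpen_Ioo.ae_eq_zero_of_integral_contDiff_smul_eq_zero hfI.locallyIntegrableOn
    fun g hg hgc hgs => ?_
  have hg0 : ∀ t ∉ Ioo 0 c, g t = 0 := fun t ht => by
    by_contra hne
    exact ht (hgs (subset_tsupport g hne))
  let v : C(AddCircle c, ℂ) := ⟨AddCircle.liftIco c 0 fun t => (g t : ℂ), by
    refine AddCircle.liftIco_continuous ?_ ?_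
    · simp [hg0]
    · exact (Complex.continuous_ofReal.comp hg.continuous).continuousOn⟩
  have hvg : ∀ t ∈ Ioo 0 c, v (t : AddCircle c) = g t := fun t ht => by
    change AddCircle.liftIco c 0 (fun t => (g t : ℂ)) t = _
    exact AddCircle.liftIco_coe_apply ⟨ht.1.le, by simpa using ht.2⟩
  have hcont : ∀ q : C(AddCircle c, ℂ), Continuous fun t : ℝ => q (t : AddCircle c) := fun q =>
    q.continuous.comp (AddCircle.continuous_mk' c)
  have hint : ∀ q : C(AddCircle c, ℂ), IntervalIntegrable (fun t => q (t : AddCircle c) * f t) volume 0 c :=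
    fun q => hf.continuousOn_mul (hcont q).continuousOn
  have hspan : ∀ q ∈ Submodule.span ℂ (range (@fourier c)),
      ∫ t in (0 : ℝ)..c, q (t : AddCircle c) * f t = 0 := by
    intro q hq
    induction hq using Submodule.span_induction with
    | mem x hx =>
      obtain ⟨n, rfl⟩ := hx
      rw [← h (2 * Real.pi * Complex.I * n / c)]
      congr 1 with t
      rw [fourier_coe_apply]
      congr 2
      ring
    | zero => simp
    | add x y _ _ hx hy =>
      simp only [ContinuousMap.add_apply, add_mul]
      rw [intervalIntegral.integral_add (hint x) (hint y), hx, hy, add_zero]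
    | smul a x _ hx =>
      simp only [ContinuousMap.smul_apply, smul_eq_mul, mul_assoc]
      rw [intervalIntegral.integral_const_mul, hx, mul_zero]
  have hv : v ∈ (Submodule.span ℂ (range (@fourier c))).topologicalClosure := by
    rw [span_fourier_closure_eq_top]; trivial
  have hv0 : ∫ t in (0 : ℝ)..c, v (t : AddCircle c) * f t = 0 := by
    rw [← norm_le_zero_iff]
    refine le_of_forall_pos_le_add fun ε hε => ?_
    set N := ∫ t in (0 : ℝ)..c, ‖f t‖ with hN
    have hN0 : 0 ≤ N := intervalIntegral.integral_nonneg hc.le fun t _ => norm_nonneg _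
    obtain ⟨q, hq, hqv⟩ := Metric.mem_closure_iff.1 hv (ε / (N + 1)) (by positivity)
    have e : ∫ t in (0 : ℝ)..c, v (t : AddCircle c) * f t
        = ∫ t in (0 : ℝ)..c, (v (t : AddCircle c) - q (t : AddCircle c)) * f t := by
      simp only [sub_mul]
      rw [intervalIntegral.integral_sub (hint v) (hint q), hspan q hq, sub_zero]
    rw [e, zero_add]
    calc _ ≤ ∫ t in (0 : ℝ)..c, ε / (N + 1) * ‖f t‖ := by
          refine intervalIntegral.norm_integral_le_of_norm_le hc.le ?_ (hf.norm.const_mul _)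
          refine Eventually.of_forall fun t _ => ?_
          rw [norm_mul]
          gcongr
          rw [← dist_eq_norm]
          exact (ContinuousMap.dist_apply_le_dist _).trans hqv.le
      _ = ε * (N / (N + 1)) := by
          rw [intervalIntegral.integral_const_mul, ← hN]; ring
      _ ≤ ε * 1 := by
          gcongr
          rw [div_le_one (by positivity)]; linarith
      _ = ε := mul_one _
  have : ∫ t, g t • f t = ∫ t in Ioo 0 c, g t • f t := by
    rw [← integral_indicator measurableSet_Ioo]
    congr 1 with t
    by_cases ht : t ∈ Ioo 0 c
    · rw [indicator_of_mem ht]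
    · rw [indicator_of_notMem ht, hg0 t ht, zero_smul]
  rw [this, ← hv0, intervalIntegral.integral_of_le hc.le, integral_Ioc_eq_integral_Ioo]
  refine setIntegral_congr_fun measurableSet_Ioo fun t ht => ?_
  simp only [hvg t ht, Complex.real_smul]

/-- If the Laplace transform of an integrable function on `[0, T]` is `O(exp (-c x))` on the positive
real axis, then the function vanishes on `(0, c)`.  The entire function
`F(z) = ∫₀ᶜ exp (z (c - t)) f(t) dt` is bounded on the left half-plane, on the positive real axis by
hypothesis, and hence everywhere; so it is constant, with limit zero at `-∞`. -/
theorem ae_eq_zero_of_laplace_le {f : ℝ → ℂ} {T c C : ℝ} (hf : IntervalIntegrable f volume 0 T)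
    (hc : 0 ≤ c) (hcT : c ≤ T)
    (h : ∀ x : ℝ, 0 < x →
      ‖∫ t in (0 : ℝ)..T, Complex.exp (x * -t) * f t‖ ≤ C * Real.exp (-c * x)) :
    ∀ᵐ t ∂(volume.restrict (Ioo 0 c)), f t = 0 := by
  have hT : 0 ≤ T := hc.trans hcT
  have hsub : ∀ {a b}, 0 ≤ a → a ≤ b → b ≤ T → IntervalIntegrable f volume a b :=
    fun {a b} ha hab hb => hf.mono_set (by
      rw [uIcc_of_le hab, uIcc_of_le hT]; exact Icc_subset_Icc ha hb)
  have hf1 : IntervalIntegrable f volume 0 c := hsub le_rfl hc hcT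
  have hf2 : IntervalIntegrable f volume c T := hsub hc hcT le_rfl
  set F : ℂ → ℂ := fun z => ∫ t in (0 : ℝ)..c, Complex.exp (z * ((c : ℂ) - t)) * f t with hF
  have hFd : Differentiable ℂ F :=
    differentiable_integral_exp_mul hf1 (φ := fun t => (c : ℂ) - t) (by fun_prop)
  set N := ∫ t in (0 : ℝ)..c, ‖f t‖ with hN
  have hre : ∀ (z : ℂ) (t : ℝ), (z * ((c : ℂ) - t)).re = z.re * (c - t) := fun z t => by
    rw [← Complex.ofReal_sub, Complex.re_mul_ofReal]
  have hgrow : ∀ (z : ℂ) (B : ℝ), (∀ t ∈ Ioc 0 c, z.re * (c - t) ≤ B) → ‖F z‖ ≤ Real.exp B * N := by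
    intro z B hB
    rw [hN, ← intervalIntegral.integral_const_mul]
    refine intervalIntegral.norm_integral_le_of_norm_le hc ?_ (hf1.norm.const_mul _)
    refine Eventually.of_forall fun t ht => ?_
    rw [norm_mul, Complex.norm_exp, hre]
    gcongr
    exact hB t ht
  have hleft : ∀ z : ℂ, z.re ≤ 0 → ‖F z‖ ≤ N := fun z hz => by
    simpa using hgrow z 0 fun t ht => mul_nonpos_of_nonpos_of_nonneg hz (by linarith [ht.2])
  have hreal : ∀ x : ℝ, 0 < x → ‖F x‖ ≤ C + ∫ t in c..T, ‖f t‖ := by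
    intro x hx
    have hI : ∀ {a b : ℝ}, IntervalIntegrable f volume a b →
        IntervalIntegrable (fun t : ℝ => Complex.exp (x * -t) * f t) volume a b := fun hab =>
      hab.continuousOn_mul (by fun_prop)
    have e : F x = Complex.exp (c * x) * (∫ t in (0 : ℝ)..T, Complex.exp (x * -t) * f t)
        - Complex.exp (c * x) * ∫ t in c..T, Complex.exp (x * -t) * f t := by
      rw [← mul_sub, ← intervalIntegral.integral_add_adjacent_intervals (hI hf1) (hI hf2),
        add_sub_cancel_right, ← intervalIntegral.integral_const_mul]
      refine intervalIntegral.integral_congr fun t _ => ?_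
      rw [← mul_assoc, ← Complex.exp_add]
      congr 2; ring
    rw [e]
    have hE : ‖Complex.exp (c * x)‖ = Real.exp (c * x) := by
      rw [Complex.norm_exp, ← Complex.ofReal_mul, Complex.ofReal_re]
    refine (norm_sub_le _ _).trans (add_le_add ?_ ?_)
    · rw [norm_mul, hE]
      calc _ ≤ Real.exp (c * x) * (C * Real.exp (-c * x)) := by gcongr; exact h x hx
        _ = C * Real.exp (c * x + -c * x) := by rw [Real.exp_add]; ring
        _ = C := by simp
    · rw [← intervalIntegral.integral_const_mul]
      refine intervalIntegral.norm_integral_le_of_norm_le hcT ?_ hf2.norm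
      refine Eventually.of_forall fun t ht => ?_
      rw [← mul_assoc, norm_mul, norm_mul, hE, Complex.norm_exp]
      have : ((x : ℂ) * -t).re = -(x * t) := by simp
      rw [this, ← Real.exp_add]
      refine mul_le_of_le_one_left (norm_nonneg _) (Real.exp_le_one_iff.2 ?_)
      nlinarith [ht.1]
  have hright : ∀ z : ℂ, 0 ≤ z.re → ‖F z‖ ≤ N := by
    intro z hz
    refine PhragmenLindelof.right_half_plane_of_bounded_on_real hFd.diffContOnCl
      ⟨1, by norm_num, c, ?_⟩ ?_ (fun x => hleft _ (by simp)) hz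
    · refine Asymptotics.IsBigO.of_bound N (Eventually.of_forall fun w => ?_)
      rw [Real.rpow_one, Real.norm_of_nonneg (Real.exp_pos _).le, mul_comm]
      refine hgrow w _ fun t ht => ?_
      have := Complex.abs_re_le_norm w
      rw [abs_le] at this
      have h1 : c - t ≤ c := by linarith [ht.1]
      have h2 : 0 ≤ c - t := by linarith [ht.2]
      nlinarith [norm_nonneg w]
    · refine ⟨C + ∫ t in c..T, ‖f t‖, ?_⟩
      rw [eventually_map]
      filter_upwards [eventually_gt_atTop 0] with x hx using hreal x hx
  have hconst : ∀ z, F z = F 0 := fun z => hFd.apply_eq_apply_of_bounded (by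
    rw [isBounded_iff_forall_norm_le]
    refine ⟨N, ?_⟩
    rintro _ ⟨w, rfl⟩
    rcases le_total 0 w.re with h | h
    exacts [hright w h, hleft w h]) _ _
  -- the constant is zero, by letting `z → -∞`
  have hlim : Tendsto (fun n : ℕ => F (-(n : ℂ))) atTop (𝓝 0) := by
    have : Tendsto (fun n : ℕ => ∫ t in (0 : ℝ)..c, Complex.exp (-(n : ℂ) * ((c : ℂ) - t)) * f t)
        atTop (𝓝 (∫ t in (0 : ℝ)..c, 0)) := by
      refine intervalIntegral.tendsto_integral_filter_of_dominated_convergence (fun t => ‖f t‖)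
        (Eventually.of_forall fun n => ?_) (Eventually.of_forall fun n => ?_) hf1.norm ?_
      · exact (hf1.continuousOn_mul (by fun_prop)).aestronglyMeasurable_restrict_uIoc
      · refine Eventually.of_forall fun t ht => ?_
        rw [uIoc_of_le hc] at ht
        rw [norm_mul, Complex.norm_exp, hre]
        refine mul_le_of_le_one_left (norm_nonneg _) (Real.exp_le_one_iff.2 ?_)
        simp only [Complex.neg_re, Complex.natCast_re]
        nlinarith [ht.2, (Nat.cast_nonneg n : (0 : ℝ) ≤ n)]
      · have hne : ∀ᵐ t : ℝ, t ≠ c := by simp [ae_iff, measure_singleton]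
        filter_upwards [hne] with t htc ht
        rw [uIoc_of_le hc] at ht
        have hpos : 0 < c - t := sub_pos.2 (lt_of_le_of_ne ht.2 htc)
        rw [← zero_mul (f t)]
        refine Tendsto.mul_const _ ?_
        rw [tendsto_zero_iff_norm_tendsto_zero]
        simp only [Complex.norm_exp, hre, Complex.neg_re, Complex.natCast_re, neg_mul]
        refine Real.tendsto_exp_neg_atTop_nhds_zero.comp ?_
        exact tendsto_natCast_atTop_atTop.atTop_mul_const hpos
    simpa only [intervalIntegral.integral_zero] using this
  have h0 : F 0 = 0 := by
    refine tendsto_nhds_unique ?_ hlim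
    simp only [hconst (-_)]
    exact tendsto_const_nhds
  refine ae_eq_zero_of_integral_exp_eq_zero hf1 fun z => ?_
  have := (hconst (-z)).trans h0
  have e : F (-z) = Complex.exp (-z * c) * ∫ t in (0 : ℝ)..c, Complex.exp (z * t) * f t := by
    rw [← intervalIntegral.integral_const_mul]
    refine intervalIntegral.integral_congr fun t _ => ?_
    rw [← mul_assoc, ← Complex.exp_add]
    congr 2; ring
  rw [e] at this
  simpa using this

/-! ### Convolution with vector-valued functions -/

section Toolkit

variable {E : Type*} [NormedAddCommGroup E]

/-- Bounded, almost everywhere strongly measurable functions on `[0, T]`.  For these the convolution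
with an integrable kernel is defined at every point, and not only almost everywhere. -/
structure BddMeasOn (T : ℝ) (u : ℝ → E) : Prop where
  aesm : AEStronglyMeasurable u (volume.restrict (Icc 0 T))
  bdd : ∃ C, ∀ t ∈ Icc 0 T, ‖u t‖ ≤ C

theorem _root_.ContinuousOn.bddMeasOn {T : ℝ} {u : ℝ → E} (hu : ContinuousOn u (Icc 0 T)) :
    BddMeasOn T u :=
  ⟨hu.aestronglyMeasurable measurableSet_Icc, isCompact_Icc.exists_bound_of_continuousOn hu⟩

theorem BddMeasOn.mono {T T' : ℝ} {u : ℝ → E} (hu : BddMeasOn T u) (h : T' ≤ T) :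
    BddMeasOn T' u :=
  ⟨hu.aesm.mono_set (Icc_subset_Icc_right h), hu.bdd.imp fun _ hC t ht => hC t ⟨ht.1, ht.2.trans h⟩⟩

theorem BddMeasOn.integrableOn {T : ℝ} {u : ℝ → E} (hu : BddMeasOn T u) :
    IntegrableOn u (Icc 0 T) := by
  obtain ⟨C, hC⟩ := hu.bdd
  exact Integrable.of_bound hu.aesm C
    ((ae_restrict_iff' measurableSet_Icc).2 (Eventually.of_forall hC))

/-- Truncation of a function to `[0, T]`. -/
noncomputable def trunc (T : ℝ) (u : ℝ → E) : ℝ → E := (Icc 0 T).indicator u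

theorem trunc_eqOn (T : ℝ) (u : ℝ → E) : EqOn (trunc T u) u (Icc 0 T) := fun _ ht =>
  indicator_of_mem ht _

theorem trunc_of_neg (T : ℝ) (u : ℝ → E) : ∀ t < 0, trunc T u t = 0 := fun _ ht =>
  indicator_of_notMem (fun h => absurd h.1 (not_le.2 ht)) _

theorem trunc_of_gt (T : ℝ) (u : ℝ → E) : ∀ t, T < t → trunc T u t = 0 := fun _ ht =>
  indicator_of_notMem (fun h => absurd h.2 (not_le.2 ht)) _

theorem integrable_trunc {T : ℝ} {u : ℝ → E} (hu : IntegrableOn u (Icc 0 T)) :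
    Integrable (trunc T u) := hu.integrable_indicator measurableSet_Icc

theorem BddMeasOn.norm_trunc_le {T : ℝ} {u : ℝ → E} (hu : BddMeasOn T u) :
    ∃ C, 0 ≤ C ∧ ∀ t, ‖trunc T u t‖ ≤ C := by
  obtain ⟨C, hC⟩ := hu.bdd
  refine ⟨max C 0, le_max_right _ _, fun t => ?_⟩
  by_cases ht : t ∈ Icc 0 T
  · rw [trunc_eqOn T u ht]; exact (hC t ht).trans (le_max_left _ _)
  · rw [trunc, indicator_of_notMem ht]; simp

variable [NormedSpace ℂ E]

/-- The convolution `(k * u)(t) = ∫₀ᵗ k(t - s) u(s) ds` of a scalar kernel with a vector-valued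
function on `[0, ∞)`; for `E = ℂ` it is `conv`. -/
noncomputable def vconv (k : ℝ → ℂ) (u : ℝ → E) (t : ℝ) : E := ∫ s in (0 : ℝ)..t, k (t - s) • u s

theorem conv_eq_vconv (f g : ℝ → ℂ) : conv f g = vconv f g := rfl

theorem vconv_zero_right (k : ℝ → ℂ) (u : ℝ → E) : vconv k u 0 = 0 := by simp [vconv]

theorem vconv_congr {k k' : ℝ → ℂ} {u u' : ℝ → E} {t : ℝ} (ht : 0 ≤ t)
    (hk : EqOn k k' (Icc 0 t)) (hu : EqOn u u' (Icc 0 t)) : vconv k u t = vconv k' u' t := by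
  refine intervalIntegral.integral_congr fun s hs => ?_
  rw [uIcc_of_le ht] at hs
  simp only [hu hs, hk ⟨sub_nonneg.2 hs.2, by linarith [hs.1]⟩]

theorem vconv_eq_integral_swap (k : ℝ → ℂ) (u : ℝ → E) (t : ℝ) :
    vconv k u t = ∫ r in (0 : ℝ)..t, k r • u (t - r) := by
  have := intervalIntegral.integral_comp_sub_left (a := 0) (b := t) (fun s => k (t - s) • u s) t
  simp only [sub_sub_cancel, sub_self, sub_zero] at this
  exact this.symm

theorem conv_comm (f g : ℝ → ℂ) : conv f g = conv g f := by
  ext t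
  rw [conv_eq_vconv, vconv_eq_integral_swap, conv_eq_vconv, vconv]
  simp only [smul_eq_mul, mul_comm]

theorem vconv_eq_convolution {f : ℝ → ℂ} {w : ℝ → E} (hf : ∀ t < 0, f t = 0)
    (hw : ∀ t < 0, w t = 0) {t : ℝ} (ht : 0 ≤ t) :
    vconv f w t = convolution f w (ContinuousLinearMap.lsmul ℂ ℂ) volume t := by
  rw [vconv_eq_integral_swap, convolution_def, intervalIntegral.integral_of_le ht,
    ← integral_Icc_eq_integral_Ioc, ← integral_indicator measurableSet_Icc]
  congr 1 with r
  by_cases hr : r ∈ Icc 0 t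
  · rw [indicator_of_mem hr]; rfl
  · rw [indicator_of_notMem hr]
    rcases lt_or_ge r 0 with h | h
    · simp [hf r h]
    · simp [hw (t - r) (by by_contra h'; exact hr ⟨h, by linarith⟩)]

theorem convolution_eq_zero_of_neg {f : ℝ → ℂ} {w : ℝ → E} (hf : ∀ t < 0, f t = 0)
    (hw : ∀ t < 0, w t = 0) {t : ℝ} (ht : t < 0) :
    convolution f w (ContinuousLinearMap.lsmul ℂ ℂ) volume t = 0 := by
  rw [convolution_def]
  refine integral_eq_zero_of_ae (Eventually.of_forall fun r => ?_)
  rcases lt_or_ge r 0 with h | h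
  · simp [hf r h]
  · simp [hw (t - r) (by linarith)]

/-- On `[0, T]` the convolution is the convolution over the whole line of the truncated functions. -/
theorem vconv_eq_convolution_trunc {k : ℝ → ℂ} {u : ℝ → E} {T t : ℝ} (ht : t ∈ Icc 0 T) :
    vconv k u t
      = convolution (trunc T k) (trunc T u) (ContinuousLinearMap.lsmul ℂ ℂ) volume t := by
  rw [← vconv_eq_convolution (trunc_of_neg _ _) (trunc_of_neg _ _) ht.1]
  have hsub : Icc 0 t ⊆ Icc 0 T := Icc_subset_Icc_right ht.2
  exact vconv_congr ht.1 ((trunc_eqOn T k).symm.mono hsub) ((trunc_eqOn T u).symm.mono hsub)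

theorem integrableOn_conv {f g : ℝ → ℂ} {T : ℝ} (hf : IntegrableOn f (Icc 0 T))
    (hg : IntegrableOn g (Icc 0 T)) : IntegrableOn (conv f g) (Icc 0 T) := by
  refine (((integrable_trunc hf).integrable_convolution (ContinuousLinearMap.lsmul ℂ ℂ)
    (integrable_trunc hg)).integrableOn (s := Icc 0 T)).congr_fun (fun t ht => ?_) measurableSet_Icc
  rw [conv_eq_vconv, vconv_eq_convolution_trunc ht]

theorem bddMeasOn_integrable_conv {k : ℝ → ℂ} {u : ℝ → E} {T : ℝ} (hk : IntegrableOn k (Icc 0 T))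
    (hu : BddMeasOn T u) {t : ℝ} (ht : t ∈ Icc 0 T) :
    IntervalIntegrable (fun s => k (t - s) • u s) volume 0 t := by
  obtain ⟨C, hC0, hC⟩ := hu.norm_trunc_le
  rw [intervalIntegrable_iff_integrableOn_Ioc_of_le ht.1]
  have h1 : Integrable (fun s => trunc T k (t - s)) := (integrable_trunc hk).comp_sub_left t
  have h2 : Integrable (fun s => trunc T k (t - s) • trunc T u s) :=
    h1.smul_bdd C (integrable_trunc hu.integrableOn).aestronglyMeasurable (Eventually.of_forall hC)
  refine h2.integrableOn.congr_fun (fun s hs => ?_) measurableSet_Ioc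
  simp only
  rw [trunc_eqOn T k ⟨sub_nonneg.2 hs.2, by linarith [hs.1, ht.2]⟩,
    trunc_eqOn T u ⟨hs.1.le, hs.2.trans ht.2⟩]

theorem vconv_add_right {k : ℝ → ℂ} {u v : ℝ → E} {T : ℝ} (hk : IntegrableOn k (Icc 0 T))
    (hu : BddMeasOn T u) (hv : BddMeasOn T v) {t : ℝ} (ht : t ∈ Icc 0 T) :
    vconv k (fun s => u s + v s) t = vconv k u t + vconv k v t := by
  simp only [vconv, smul_add]
  exact intervalIntegral.integral_add (bddMeasOn_integrable_conv hk hu ht)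
    (bddMeasOn_integrable_conv hk hv ht)

theorem vconv_sub_right {k : ℝ → ℂ} {u v : ℝ → E} {T : ℝ} (hk : IntegrableOn k (Icc 0 T))
    (hu : BddMeasOn T u) (hv : BddMeasOn T v) {t : ℝ} (ht : t ∈ Icc 0 T) :
    vconv k (fun s => u s - v s) t = vconv k u t - vconv k v t := by
  simp only [vconv, smul_sub]
  exact intervalIntegral.integral_sub (bddMeasOn_integrable_conv hk hu ht)
    (bddMeasOn_integrable_conv hk hv ht)

theorem vconv_smul_const [CompleteSpace E] (k f : ℝ → ℂ) (x : E) (t : ℝ) :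
    vconv k (fun s => f s • x) t = conv k f t • x := by
  simp only [vconv, conv, smul_smul]
  exact intervalIntegral.integral_smul_const _ _

theorem norm_vconv_le {k : ℝ → ℂ} {u : ℝ → E} {T C : ℝ} (hk : IntegrableOn k (Icc 0 T))
    (hu : ∀ t ∈ Icc 0 T, ‖u t‖ ≤ C) (hC : 0 ≤ C) {t : ℝ} (ht : t ∈ Icc 0 T) :
    ‖vconv k u t‖ ≤ C * ∫ s in Icc 0 T, ‖k s‖ := by
  rw [vconv_eq_integral_swap, intervalIntegral.integral_of_le ht.1, ← integral_const_mul]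
  refine (norm_integral_le_integral_norm _).trans ?_
  have hsub : Ioc 0 t ⊆ Icc 0 T := fun s hs => ⟨hs.1.le, hs.2.trans ht.2⟩
  refine le_trans ?_ (setIntegral_mono_set (hk.norm.const_mul C)
    (Eventually.of_forall fun s => by positivity) (Eventually.of_forall hsub))
  refine integral_mono_of_nonneg (Eventually.of_forall fun _ => norm_nonneg _)
    (IntegrableOn.mono_set (hk.norm.const_mul C) hsub) ?_
  refine (ae_restrict_iff' measurableSet_Ioc).2 (Eventually.of_forall fun s hs => ?_)
  simp only [norm_smul]
  rw [mul_comm]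
  gcongr
  exact hu _ ⟨by linarith [hs.2], by linarith [hs.1, ht.2]⟩

theorem _root_.ContinuousLinearMap.map_vconv {F : Type*} [NormedAddCommGroup F] [NormedSpace ℂ F]
    [CompleteSpace E] [CompleteSpace F] (L : E →L[ℂ] F) {k : ℝ → ℂ} {u : ℝ → E} {T : ℝ}
    (hk : IntegrableOn k (Icc 0 T)) (hu : BddMeasOn T u) {t : ℝ} (ht : t ∈ Icc 0 T) :
    L (vconv k u t) = vconv k (fun s => L (u s)) t := by
  have := L.intervalIntegral_comp_comm (bddMeasOn_integrable_conv hk hu ht)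
  simpa [vconv] using this.symm

theorem continuousOn_vconv {k : ℝ → ℂ} {u : ℝ → E} {T : ℝ} (hk : IntegrableOn k (Icc 0 T))
    (hu : ContinuousOn u (Icc 0 T)) : ContinuousOn (vconv k u) (Icc 0 T) := by
  rcases lt_or_ge T 0 with hT | hT
  · simp [Icc_eq_empty (not_le.2 hT)]
  set w : ℝ → E := IccExtend hT ((Icc 0 T).domRestrict u) with hw
  have hwc : Continuous w := hu.domRestrict.Icc_extend'
  obtain ⟨C, hC⟩ := isCompact_Icc.exists_bound_of_continuousOn hu
  have hwC : ∀ t, ‖w t‖ ≤ C := fun t => hC _ (projIcc 0 T hT t).2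
  have hcont : Continuous fun t => ∫ r, (Iic t).indicator (fun r => trunc T k r • w (t - r)) r := by
    refine continuous_iff_continuousAt.2 fun t₀ => ?_
    refine continuousAt_of_dominated (bound := fun r => ‖trunc T k r‖ * C)
      (Eventually.of_forall fun t => ?_) (Eventually.of_forall fun t => Eventually.of_forall fun r => ?_)
      ((integrable_trunc hk).norm.mul_const _) ?_
    · exact ((integrable_trunc hk).aestronglyMeasurable.smul
        (hwc.comp (by fun_prop : Continuous fun r => t - r)).aestronglyMeasurable).indicator
        measurableSet_Iic
    · refine (norm_indicator_le_norm_self _ _).trans ?_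
      rw [norm_smul]
      gcongr
      exact hwC _
    · have hne : ∀ᵐ r : ℝ, r ≠ t₀ := by simp [ae_iff, measure_singleton]
      filter_upwards [hne] with r hr
      have hc : ContinuousAt (fun t => trunc T k r • w (t - r)) t₀ :=
        (continuous_const.smul (hwc.comp (by fun_prop : Continuous fun t => t - r))).continuousAt
      rcases lt_or_gt_of_ne hr with h | h
      · refine hc.congr ?_
        filter_upwards [lt_mem_nhds h] with t ht
        rw [indicator_of_mem (show r ∈ Iic t from ht.le)]
      · refine (continuousAt_const (y := (0 : E))).congr ?_
        filter_upwards [gt_mem_nhds h] with t ht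
        rw [indicator_of_notMem (show r ∉ Iic t from not_le.2 ht)]
  refine hcont.continuousOn.congr fun t ht => ?_
  rw [vconv_eq_integral_swap, intervalIntegral.integral_of_le ht.1, ← integral_Icc_eq_integral_Ioc,
    ← integral_indicator measurableSet_Icc]
  congr 1 with r
  by_cases hr : r ∈ Icc 0 t
  · rw [indicator_of_mem hr, indicator_of_mem (show r ∈ Iic t from hr.2),
      trunc_eqOn T k ⟨hr.1, hr.2.trans ht.2⟩]
    congr 1
    have : t - r ∈ Icc 0 T := ⟨by linarith [hr.2], by linarith [hr.1, ht.2]⟩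
    rw [hw, IccExtend_of_mem _ _ this]
    rfl
  · rw [indicator_of_notMem hr]
    by_cases h : r ≤ t
    · rw [indicator_of_mem (show r ∈ Iic t from h),
        trunc_of_neg T k r (by by_contra h'; exact hr ⟨not_lt.1 h', h⟩), zero_smul]
    · rw [indicator_of_notMem (show r ∉ Iic t from h)]

theorem BddMeasOn.vconv {k : ℝ → ℂ} {u : ℝ → E} {T : ℝ} (hk : IntegrableOn k (Icc 0 T))
    (hu : BddMeasOn T u) : BddMeasOn T (vconv k u) := by
  refine ⟨?_, ?_⟩
  · refine (((integrable_trunc hk).integrable_convolution (ContinuousLinearMap.lsmul ℂ ℂ)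
      (integrable_trunc hu.integrableOn)).aestronglyMeasurable.mono_measure
        (Measure.restrict_le_self (s := Icc 0 T))).congr ?_
    refine (ae_restrict_iff' measurableSet_Icc).2 (Eventually.of_forall fun t ht => ?_)
    rw [vconv_eq_convolution_trunc ht]
  · obtain ⟨C, hC⟩ := hu.bdd
    exact ⟨_, fun t ht => norm_vconv_le hk (fun s hs => (hC s hs).trans (le_max_left C 0))
      (le_max_right C 0) ht⟩

/-- Associativity of the convolution, at every point of `[0, T]`. -/
theorem vconv_vconv [CompleteSpace E] {k l : ℝ → ℂ} {u : ℝ → E} {T : ℝ}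
    (hk : IntegrableOn k (Icc 0 T)) (hl : IntegrableOn l (Icc 0 T)) (hu : BddMeasOn T u) {t : ℝ}
    (ht : t ∈ Icc 0 T) : vconv k (vconv l u) t = vconv (conv k l) u t := by
  set f := trunc T k
  set g := trunc T l
  set w := trunc T u
  have hf : Integrable f := integrable_trunc hk
  have hg : Integrable g := integrable_trunc hl
  have hw : Integrable w := integrable_trunc hu.integrableOn
  obtain ⟨C, hC0, hC⟩ := hu.norm_trunc_le
  have hsub : Icc 0 t ⊆ Icc 0 T := Icc_subset_Icc_right ht.2
  have hassoc := convolution_assoc (f := f) (g := g) (k := w) (μ := volume) (ν := volume) (x₀ := t)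
    (ContinuousLinearMap.lsmul ℂ ℂ) (ContinuousLinearMap.lsmul ℂ ℂ) (ContinuousLinearMap.lsmul ℂ ℂ)
    (ContinuousLinearMap.lsmul ℂ ℂ) (fun x y z => mul_smul x y z) hf.aestronglyMeasurable
    hg.aestronglyMeasurable hw.aestronglyMeasurable (hf.ae_convolution_exists _ hg)
    (hg.norm.ae_convolution_exists _ hw.norm) (by
      refine BddAbove.convolutionExistsAt _ (s := univ) ?_ MeasurableSet.univ (subset_univ _)
        hf.norm.integrableOn (hg.norm.integrable_convolution _ hw.norm).aestronglyMeasurable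
      refine ⟨(∫ r, ‖g r‖) * C, ?_⟩
      rintro _ ⟨r, _, rfl⟩
      simp only
      rw [convolution_def, ← integral_mul_const]
      refine norm_integral_le_of_norm_le (hg.norm.mul_const C) (Eventually.of_forall fun s => ?_)
      simp only [ContinuousLinearMap.mul_apply', norm_mul, norm_norm]
      gcongr
      exact hC _)
  have h1 : vconv k (vconv l u) t = convolution f (convolution g w (ContinuousLinearMap.lsmul ℂ ℂ)
      volume) (ContinuousLinearMap.lsmul ℂ ℂ) volume t := by
    rw [← vconv_eq_convolution (trunc_of_neg _ _)
      (fun s hs => convolution_eq_zero_of_neg (trunc_of_neg _ _) (trunc_of_neg _ _) hs) ht.1]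
    refine vconv_congr ht.1 ((trunc_eqOn T k).symm.mono hsub) fun s hs => ?_
    exact vconv_eq_convolution_trunc (hsub hs)
  have h2 : vconv (conv k l) u t = convolution (convolution f g (ContinuousLinearMap.lsmul ℂ ℂ)
      volume) w (ContinuousLinearMap.lsmul ℂ ℂ) volume t := by
    rw [← vconv_eq_convolution
      (fun s hs => convolution_eq_zero_of_neg (trunc_of_neg _ _) (trunc_of_neg _ _) hs)
      (trunc_of_neg _ _) ht.1]
    refine vconv_congr ht.1 (fun s hs => ?_) ((trunc_eqOn T u).symm.mono hsub)
    exact vconv_eq_convolution_trunc (hsub hs)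
  rw [h1, h2, hassoc]

theorem vconv_one (u : ℝ → E) (t : ℝ) : vconv (fun _ => 1) u t = ∫ s in (0 : ℝ)..t, u s := by
  simp [vconv]

/-- Splitting a convolution at the point `T`. -/
theorem vconv_add_arg {k : ℝ → ℂ} {u : ℝ → E} {T r : ℝ} (hT : 0 ≤ T) (hr : 0 ≤ r)
    (hk : IntegrableOn k (Icc 0 (T + r))) (hu : BddMeasOn (T + r) u) :
    vconv k u (T + r)
      = (∫ s in (0 : ℝ)..T, k (T + r - s) • u s) + vconv k (fun s => u (T + s)) r := by
  have hI := bddMeasOn_integrable_conv hk hu (right_mem_Icc.2 (by linarith : 0 ≤ T + r))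
  have h0 : (0 : ℝ) ≤ T + r := by linarith
  have h1 : IntervalIntegrable (fun s => k (T + r - s) • u s) volume 0 T := hI.mono_set (by
    rw [uIcc_of_le hT, uIcc_of_le h0]; exact Icc_subset_Icc le_rfl (by linarith))
  have h2 : IntervalIntegrable (fun s => k (T + r - s) • u s) volume T (T + r) := hI.mono_set (by
    rw [uIcc_of_le (by linarith), uIcc_of_le h0]; exact Icc_subset_Icc hT le_rfl)
  rw [vconv, ← intervalIntegral.integral_add_adjacent_intervals h1 h2]
  congr 1
  have := intervalIntegral.integral_comp_add_left (a := 0) (b := r)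
    (fun s => k (T + r - s) • u s) T
  simp only [add_zero, add_sub_add_left_eq_sub] at this
  exact this.symm

end Toolkit

/-! ### Titchmarsh's convolution theorem -/

/-- The Laplace transform turns convolutions into products. -/
theorem laplace_convolution {f g : ℝ → ℂ} (hf : Integrable f) (hg : Integrable g) {T : ℝ}
    (hf0 : ∀ t < 0, f t = 0) (hg0 : ∀ t < 0, g t = 0) (hfT : ∀ t, T < t → f t = 0)
    (hgT : ∀ t, T < t → g t = 0) (z : ℂ) :
    (∫ t : ℝ, Complex.exp (z * -t) * f t) * ∫ t : ℝ, Complex.exp (z * -t) * g t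
      = ∫ t : ℝ, Complex.exp (z * -t)
        * convolution f g (ContinuousLinearMap.lsmul ℂ ℂ) volume t := by
  have hI : ∀ h : ℝ → ℂ, Integrable h → (∀ t < 0, h t = 0) → (∀ t, T < t → h t = 0) →
      Integrable fun t : ℝ => Complex.exp (z * -t) * h t := by
    intro h hh h0 hT
    refine (integrableOn_iff_integrable_of_support_subset (s := Icc 0 T) fun t ht => ?_).1
      (hh.integrableOn.continuousOn_mul (by fun_prop) isCompact_Icc)
    by_contra h'
    refine ht ?_
    simp only [mem_Icc, not_and_or, not_le] at h'
    rcases h' with h' | h' <;> simp [h0, hT, h']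
  have := integral_convolution (ContinuousLinearMap.lsmul ℂ ℂ) (hI f hf hf0 hfT) (hI g hg hg0 hgT)
  rw [ContinuousLinearMap.lsmul_apply, smul_eq_mul] at this
  rw [← this]
  refine integral_congr_ae (Eventually.of_forall fun t => ?_)
  simp only [convolution_def, ContinuousLinearMap.lsmul_apply, smul_eq_mul]
  rw [← integral_const_mul]
  refine integral_congr_ae (Eventually.of_forall fun s => ?_)
  simp only
  rw [mul_mul_mul_comm, ← Complex.exp_add]
  congr 2
  push_cast
  ring

/-- The core of Titchmarsh's theorem: if a convolution vanishes near the origin, then so does one of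
the factors.  The Laplace transforms `F`, `G` are bounded on the right half-plane and `F G` decays
exponentially there, so that one of them decays exponentially on the positive real axis. -/
theorem ae_eq_zero_near_zero_of_conv {f g : ℝ → ℂ} {T : ℝ} (hT : 0 < T)
    (hf : IntegrableOn f (Icc 0 T)) (hg : IntegrableOn g (Icc 0 T))
    (h : ∀ᵐ t ∂(volume.restrict (Ioo 0 T)), conv f g t = 0) :
    (∀ᵐ t ∂(volume.restrict (Ioo 0 (T / 4))), f t = 0) ∨
      ∀ᵐ t ∂(volume.restrict (Ioo 0 (T / 4))), g t = 0 := by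
  -- the truncated functions, with `L¹` norm at most one after division by `M`
  set M : (ℝ → ℂ) → ℝ := fun h => (∫ t, ‖trunc T h t‖) + 1 with hM
  have hMpos : ∀ h, 0 < M h := fun h => by
    have : 0 ≤ ∫ t, ‖trunc T h t‖ := integral_nonneg fun _ => norm_nonneg _
    simp only [hM]; linarith
  set Lp : (ℝ → ℂ) → ℂ → ℂ := fun h z => (M h : ℂ)⁻¹ * ∫ t in (0 : ℝ)..T, Complex.exp (z * -t) * h t
    with hLp
  have hii : ∀ h : ℝ → ℂ, IntegrableOn h (Icc 0 T) → IntervalIntegrable h volume 0 T := fun h hh =>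
    by
    rw [intervalIntegrable_iff_integrableOn_Ioc_of_le hT.le]
    exact hh.mono_set Ioc_subset_Icc_self
  have hLd : ∀ h : ℝ → ℂ, IntegrableOn h (Icc 0 T) → Differentiable ℂ (Lp h) := fun h hh =>
    (differentiable_integral_exp_mul (hii h hh) (φ := fun t => -(t : ℂ)) (by fun_prop)).const_mul _
  have hLtr : ∀ h z, Lp h z = (M h : ℂ)⁻¹ * ∫ t : ℝ, Complex.exp (z * -t) * trunc T h t := by
    intro h z
    simp only [hLp]
    rw [intervalIntegral.integral_of_le hT.le, ← integral_Icc_eq_integral_Ioc,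
      ← integral_indicator measurableSet_Icc]
    congr 2 with t
    by_cases ht : t ∈ Icc 0 T <;> simp [trunc, ht]
  have hnM : ∀ h, ‖(M h : ℂ)⁻¹‖ = (M h)⁻¹ := fun h => by
    rw [norm_inv, Complex.norm_real, Real.norm_of_nonneg (hMpos h).le]
  have hexp : ∀ (z : ℂ) (t : ℝ), ‖Complex.exp (z * -t)‖ = Real.exp (-(z.re * t)) := fun z t => by
    rw [Complex.norm_exp]; simp
  have hL1 : ∀ h : ℝ → ℂ, IntegrableOn h (Icc 0 T) → ∀ z : ℂ, 0 ≤ z.re → ‖Lp h z‖ ≤ 1 := by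
    intro h hh z hz
    rw [hLtr, norm_mul, hnM, inv_mul_le_iff₀ (hMpos h), mul_one]
    refine (norm_integral_le_of_norm_le (integrable_trunc hh).norm
      (Eventually.of_forall fun t => ?_)).trans (by simp only [hM]; linarith)
    rw [norm_mul, hexp]
    rcases lt_or_ge t 0 with ht | ht
    · simp [trunc_of_neg T h t ht]
    · exact mul_le_of_le_one_left (norm_nonneg _) (Real.exp_le_one_iff.2 (by nlinarith))
  have hff := integrable_trunc hf
  have hgg := integrable_trunc hg
  set w := convolution (trunc T f) (trunc T g) (ContinuousLinearMap.lsmul ℂ ℂ) volume with hw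
  have hwi : Integrable w := hff.integrable_convolution _ hgg
  have hw0 : ∀ᵐ t, t < T → w t = 0 := by
    have hne : ∀ᵐ t : ℝ, t ≠ 0 := by simp [ae_iff, measure_singleton]
    filter_upwards [(ae_restrict_iff' measurableSet_Ioo).1 h, hne] with t ht ht0 htT
    rcases lt_or_gt_of_ne ht0 with h0 | h0
    · exact convolution_eq_zero_of_neg (trunc_of_neg _ _) (trunc_of_neg _ _) h0
    · rw [← ht ⟨h0, htT⟩, conv_eq_vconv, vconv_eq_convolution_trunc ⟨h0.le, htT.le⟩]
  have hwn : ∫ t, ‖w t‖ ≤ (∫ t, ‖trunc T f t‖) * ∫ t, ‖trunc T g t‖ := by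
    have := integral_convolution (ContinuousLinearMap.lsmul ℝ ℝ) hff.norm hgg.norm
    rw [ContinuousLinearMap.lsmul_apply, smul_eq_mul] at this
    rw [← this]
    refine integral_mono hwi.norm (hff.norm.integrable_convolution _ hgg.norm) fun t => ?_
    simp only [hw, convolution_def]
    refine (norm_integral_le_integral_norm _).trans (le_of_eq ?_)
    simp
  have hprod : ∀ z : ℂ, 0 ≤ z.re → ‖Lp f z‖ * ‖Lp g z‖ ≤ Real.exp (-T * z.re) := by
    intro z hz
    rw [← norm_mul, hLtr, hLtr, mul_mul_mul_comm, laplace_convolution hff hgg (trunc_of_neg _ _)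
      (trunc_of_neg _ _) (trunc_of_gt _ _) (trunc_of_gt _ _), norm_mul, norm_mul, hnM, hnM,
      ← mul_inv, inv_mul_le_iff₀ (mul_pos (hMpos f) (hMpos g))]
    have : ‖∫ t : ℝ, Complex.exp (z * -t) * w t‖ ≤ ∫ t, Real.exp (-T * z.re) * ‖w t‖ := by
      refine norm_integral_le_of_norm_le (hwi.norm.const_mul _) ?_
      filter_upwards [hw0] with t ht
      rw [norm_mul, hexp]
      rcases lt_or_ge t T with h' | h'
      · simp [ht h']
      · gcongr; nlinarith
    rw [integral_const_mul] at this
    refine this.trans ?_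
    rw [mul_comm]
    gcongr
    refine hwn.trans ?_
    simp only [hM]
    have a : 0 ≤ ∫ t, ‖trunc T f t‖ := integral_nonneg fun _ => norm_nonneg _
    have b : 0 ≤ ∫ t, ‖trunc T g t‖ := integral_nonneg fun _ => norm_nonneg _
    nlinarith
  have hend : ∀ h : ℝ → ℂ, IntegrableOn h (Icc 0 T) →
      (∀ x : ℝ, 0 < x → ‖Lp h x‖ ≤ Real.exp (-(T / 4) * x)) →
      ∀ᵐ t ∂(volume.restrict (Ioo 0 (T / 4))), h t = 0 := by
    intro h hh hx
    refine ae_eq_zero_of_laplace_le (hii h hh) (by linarith) (by linarith) (C := M h) fun x hx0 => ?_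
    have := hx x hx0
    rwa [hLp, norm_mul, hnM, inv_mul_le_iff₀ (hMpos h)] at this
  exact (exp_decay_of_mul (hLd f hf) (hLd g hg) (hL1 f hf) (hL1 g hg) hT hprod).imp
    (hend f hf) (hend g hg)

/-- If `f` vanishes on `(0, s)`, then the translate of `k * f` by `s` is the convolution of `k` with the
translate of `f`. -/
theorem conv_add_arg_of_ae_eq_zero {k f : ℝ → ℂ} {s t : ℝ} (hs : 0 ≤ s) (ht : 0 ≤ t)
    (hf : ∀ᵐ r ∂(volume.restrict (Ioo 0 s)), f r = 0) :
    conv k f (s + t) = conv k (fun r => f (s + r)) t := by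
  have h1 : ∫ r in Ioc 0 (s + t), k (s + t - r) * f r = ∫ r in Ioc s (s + t), k (s + t - r) * f r := by
    refine setIntegral_eq_of_subset_of_ae_sdiff_eq_zero measurableSet_Ioc.nullMeasurableSet
      (Ioc_subset_Ioc_left hs) ?_
    have hne : ∀ᵐ r : ℝ, r ≠ s := by simp [ae_iff, measure_singleton]
    filter_upwards [(ae_restrict_iff' measurableSet_Ioo).1 hf, hne] with r hr hrs hmem
    rw [hr ⟨hmem.1.1, lt_of_le_of_ne ?_ hrs⟩, mul_zero]
    by_contra h'
    exact hmem.2 ⟨not_le.1 h', hmem.1.2⟩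
  rw [conv, intervalIntegral.integral_of_le (by linarith), h1,
    ← intervalIntegral.integral_of_le (by linarith), conv]
  have := intervalIntegral.integral_comp_add_left (a := 0) (b := t)
    (fun r => k (s + t - r) * f r) s
  simp only [add_zero, add_sub_add_left_eq_sub] at this
  exact this.symm

theorem integrableOn_comp_add_left {E : Type*} [NormedAddCommGroup E] {f : ℝ → E} {a T : ℝ}
    (ha : 0 ≤ a) (hf : IntegrableOn f (Icc 0 T)) :
    IntegrableOn (fun t => f (a + t)) (Icc 0 (T - a)) := by
  have h1 : Integrable (fun t => trunc T f (a + t)) := (integrable_trunc hf).comp_add_left a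
  refine h1.integrableOn.congr_fun (fun t ht => ?_) measurableSet_Icc
  exact trunc_eqOn T f ⟨by linarith [ht.1], by linarith [ht.2]⟩

/-- **Titchmarsh's convolution theorem**, for a kernel whose support contains the origin.  If `(0, s)` is
the largest interval where `f` vanishes and `s < T`, the translate `f (s + ·)` contradicts the version
of the theorem near the origin. -/
theorem ae_eq_zero_of_conv_eq_zero {k f : ℝ → ℂ} {T : ℝ} (hk0 : ZeroMemSupp k)
    (hk : IntegrableOn k (Icc 0 T)) (hf : IntegrableOn f (Icc 0 T))
    (h : ∀ᵐ t ∂(volume.restrict (Ioo 0 T)), conv k f t = 0) :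
    ∀ᵐ t ∂(volume.restrict (Ioo 0 T)), f t = 0 := by
  rcases le_or_gt T 0 with hT | hT
  · simp [Ioo_eq_empty (not_lt.2 hT)]
  set A : Set ℝ := {a | a ∈ Icc 0 T ∧ ∀ᵐ t ∂(volume.restrict (Ioo 0 a)), f t = 0} with hA
  have hA0 : (0 : ℝ) ∈ A := ⟨⟨le_rfl, hT.le⟩, by simp⟩
  have hAb : BddAbove A := ⟨T, fun a ha => ha.1.2⟩
  set s := sSup A with hs
  have hs0 : 0 ≤ s := le_csSup hAb hA0
  have hsT : s ≤ T := csSup_le ⟨0, hA0⟩ fun a ha => ha.1.2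
  have hsA : ∀ᵐ t ∂(volume.restrict (Ioo 0 s)), f t = 0 := by
    obtain ⟨u, -, hu, huA⟩ := exists_seq_tendsto_sSup ⟨0, hA0⟩ hAb
    have hall : ∀ᵐ t, ∀ n, t ∈ Ioo 0 (u n) → f t = 0 :=
      ae_all_iff.2 fun n => (ae_restrict_iff' measurableSet_Ioo).1 (huA n).2
    refine (ae_restrict_iff' measurableSet_Ioo).2 (hall.mono fun t ht hts => ?_)
    obtain ⟨n, hn⟩ := (hu.eventually (lt_mem_nhds hts.2)).exists
    exact ht n ⟨hts.1, hn⟩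
  rcases eq_or_lt_of_le hsT with hsT' | hsT'
  · rwa [← hsT']
  exfalso
  -- the shifted function `f (s + ·)` has the origin in its support
  have hconv : ∀ᵐ t ∂(volume.restrict (Ioo 0 (T - s))), conv k (fun r => f (s + r)) t = 0 := by
    have h1 := (measurePreserving_add_left volume s).quasiMeasurePreserving.ae
      ((ae_restrict_iff' measurableSet_Ioo).1 h)
    refine (ae_restrict_iff' measurableSet_Ioo).2 (h1.mono fun t ht htm => ?_)
    rw [← conv_add_arg_of_ae_eq_zero hs0 htm.1.le hsA]
    exact ht ⟨by linarith [htm.1], by linarith [htm.2]⟩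
  rcases ae_eq_zero_near_zero_of_conv (sub_pos.2 hsT')
    (hk.mono_set (Icc_subset_Icc_right (by linarith))) (integrableOn_comp_add_left hs0 hf) hconv
    with hz | hz
  · exact hk0 _ (by linarith) hz
  · have : s + (T - s) / 4 ∈ A := by
      refine ⟨⟨by linarith, by linarith⟩, (ae_restrict_iff' measurableSet_Ioo).2 ?_⟩
      have h1 := (measurePreserving_sub_right volume s).quasiMeasurePreserving.ae
        ((ae_restrict_iff' measurableSet_Ioo).1 hz)
      have hne : ∀ᵐ t : ℝ, t ≠ s := by simp [ae_iff, measure_singleton]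
      filter_upwards [h1, hne, (ae_restrict_iff' measurableSet_Ioo).1 hsA] with t ht hts hts' htm
      rcases lt_or_gt_of_ne hts with h' | h'
      · exact hts' ⟨htm.1, h'⟩
      · have := ht ⟨by linarith, by linarith [htm.2]⟩
        simpa using this
    have := le_csSup hAb this
    linarith

theorem _root_.MeasureTheory.LocallyIntegrableOn.integrableOn_Icc {E : Type*}
    [NormedAddCommGroup E] {k : ℝ → E} (hk : LocallyIntegrableOn k (Ici 0)) (T : ℝ) :
    IntegrableOn k (Icc 0 T) :=
  hk.integrableOn_compact_subset (fun _ hx => hx.1) isCompact_Icc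

theorem locallyIntegrableOn_of_forall_Icc {E : Type*}
    [NormedAddCommGroup E] {k : ℝ → E} (hk : ∀ T, IntegrableOn k (Icc 0 T)) :
    LocallyIntegrableOn k (Ici 0) := by
  intro x hx
  refine ⟨Icc 0 (x + 1), ?_, hk _⟩
  have : Iic (x + 1) ∈ 𝓝[Ici 0] x := mem_nhdsWithin_of_mem_nhds (Iic_mem_nhds (by linarith))
  filter_upwards [this, self_mem_nhdsWithin] with y hy hy' using ⟨hy', hy⟩

theorem ZeroMemSupp.conv {k l : ℝ → ℂ} (hk : LocallyIntegrableOn k (Ici 0))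
    (hl : LocallyIntegrableOn l (Ici 0)) (hk0 : ZeroMemSupp k) (hl0 : ZeroMemSupp l) :
    ZeroMemSupp (conv k l) := fun ε hε h =>
  hl0 ε hε (ae_eq_zero_of_conv_eq_zero hk0 (hk.integrableOn_Icc ε) (hl.integrableOn_Icc ε) h)

theorem zeroMemSupp_one : ZeroMemSupp fun _ => 1 := fun ε hε h => by
  have h0 : volume.restrict (Ioo 0 ε) = 0 := ae_eq_bot.1 (eventually_false_iff_eq_bot.1
    (h.mono fun _ ht => one_ne_zero ht))
  rw [Measure.restrict_eq_zero, Real.volume_Ioo, sub_zero, ENNReal.ofReal_eq_zero] at h0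
  linarith

/-- The origin belongs to the support of all convolution powers, by Titchmarsh's theorem. -/
theorem ZeroMemSupp.convPow {k : ℝ → ℂ} (hk : LocallyIntegrableOn k (Ici 0)) (hk0 : ZeroMemSupp k) :
    ∀ n, 1 ≤ n → ZeroMemSupp (convPow k n)
  | 1, _ => hk0
  | n + 2, _ => hk0.conv hk (convPow_locallyIntegrableOn hk (n + 1))
      (ZeroMemSupp.convPow hk hk0 (n + 1) (by omega))

theorem conv_one_left (k : ℝ → ℂ) (t : ℝ) : conv (fun _ => 1) k t = ∫ s in (0 : ℝ)..t, k s := by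
  simp [conv]

/-- Titchmarsh's theorem for continuous functions with values in a Banach space. -/
theorem eqOn_zero_of_vconv_eq_zero {E : Type*} [NormedAddCommGroup E] [NormedSpace ℂ E]
    [CompleteSpace E] {k : ℝ → ℂ} {u : ℝ → E} {T : ℝ} (hT : 0 < T) (hk0 : ZeroMemSupp k)
    (hk : IntegrableOn k (Icc 0 T)) (hu : ContinuousOn u (Icc 0 T))
    (h : ∀ t ∈ Ioo 0 T, vconv k u t = 0) : ∀ t ∈ Icc 0 T, u t = 0 := by
  intro t ht
  refine SeparatingDual.eq_zero_of_forall_dual_eq_zero (R := ℂ) fun l => ?_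
  have hlu : ContinuousOn (fun s => l (u s)) (Icc 0 T) := l.continuous.comp_continuousOn hu
  have h0 : ∀ᵐ s ∂(volume.restrict (Ioo 0 T)), l (u s) = 0 := by
    refine ae_eq_zero_of_conv_eq_zero hk0 hk (hlu.integrableOn_compact isCompact_Icc) ?_
    refine (ae_restrict_iff' measurableSet_Ioo).2 (Eventually.of_forall fun s hs => ?_)
    rw [conv_eq_vconv, ← l.map_vconv hk hu.bddMeasOn (Ioo_subset_Icc_self hs), h s hs, map_zero]
  have h1 : (fun s => l (u s)) =ᵐ[volume.restrict (Icc 0 T)] fun _ => 0 := by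
    rwa [← Measure.restrict_congr_set Ioo_ae_eq_Icc]
  exact Measure.eqOn_Icc_of_ae_eq volume hT.ne h1 hlu continuousOn_const ht

/-! ### Primitives and the uniqueness of solutions -/

section Prim

variable {E : Type*} [NormedAddCommGroup E] [NormedSpace ℂ E]

/-- The primitive `∫₀ᵗ u(s) ds`. -/
noncomputable def prim (u : ℝ → E) (t : ℝ) : E := ∫ s in (0 : ℝ)..t, u s

theorem prim_eq_vconv (u : ℝ → E) : prim u = vconv (fun _ => 1) u :=
  funext fun t => (vconv_one u t).symm

theorem prim_zero (u : ℝ → E) : prim u 0 = 0 := by simp [prim]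

theorem integrableOn_one (T : ℝ) : IntegrableOn (fun _ : ℝ => (1 : ℂ)) (Icc 0 T) :=
  continuousOn_const.integrableOn_compact isCompact_Icc

theorem intervalIntegrable_of_Icc {u : ℝ → E} {T a b : ℝ} (hu : IntegrableOn u (Icc 0 T))
    (ha : a ∈ Icc 0 T) (hb : b ∈ Icc 0 T) : IntervalIntegrable u volume a b :=
  (hu.mono_set (uIcc_subset_Icc ha hb)).intervalIntegrable

theorem continuousOn_prim {u : ℝ → E} {T : ℝ} (hu : IntegrableOn u (Icc 0 T)) :
    ContinuousOn (prim u) (Icc 0 T) := by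
  have := intervalIntegral.continuousOn_primitive hu
  refine this.congr fun t ht => ?_
  rw [prim, intervalIntegral.integral_of_le ht.1]

theorem prim_add_arg {u : ℝ → E} {a t : ℝ} (ha : 0 ≤ a) (ht : 0 ≤ t)
    (hu : IntegrableOn u (Icc 0 (a + t))) :
    prim (fun s => u (a + s)) t = prim u (a + t) - prim u a := by
  have h0 : (0 : ℝ) ∈ Icc 0 (a + t) := ⟨le_rfl, by linarith⟩
  have h1 : a ∈ Icc 0 (a + t) := ⟨ha, by linarith⟩
  have h2 : a + t ∈ Icc 0 (a + t) := ⟨by linarith, le_rfl⟩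
  have := intervalIntegral.integral_comp_add_left (a := 0) (b := t) u a
  rw [add_zero] at this
  rw [prim, this, prim, prim, ← intervalIntegral.integral_add_adjacent_intervals
    (intervalIntegrable_of_Icc hu h0 h1) (intervalIntegrable_of_Icc hu h1 h2), add_sub_cancel_left]

variable [CompleteSpace E]

theorem prim_vconv {k : ℝ → ℂ} {u : ℝ → E} {T : ℝ} (hk : IntegrableOn k (Icc 0 T))
    (hu : BddMeasOn T u) {t : ℝ} (ht : t ∈ Icc 0 T) :
    prim (vconv k u) t = vconv k (prim u) t := by
  rw [prim_eq_vconv, prim_eq_vconv, vconv_vconv (integrableOn_one T) hk hu ht,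
    vconv_vconv hk (integrableOn_one T) hu ht, conv_comm]

theorem conv_prim {f g : ℝ → ℂ} {T : ℝ} (hf : IntegrableOn f (Icc 0 T))
    (hg : IntegrableOn g (Icc 0 T)) {t : ℝ} (ht : t ∈ Icc 0 T) :
    conv f (prim g) t = prim (conv f g) t := by
  have h1 : BddMeasOn T fun _ : ℝ => (1 : ℂ) := continuousOn_const.bddMeasOn
  rw [prim_eq_vconv, prim_eq_vconv, ← conv_eq_vconv, ← conv_eq_vconv, conv_comm _ g,
    conv_comm _ (conv f g), conv_eq_vconv f, conv_eq_vconv g, vconv_vconv hf hg h1 ht]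
  rfl

theorem conv_prim_comm {f g : ℝ → ℂ} {T : ℝ} (hf : IntegrableOn f (Icc 0 T))
    (hg : IntegrableOn g (Icc 0 T)) {t : ℝ} (ht : t ∈ Icc 0 T) :
    conv f (prim g) t = conv g (prim f) t := by
  rw [conv_prim hf hg ht, conv_prim hg hf ht, conv_comm]

theorem vconv_const (k : ℝ → ℂ) (x : E) (t : ℝ) : vconv k (fun _ => x) t = prim k t • x := by
  have := vconv_smul_const k (fun _ => 1) x t
  simp only [one_smul] at this
  rw [this, conv_comm, conv_one_left, prim]

/-- Convolution with a function that vanishes on `[0, T]`.  The maximum covers both the times `t ≤ T`,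
where both sides are zero, and the times `t ≥ T`. -/
theorem vconv_of_eqOn_zero {k : ℝ → ℂ} {u : ℝ → E} {T T' t : ℝ} (hT : 0 ≤ T)
    (ht : t ∈ Icc 0 T') (hk : IntegrableOn k (Icc 0 T')) (hu : BddMeasOn T' u)
    (hu0 : ∀ s ∈ Icc 0 T, u s = 0) :
    vconv k u t = vconv k (fun s => u (T + s)) (max (t - T) 0) := by
  rcases le_total t T with h | h
  · rw [max_eq_right (by linarith), vconv_zero_right,
      vconv_congr (u' := fun _ => 0) ht.1 (fun _ _ => rfl) fun s hs => hu0 s ⟨hs.1, hs.2.trans h⟩]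
    simp [vconv]
  · have e : t = T + (t - T) := by ring
    rw [max_eq_left (by linarith), e, vconv_add_arg hT (by linarith)
      (hk.mono_set (Icc_subset_Icc_right (by linarith [ht.2]))) (hu.mono (by linarith [ht.2])), ← e,
      add_eq_right]
    refine (intervalIntegral.integral_congr fun s hs => ?_).trans intervalIntegral.integral_zero
    rw [uIcc_of_le hT] at hs
    simp [hu0 s hs]

theorem hasDerivAt_prim {u : ℝ → E} {T : ℝ} (hu : ContinuousOn u (Icc 0 T)) {t : ℝ} (ht : t ∈ Ioo 0 T) :
    HasDerivAt (prim u) (u t) t := by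
  have h0 : (0 : ℝ) ∈ Icc 0 T := ⟨le_rfl, (ht.1.trans ht.2).le⟩
  refine intervalIntegral.integral_hasDerivAt_right
    (intervalIntegrable_of_Icc (hu.integrableOn_compact isCompact_Icc) h0 (Ioo_subset_Icc_self ht))
    ?_ (hu.continuousAt (Icc_mem_nhds ht.1 ht.2))
  exact (hu.mono Ioo_subset_Icc_self).stronglyMeasurableAtFilter isOpen_Ioo t ht

end Prim

section Graph

variable {X : Type*} [NormedAddCommGroup X] [NormedSpace ℂ X] [CompleteSpace X]

/-- No integrability is required, as the integral of a non-integrable function is zero. -/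
theorem _root_.Submodule.intervalIntegral_mem {M : Submodule ℂ X} (hM : IsClosed (M : Set X))
    {f : ℝ → X} {a b : ℝ} (hab : a ≤ b) (h : ∀ s ∈ Icc a b, f s ∈ M) :
    ∫ s in a..b, f s ∈ M := by
  by_cases hf : IntervalIntegrable f volume a b
  · have : IsClosed (M : Set X) := hM
    rw [← Submodule.Quotient.mk_eq_zero, ← Submodule.mkQ_apply, ← Submodule.mkQL_apply,
      ← M.mkQL.intervalIntegral_comp_comm hf]
    refine (intervalIntegral.integral_congr fun s hs => ?_).trans intervalIntegral.integral_zero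
    rw [uIcc_of_le hab] at hs
    simpa using h s hs
  · rw [intervalIntegral.integral_undef hf]; exact M.zero_mem

theorem vconv_mem_graph {A : X →ₗ.[ℂ] X} (hA : A.IsClosed) {k : ℝ → ℂ} {u v : ℝ → X} {T : ℝ}
    (hk : IntegrableOn k (Icc 0 T)) (hu : BddMeasOn T u) (hv : BddMeasOn T v)
    (h : ∀ s ∈ Icc 0 T, (u s, v s) ∈ A.graph) {t : ℝ} (ht : t ∈ Icc 0 T) :
    (vconv k u t, vconv k v t) ∈ A.graph := by
  have hw : BddMeasOn T fun s => (u s, v s) := by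
    obtain ⟨C, hC⟩ := hu.bdd
    obtain ⟨D, hD⟩ := hv.bdd
    exact ⟨hu.aesm.prodMk hv.aesm, max C D, fun s hs => max_le_max (hC s hs) (hD s hs)⟩
  have h1 : vconv k (fun s => (u s, v s)) t ∈ A.graph :=
    Submodule.intervalIntegral_mem hA ht.1 fun s hs =>
      A.graph.smul_mem _ (h s ⟨hs.1, hs.2.trans ht.2⟩)
  have e1 := (ContinuousLinearMap.fst ℂ X X).map_vconv hk hw ht
  have e2 := (ContinuousLinearMap.snd ℂ X X).map_vconv hk hw ht
  have : vconv k (fun s => (u s, v s)) t = (vconv k u t, vconv k v t) := Prod.ext e1 e2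
  rwa [this] at h1

theorem prim_mem_graph {A : X →ₗ.[ℂ] X} (hA : A.IsClosed) {u v : ℝ → X} {T : ℝ}
    (hu : BddMeasOn T u) (hv : BddMeasOn T v)
    (h : ∀ s ∈ Icc 0 T, (u s, v s) ∈ A.graph) {t : ℝ} (ht : t ∈ Icc 0 T) :
    (prim u t, prim v t) ∈ A.graph := by
  rw [prim_eq_vconv, prim_eq_vconv]
  exact vconv_mem_graph hA (integrableOn_one T) hu hv h ht

/-- A function that is continuous in the first variable and Lipschitz in the second one is
continuous along continuous curves. -/
theorem continuousOn_apply_of_lipschitz {V : ℝ → X → X} {y : ℝ → X} {s : Set ℝ} {C : ℝ}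
    (hC : ∀ t ∈ s, ∀ x x', ‖V t x - V t x'‖ ≤ C * ‖x - x'‖)
    (hV : ∀ x, ContinuousOn (fun t => V t x) s) (hy : ContinuousOn y s) :
    ContinuousOn (fun t => V t (y t)) s := by
  intro t₀ ht₀
  have h1 : Tendsto (fun t => V t (y t₀)) (𝓝[s] t₀) (𝓝 (V t₀ (y t₀))) := hV _ t₀ ht₀
  have h2 : Tendsto (fun t => C * ‖y t - y t₀‖) (𝓝[s] t₀) (𝓝 0) := by
    have : Tendsto (fun t => y t - y t₀) (𝓝[s] t₀) (𝓝 (y t₀ - y t₀)) := (hy t₀ ht₀).sub_const _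
    simpa using this.norm.const_mul C
  have h3 : Tendsto (fun t => V t (y t) - V t (y t₀)) (𝓝[s] t₀) (𝓝 0) := by
    refine squeeze_zero_norm' ?_ h2
    filter_upwards [self_mem_nhdsWithin] with t ht using hC t ht _ _
  have := h3.add h1
  simpa [ContinuousWithinAt] using this

end Graph

namespace IsLocalConvolutedSemigroup

variable {X : Type*} [NormedAddCommGroup X] [NormedSpace ℂ X] [CompleteSpace X]
  {k : ℝ → ℂ} {T : ℝ} {U : ℝ → X →L[ℂ] X} {A : X →ₗ.[ℂ] X}

theorem exists_bound (hU : IsLocalConvolutedSemigroup k T U A) :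
    ∃ C, 0 ≤ C ∧ ∀ t ∈ Icc 0 T, ‖U t‖ ≤ C := by
  obtain ⟨C, hC⟩ := banach_steinhaus (g := fun t : Icc 0 T => U t) fun x => by
    obtain ⟨C, hC⟩ := isCompact_Icc.exists_bound_of_continuousOn (hU.strongly_continuous x)
    exact ⟨C, fun t => hC t t.2⟩
  exact ⟨max C 0, le_max_right _ _, fun t ht => (hC ⟨t, ht⟩).trans (le_max_left _ _)⟩

theorem bddMeasOn (hU : IsLocalConvolutedSemigroup k T U A) (x : X) :
    BddMeasOn T fun t => U t x := (hU.strongly_continuous x).bddMeasOn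

theorem mem_graph (hU : IsLocalConvolutedSemigroup k T U A) {t : ℝ} (ht : t ∈ Icc 0 T) {x y : X}
    (h : (x, y) ∈ A.graph) : (U t x, U t y) ∈ A.graph := by
  obtain ⟨z, hz1, hz2⟩ := A.mem_graph_iff.1 h
  simp only at hz1 hz2
  subst hz1 hz2
  exact hU.commutes t ht z

theorem apply_zero (hU : IsLocalConvolutedSemigroup k T U A) (hT : 0 ≤ T) (x : X) : U 0 x = 0 := by
  have := hU.duhamel 0 ⟨le_rfl, hT⟩ x
  simp only [intervalIntegral.integral_same, zero_smul, sub_zero] at this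
  exact A.graph_fst_eq_zero_snd this rfl

theorem prim_apply_of_mem_graph (hU : IsLocalConvolutedSemigroup k T U A) {t : ℝ}
    (ht : t ∈ Icc 0 T) {x y : X} (h : (x, y) ∈ A.graph) :
    prim (fun s => U s y) t = U t x - prim k t • x :=
  A.mem_graph_snd_inj (prim_mem_graph hU.isClosed (hU.bddMeasOn x) (hU.bddMeasOn y)
    (fun _ hs => hU.mem_graph hs h) ht) (hU.duhamel t ht x) rfl

theorem norm_prim_apply_le {C : ℝ} (hC0 : 0 ≤ C)
    (hC : ∀ t ∈ Icc 0 T, ‖U t‖ ≤ C) {t : ℝ} (ht : t ∈ Icc 0 T) (x : X) :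
    ‖prim (fun s => U s x) t‖ ≤ C * T * ‖x‖ := by
  have : ‖prim (fun s => U s x) t‖ ≤ C * ‖x‖ * |t - 0| :=
    intervalIntegral.norm_integral_le_of_norm_le_const fun s hs => by
      rw [uIoc_of_le ht.1] at hs
      exact (U s).le_of_opNorm_le (hC s ⟨hs.1.le, hs.2.trans ht.2⟩) x
  refine this.trans ?_
  rw [sub_zero, abs_of_nonneg ht.1]
  nlinarith [ht.2, mul_nonneg hC0 (norm_nonneg x)]

theorem prim_sub_apply (hU : IsLocalConvolutedSemigroup k T U A) {t : ℝ} (ht : t ∈ Icc 0 T)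
    (x y : X) : prim (fun s => U s x) t - prim (fun s => U s y) t = prim (fun s => U s (x - y)) t := by
  have h0 : (0 : ℝ) ∈ Icc 0 T := ⟨le_rfl, ht.1.trans ht.2⟩
  simp only [prim, map_sub]
  exact (intervalIntegral.integral_sub
    (intervalIntegrable_of_Icc (hU.bddMeasOn x).integrableOn h0 ht)
    (intervalIntegrable_of_Icc (hU.bddMeasOn y).integrableOn h0 ht)).symm

/-- Uniqueness for the abstract Volterra equation `w = A (1 * w)`: with `J = 1 * w`, the derivative of
`s ↦ ∫₀^{c - s} U(σ) J(s) dσ` is `- K(c - s) J(s)`, so that `K * J = 0` and Titchmarsh's theorem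
applies.  Here `K` denotes the primitive of `k`. -/
theorem eq_zero_of_volterra (hU : IsLocalConvolutedSemigroup k T U A) (hk0 : ZeroMemSupp k)
    (hk : LocallyIntegrableOn k (Ici 0)) {T' : ℝ} (hT' : T' ≤ T) {w : ℝ → X}
    (hw : ContinuousOn w (Icc 0 T')) (h : ∀ t ∈ Icc 0 T', (prim w t, w t) ∈ A.graph) :
    ∀ t ∈ Icc 0 T', w t = 0 := by
  suffices hJ : ∀ t ∈ Icc 0 T', prim w t = 0 from fun t ht =>
    A.graph_fst_eq_zero_snd (h t ht) (hJ t ht)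
  rcases le_or_gt T' 0 with hT0 | hT0
  · intro t ht
    have : t = 0 := le_antisymm (ht.2.trans hT0) ht.1
    rw [this, prim_zero]
  obtain ⟨C, hC0, hC⟩ := hU.exists_bound
  have hwi : IntegrableOn w (Icc 0 T') := hw.integrableOn_compact isCompact_Icc
  have hJc : ContinuousOn (prim w) (Icc 0 T') := continuousOn_prim hwi
  have hKc : ContinuousOn (prim k) (Icc 0 T') := continuousOn_prim (hk.integrableOn_Icc T')
  set I : ℝ → X → X := fun σ y => prim (fun r => U r y) σ with hI
  have hIc : ∀ y, ContinuousOn (fun σ => I σ y) (Icc 0 T) := fun y =>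
    continuousOn_prim (hU.bddMeasOn y).integrableOn
  have hIl : ∀ t ∈ Icc 0 T, ∀ x x', ‖I t x - I t x'‖ ≤ C * T * ‖x - x'‖ := fun t ht x x' => by
    simp only [hI]
    rw [hU.prim_sub_apply ht]
    exact norm_prim_apply_le hC0 hC ht _
  have key : ∀ c ∈ Ioo 0 T', vconv (prim k) (prim w) c = 0 := by
    intro c hc
    have hmap : MapsTo (fun s => c - s) (Icc 0 c) (Icc 0 T) := fun s hs =>
      ⟨by linarith [hs.2], by linarith [hs.1, hc.2]⟩
    have hcs : ContinuousOn (fun s => c - s) (Icc 0 c) := by fun_prop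
    have hsubc : Icc 0 c ⊆ Icc 0 T' := Icc_subset_Icc_right hc.2.le
    have hHc : ContinuousOn (fun s => I (c - s) (prim w s)) (Icc 0 c) :=
      continuousOn_apply_of_lipschitz (fun s hs => hIl _ (hmap hs))
        (fun x => (hIc x).comp hcs hmap) (hJc.mono hsubc)
    have hHd : ∀ s ∈ Ioo 0 c,
        HasDerivAt (fun s => I (c - s) (prim w s)) (-(prim k (c - s) • prim w s)) s := by
      intro s hs
      have hsT' : s ∈ Ioo 0 T' := ⟨hs.1, hs.2.trans hc.2⟩
      have hcsT : c - s ∈ Ioo 0 T := ⟨by linarith [hs.2], by linarith [hs.1, hc.2]⟩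
      have hd1 : HasDerivAt (fun s' => I (c - s') (prim w s)) (-(U (c - s) (prim w s))) s := by
        have := (hasDerivAt_prim (hU.strongly_continuous (prim w s)) hcsT).scomp s
          ((hasDerivAt_id s).const_sub c)
        simpa [Function.comp_def] using this
      have hJd : HasDerivAt (prim w) (w s) s := hasDerivAt_prim hw hsT'
      have hnear : ∀ᶠ s' in 𝓝 s, c - s' ∈ Icc 0 T := by
        have : ContinuousAt (fun s' => c - s') s := by fun_prop
        exact this.eventually_mem (Icc_mem_nhds hcsT.1 hcsT.2)
      have hd2 : HasDerivAt (fun s' => I (c - s') (prim w s' - prim w s)) (I (c - s) (w s)) s := by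
        rw [hasDerivAt_iff_isLittleO]
        have o1 : (fun s' => I (c - s') (prim w s' - prim w s) - I (c - s') ((s' - s) • w s))
            =o[𝓝 s] fun s' => s' - s := by
          refine Asymptotics.IsBigO.trans_isLittleO ?_ (hasDerivAt_iff_isLittleO.1 hJd)
          exact Asymptotics.IsBigO.of_bound (C * T) (hnear.mono fun s' hs' => hIl _ hs' _ _)
        have o2 : (fun s' => (s' - s) • (I (c - s') (w s) - I (c - s) (w s)))
            =o[𝓝 s] fun s' => s' - s := by
          have ht : Tendsto (fun s' => I (c - s') (w s) - I (c - s) (w s)) (𝓝 s) (𝓝 0) := by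
            have h1 : ContinuousAt (fun σ => I σ (w s)) (c - s) :=
              (hIc (w s)).continuousAt (Icc_mem_nhds hcsT.1 hcsT.2)
            have h2 : ContinuousAt (fun s' => I (c - s') (w s)) s :=
              ContinuousAt.comp (f := fun s' => c - s') (g := fun σ => I σ (w s)) h1 (by fun_prop)
            have := h2.tendsto.sub_const (I (c - s) (w s))
            simpa using this
          have := (Asymptotics.isBigO_refl (fun s' : ℝ => s' - s) (𝓝 s)).smul_isLittleO
            ((Asymptotics.isLittleO_one_iff ℝ).2 ht)
          simpa using this
        refine (o1.add o2).congr_left fun s' => ?_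
        have e : I (c - s') ((s' - s) • w s) = (s' - s) • I (c - s') (w s) := by
          simp only [hI, prim]
          rw [← intervalIntegral.integral_smul]
          simp only [← Complex.coe_smul, map_smul]
        have e0 : I (c - s) (prim w s - prim w s) = 0 := by simp [hI, prim]
        rw [e, e0, smul_sub]
        abel
      have hsum := hd1.add hd2
      have hval : -(U (c - s) (prim w s)) + I (c - s) (w s) = -(prim k (c - s) • prim w s) := by
        simp only [hI]
        rw [hU.prim_apply_of_mem_graph (Ioo_subset_Icc_self hcsT) (h s (Ioo_subset_Icc_self hsT'))]
        abel
      rw [hval] at hsum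
      refine hsum.congr_of_eventuallyEq (hnear.mono fun s' hs' => ?_)
      simp only [Pi.add_apply, hI]
      rw [← hU.prim_sub_apply hs']
      abel
    have hint : IntervalIntegrable (fun s => -(prim k (c - s) • prim w s)) volume 0 c := by
      refine ContinuousOn.intervalIntegrable ?_
      rw [uIcc_of_le hc.1.le]
      refine ((hKc.comp hcs fun s hs => ?_).smul (hJc.mono hsubc)).neg
      exact ⟨by linarith [hs.2], by linarith [hs.1, hc.2]⟩
    have := intervalIntegral.integral_eq_sub_of_hasDerivAt_of_le hc.1.le hHc hHd hint
    rw [intervalIntegral.integral_neg] at this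
    simp only [hI, sub_self, prim_zero, sub_zero, map_zero] at this
    rw [vconv, ← neg_eq_zero, this]
    simp [prim]
  have hK0 : ZeroMemSupp (prim k) := by
    have : prim k = conv (fun _ => 1) k := funext fun t => (conv_one_left k t).symm
    rw [this]
    exact zeroMemSupp_one.conv (continuous_const.locallyIntegrable.locallyIntegrableOn _) hk hk0
  exact eqOn_zero_of_vconv_eq_zero hT0 hK0 (hKc.integrableOn_compact isCompact_Icc) hJc key

end IsLocalConvolutedSemigroup

/-! ### The orbit of a smeared vector -/

namespace IsLocalConvolutedSemigroup

variable {X : Type*} [NormedAddCommGroup X] [NormedSpace ℂ X] [CompleteSpace X]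
  {k : ℝ → ℂ} {T : ℝ} {U : ℝ → X →L[ℂ] X} {A : X →ₗ.[ℂ] X}

theorem prim_bddMeasOn (hU : IsLocalConvolutedSemigroup k T U A) (x : X) :
    BddMeasOn T (prim fun s => U s x) :=
  (continuousOn_prim (hU.bddMeasOn x).integrableOn).bddMeasOn

/-- Convolving the defining equation of a convoluted semigroup with a scalar function. -/
theorem vconv_prim_mem_graph (hU : IsLocalConvolutedSemigroup k T U A)
    (hk : LocallyIntegrableOn k (Ici 0)) {f : ℝ → ℂ} (hf : IntegrableOn f (Icc 0 T)) (x : X) {t : ℝ}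
    (ht : t ∈ Icc 0 T) :
    (vconv f (prim fun s => U s x) t, vconv f (fun s => U s x) t - conv f (prim k) t • x)
      ∈ A.graph := by
  have hK : BddMeasOn T fun s => prim k s • x :=
    ((continuousOn_prim (hk.integrableOn_Icc T)).smul continuousOn_const).bddMeasOn
  rw [← vconv_smul_const, ← vconv_sub_right hf (hU.bddMeasOn x) hK ht]
  exact vconv_mem_graph hU.isClosed hf (hU.prim_bddMeasOn x)
    ((hU.strongly_continuous x).sub
      ((continuousOn_prim (hk.integrableOn_Icc T)).smul continuousOn_const)).bddMeasOn
    (fun s hs => hU.duhamel s hs x) ht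

/-- The orbit of a smeared vector `y = (h * U x)(T₂)`.  If `U` were the convolution of `k` with a
semigroup, `y` would be a superposition of points of the orbit of `x`, and shifting the argument in
`h * U x` would produce the orbit of `y` up to the contribution of `h * k`.  The two sides differ by a
solution of the equation of `eq_zero_of_volterra`. -/
theorem apply_vconv (hU : IsLocalConvolutedSemigroup k T U A) (hk0 : ZeroMemSupp k)
    (hk : LocallyIntegrableOn k (Ici 0)) {T₁ T₂ : ℝ} (hT₂ : 0 ≤ T₂) (hT : T₁ + T₂ ≤ T) {h : ℝ → ℂ}
    (hh : ∀ T, IntegrableOn h (Icc 0 T)) (x : X) {t : ℝ} (ht : t ∈ Icc 0 T₁) :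
    U t (vconv h (fun s => U s x) T₂)
      = vconv k (fun r => vconv h (fun s => U s x) (T₂ + r)) t
        - vconv (fun r => conv h k (T₂ + r)) (fun s => U s x) t := by
  have hT₁ : 0 ≤ T₁ := ht.1.trans ht.2
  have hT₁T : T₁ ≤ T := by linarith
  set q := vconv h (fun s => U s x) with hq
  set y := q T₂ with hy
  set p : ℝ → X := fun r => q (T₂ + r) with hp
  set F : ℝ → ℂ := fun r => conv h k (T₂ + r) with hF
  have hadd : MapsTo (fun r => T₂ + r) (Icc 0 T₁) (Icc 0 T) := fun r hr =>
    ⟨by linarith [hr.1], by linarith [hr.2]⟩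
  have hqc : ContinuousOn q (Icc 0 T) := continuousOn_vconv (hh T) (hU.strongly_continuous x)
  have hpc : ContinuousOn p (Icc 0 T₁) := hqc.comp (by fun_prop) hadd
  have hki := hk.integrableOn_Icc
  have hhk : ∀ T, IntegrableOn (conv h k) (Icc 0 T) := fun T => integrableOn_conv (hh T) (hki T)
  have hFi : IntegrableOn F (Icc 0 T₁) := by
    have := integrableOn_comp_add_left hT₂ (hhk (T₂ + T₁))
    rwa [add_sub_cancel_left] at this
  have hUc1 : ContinuousOn (fun s => U s x) (Icc 0 T₁) :=
    (hU.strongly_continuous x).mono (Icc_subset_Icc_right hT₁T)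
  have hFc : ContinuousOn (vconv F fun s => U s x) (Icc 0 T₁) := continuousOn_vconv hFi hUc1
  have hkp : ContinuousOn (vconv k p) (Icc 0 T₁) := continuousOn_vconv (hki T₁) hpc
  set w : ℝ → X := fun t => U t y - (vconv k p t - vconv F (fun s => U s x) t) with hw
  have hwc : ContinuousOn w (Icc 0 T₁) :=
    ((hU.strongly_continuous y).mono (Icc_subset_Icc_right hT₁T)).sub (hkp.sub hFc)
  suffices h0 : ∀ t ∈ Icc 0 T₁, w t = 0 from sub_eq_zero.1 (h0 t ht)
  refine hU.eq_zero_of_volterra hk0 hk hT₁T hwc fun t ht => ?_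
  have htT : t ∈ Icc 0 T := ⟨ht.1, ht.2.trans hT₁T⟩
  have h0T : (0 : ℝ) ∈ Icc 0 T₁ := ⟨le_rfl, hT₁⟩
  -- the equation satisfied by `p`
  have hpg : ∀ r ∈ Icc 0 T₁, (prim p r, p r - (y + prim F r • x)) ∈ A.graph := by
    intro r hr
    have hr' := hadd hr
    have h2' : T₂ ∈ Icc 0 T := ⟨hT₂, by linarith⟩
    have g := A.graph.sub_mem (hU.vconv_prim_mem_graph hk (hh T) x hr')
      (hU.vconv_prim_mem_graph hk (hh T) x h2')
    have hqi : IntegrableOn q (Icc 0 (T₂ + r)) :=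
      (hqc.mono (Icc_subset_Icc_right hr'.2)).integrableOn_compact isCompact_Icc
    have e1 : prim p r = vconv h (prim fun s => U s x) (T₂ + r)
        - vconv h (prim fun s => U s x) T₂ := by
      rw [hp, prim_add_arg hT₂ hr.1 hqi, hq, prim_vconv (hh T) (hU.bddMeasOn x) hr',
        prim_vconv (hh T) (hU.bddMeasOn x) h2']
    have e2 : prim F r = conv h (prim k) (T₂ + r) - conv h (prim k) T₂ := by
      rw [hF, prim_add_arg hT₂ hr.1 (hhk _), conv_prim (hh T) (hki T) hr', conv_prim (hh T) (hki T) h2']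
    rw [Prod.mk_sub_mk, ← e1] at g
    convert g using 2
    rw [e2, sub_smul, hp, hy]
    simp only
    abel
  have hprimF : ContinuousOn (prim F) (Icc 0 T₁) := continuousOn_prim hFi
  have b1 : BddMeasOn T₁ (prim p) :=
    (continuousOn_prim (hpc.integrableOn_compact isCompact_Icc)).bddMeasOn
  have c2 : ContinuousOn (fun r => y + prim F r • x) (Icc 0 T₁) :=
    continuousOn_const.add (hprimF.smul continuousOn_const)
  have c3 : ContinuousOn (fun r => p r - (y + prim F r • x)) (Icc 0 T₁) := hpc.sub c2
  have c4 : ContinuousOn (fun r => prim F r • x) (Icc 0 T₁) := hprimF.smul continuousOn_const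
  have g1 := vconv_mem_graph hU.isClosed (hki T₁) b1 c3.bddMeasOn hpg ht
  rw [vconv_sub_right (hki T₁) hpc.bddMeasOn c2.bddMeasOn ht, vconv_add_right (hki T₁)
    continuousOn_const.bddMeasOn c4.bddMeasOn ht, vconv_const,
    vconv_smul_const] at g1
  have hU1 : IsLocalConvolutedSemigroup k T₁ U A :=
    ⟨hU.isClosed, fun x => (hU.strongly_continuous x).mono (Icc_subset_Icc_right hT₁T),
      fun t ht => hU.commutes t ⟨ht.1, ht.2.trans hT₁T⟩,
      fun t ht => hU.duhamel t ⟨ht.1, ht.2.trans hT₁T⟩⟩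
  have g2 := hU1.vconv_prim_mem_graph hk hFi x ht
  have g3 := A.graph.sub_mem (hU.duhamel t htT y) (A.graph.sub_mem g1 g2)
  have e : prim w t = prim (fun s => U s y) t - (vconv k (prim p) t
      - vconv F (prim fun s => U s x) t) := by
    rw [← prim_vconv (hki T₁) hpc.bddMeasOn ht, ← prim_vconv hFi hUc1.bddMeasOn ht]
    have i1 := intervalIntegrable_of_Icc ((hU1.bddMeasOn y).integrableOn) h0T ht
    have i2 := intervalIntegrable_of_Icc (hkp.integrableOn_compact isCompact_Icc) h0T ht
    have i3 := intervalIntegrable_of_Icc (hFc.integrableOn_compact isCompact_Icc) h0T ht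
    simp only [prim, hw]
    rw [intervalIntegral.integral_sub i1 (i2.sub i3), intervalIntegral.integral_sub i2 i3]
  have ec : conv k (prim F) t = conv F (prim k) t := conv_prim_comm (hki T₁) hFi ht
  have ew : w t = U t y - prim k t • y - (vconv k p t - (prim k t • y + conv k (prim F) t • x)
      - (vconv F (fun s => U s x) t - conv F (prim k) t • x)) := by
    simp only [hw, ec]
    abel
  rw [e, ew]
  exact g3

/-- The convolution of a scalar kernel with a strongly continuous family of operators. -/
theorem exists_clm_vconv (hU : IsLocalConvolutedSemigroup k T U A) {f : ℝ → ℂ} {T' : ℝ}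
    {m : ℝ → ℝ} (hm : ContinuousOn m (Icc 0 T')) (hmT : MapsTo m (Icc 0 T') (Icc 0 T))
    (hf : IntegrableOn f (Icc 0 T')) {t : ℝ} (ht : t ∈ Icc 0 T') :
    ∃ L : X →L[ℂ] X, ∀ x, L x = vconv f (fun s => U (m s) x) t := by
  obtain ⟨C, hC0, hC⟩ := hU.exists_bound
  have hb : ∀ x, BddMeasOn T' fun s => U (m s) x := fun x =>
    ((hU.strongly_continuous x).comp hm hmT).bddMeasOn
  let L : X →ₗ[ℂ] X :=
    { toFun := fun x => vconv f (fun s => U (m s) x) t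
      map_add' := fun x y => by
        simp only [map_add]
        exact vconv_add_right hf (hb x) (hb y) ht
      map_smul' := fun c x => by
        simp only [map_smul, vconv, RingHom.id_apply]
        rw [← intervalIntegral.integral_smul]
        simp only [smul_comm c] }
  refine ⟨L.mkContinuous (C * ∫ s in Icc 0 T', ‖f s‖) fun x => ?_, fun x => rfl⟩
  have := norm_vconv_le (u := fun s => U (m s) x) (C := C * ‖x‖) hf
    (fun s hs => (U (m s)).le_of_opNorm_le (hC _ (hmT hs)) x) (by positivity) ht
  refine this.trans (le_of_eq (by ring))

/-- Delaying a function that vanishes at the origin by `T` delays its primitive by `T`. -/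
theorem prim_comp_max {u : ℝ → X} {T T' : ℝ} (hT : 0 ≤ T) (hu : ContinuousOn u (Icc 0 T'))
    (hu0 : u 0 = 0) {t : ℝ} (ht : t ∈ Icc 0 (T + T')) :
    prim (fun s => u (max (s - T) 0)) t = prim u (max (t - T) 0) := by
  have hT' : 0 ≤ T + T' := ht.1.trans ht.2
  rw [prim_eq_vconv, prim_eq_vconv]
  rcases le_total 0 T' with h | h
  · have hc : ContinuousOn (fun s => u (max (s - T) 0)) (Icc 0 (T + T')) :=
      hu.comp (by fun_prop) fun s hs => ⟨le_max_right _ _, max_le (by linarith [hs.2]) h⟩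
    rw [vconv_of_eqOn_zero hT ht (integrableOn_one _) hc.bddMeasOn fun s hs => by
      rw [max_eq_right (by linarith [hs.2]), hu0]]
    refine vconv_congr (le_max_right _ _) (fun _ _ => rfl) fun s hs => ?_
    simp only [add_sub_cancel_left, max_eq_left hs.1]
  · rw [max_eq_right (by linarith [ht.2]), vconv_zero_right]
    rw [vconv_congr (u' := fun _ => 0) ht.1 (fun _ _ => rfl) fun s hs => by
      simp only; rw [max_eq_right (by linarith [hs.2, ht.2]), hu0]]
    simp [vconv]

end IsLocalConvolutedSemigroup

/-! ### Extension of local convoluted semigroups -/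

namespace IsLocalConvolutedSemigroup

variable {X : Type*} [NormedAddCommGroup X] [NormedSpace ℂ X] [CompleteSpace X]
  {k l : ℝ → ℂ} {τ T : ℝ} {S U : ℝ → X →L[ℂ] X} {A : X →ₗ.[ℂ] X}

/-- The extension of a local `l`-convoluted semigroup `U` on `[0, T]` to a local `k * l`-convoluted
semigroup on `[0, T + τ]`, by means of a local `k`-convoluted semigroup `S` on `[0, τ]` with the same
generator.  The formula uses `r = max (t - T) 0` and `U` stopped at `T`, which makes continuity at `T`
evident. -/
theorem exists_extension (hS : IsLocalConvolutedSemigroup k τ S A)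
    (hU : IsLocalConvolutedSemigroup l T U A) (hk : LocallyIntegrableOn k (Ici 0))
    (hl : LocallyIntegrableOn l (Ici 0)) (hτ : 0 ≤ τ) (hT : 0 ≤ T) :
    ∃ V : ℝ → X →L[ℂ] X, IsLocalConvolutedSemigroup (conv k l) (T + τ) V A ∧
      ∀ t ∈ Icc 0 (T + τ), ∀ x, V t x
        = U T (S (max (t - T) 0) x - prim k (max (t - T) 0) • x)
          + vconv (fun s => l (T + s)) (fun s => S s x) (max (t - T) 0)
          + vconv k (fun s => U (min s T) x) t := by
  have hTτ : 0 ≤ T + τ := by linarith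
  have hr : MapsTo (fun t => max (t - T) 0) (Icc 0 (T + τ)) (Icc 0 τ) := fun t ht =>
    ⟨le_max_right _ _, max_le (by linarith [ht.2]) hτ⟩
  have hm : MapsTo (fun s => min s T) (Icc 0 (T + τ)) (Icc 0 T) := fun s hs =>
    ⟨le_min hs.1 hT, min_le_right _ _⟩
  have hrc : ContinuousOn (fun t => max (t - T) 0) (Icc 0 (T + τ)) := by fun_prop
  have hmc : ContinuousOn (fun s => min s T) (Icc 0 (T + τ)) := by fun_prop
  have hki := hk.integrableOn_Icc
  have hli := hl.integrableOn_Icc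
  have hlT : IntegrableOn (fun s => l (T + s)) (Icc 0 τ) := by
    have := integrableOn_comp_add_left hT (hli (T + τ))
    rwa [add_sub_cancel_left] at this
  have hex : ∀ t, ∃ L : X →L[ℂ] X, t ∈ Icc 0 (T + τ) → ∀ x, L x
      = U T (S (max (t - T) 0) x - prim k (max (t - T) 0) • x)
          + vconv (fun s => l (T + s)) (fun s => S s x) (max (t - T) 0)
          + vconv k (fun s => U (min s T) x) t := by
    intro t
    by_cases ht : t ∈ Icc 0 (T + τ)
    · obtain ⟨L₁, h₁⟩ := hS.exists_clm_vconv (f := fun s => l (T + s)) (m := id)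
        continuousOn_id (mapsTo_id _) hlT (hr ht)
      obtain ⟨L₂, h₂⟩ := hU.exists_clm_vconv hmc hm (hki _) ht
      refine ⟨U T ∘L (S (max (t - T) 0) - prim k (max (t - T) 0) • ContinuousLinearMap.id ℂ X)
        + L₁ + L₂, fun _ x => ?_⟩
      simp [h₁, h₂]
    · exact ⟨0, fun h => absurd h ht⟩
  choose V hV using hex
  refine ⟨V, ?_, hV⟩
  have hrT : ∀ x, ContinuousOn (fun r => S r x - prim k r • x) (Icc 0 τ) := fun x =>
    (hS.strongly_continuous x).sub ((continuousOn_prim (hki τ)).smul continuousOn_const)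
  have hUm : ∀ x, ContinuousOn (fun s => U (min s T) x) (Icc 0 (T + τ)) := fun x =>
    (hU.strongly_continuous x).comp hmc hm
  have hLm : ContinuousOn (fun s => prim l (min s T)) (Icc 0 (T + τ)) :=
    (continuousOn_prim (hli T)).comp hmc hm
  have hPm : ∀ x, ContinuousOn (fun s => prim (fun σ => U σ x) (min s T)) (Icc 0 (T + τ)) := fun x =>
    (continuousOn_prim (hU.bddMeasOn x).integrableOn).comp hmc hm
  -- `V` is the sum of a part that vanishes up to the time `T` and of the convolution of `k` with `U`
  -- stopped at `T`
  set e : X → ℝ → X := fun x r => U T (S r x - prim k r • x)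
    + vconv (fun s => l (T + s)) (fun s => S s x) r with he
  have hec : ∀ x, ContinuousOn (e x) (Icc 0 τ) := fun x =>
    ((U T).continuous.comp_continuousOn (hrT x)).add
      (continuousOn_vconv hlT (hS.strongly_continuous x))
  have he0 : ∀ x, e x 0 = 0 := fun x => by
    simp [he, hS.apply_zero hτ, prim_zero, vconv_zero_right]
  have hVe : ∀ t ∈ Icc 0 (T + τ), ∀ x, V t x
      = e x (max (t - T) 0) + vconv k (fun s => U (min s T) x) t := fun t ht x => hV t ht x
  have hv2 : ∀ x, ContinuousOn (vconv k fun s => U (min s T) x) (Icc 0 (T + τ)) := fun x =>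
    continuousOn_vconv (hki _) (hUm x)
  have hv1 : ∀ x, ContinuousOn (fun t => e x (max (t - T) 0)) (Icc 0 (T + τ)) := fun x =>
    (hec x).comp hrc hr
  refine ⟨hS.isClosed, fun x => ?_, fun t ht x => ?_, fun t ht x => ?_⟩
  · exact ((hv1 x).add (hv2 x)).congr fun t ht => hVe t ht x
  · have hx : ((x : X), A x) ∈ A.graph := A.mem_graph x
    rw [hV t ht, hV t ht]
    refine A.graph.add_mem (x := (_, _)) (y := (_, _)) (A.graph.add_mem (x := (_, _)) (y := (_, _))
      (hU.mem_graph ⟨hT, le_rfl⟩ (A.graph.sub_mem (x := (_, _)) (y := (_, _))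
        (hS.mem_graph (hr ht) hx) (A.graph.smul_mem _ hx))) ?_) ?_
    · exact vconv_mem_graph hS.isClosed hlT (hS.bddMeasOn _) (hS.bddMeasOn _)
        (fun s hs => hS.mem_graph hs hx) (hr ht)
    · exact vconv_mem_graph hS.isClosed (hki _) (hUm _).bddMeasOn (hUm _).bddMeasOn
        (fun s hs => hU.mem_graph (hm hs) hx) ht
  · set r := max (t - T) 0 with hrdef
    have hrm : r ∈ Icc 0 τ := hr ht
    have h0τ : (0 : ℝ) ∈ Icc 0 τ := ⟨le_rfl, hτ⟩
    have h0t : (0 : ℝ) ∈ Icc 0 (T + τ) := ⟨le_rfl, hTτ⟩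
    -- convolution of `k` with the ramp `max (· - T) 0`
    have hramp : ∀ y : X, vconv k (fun s => ((max (s - T) 0 : ℝ) : ℂ) • y) t
        = prim (prim k) r • y := by
      intro y
      have hc : ContinuousOn (fun s => ((max (s - T) 0 : ℝ) : ℂ)) (Icc 0 (T + τ)) := by fun_prop
      rw [vconv_smul_const]
      congr 1
      rw [conv_eq_vconv, vconv_of_eqOn_zero hT ht (hki _) hc.bddMeasOn fun s hs => by
        simp [hs.2]]
      rw [vconv_congr (u' := prim fun _ => (1 : ℂ)) hrm.1 (fun _ _ => rfl) fun s hs => by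
        simp [prim, hs.1], ← conv_eq_vconv, conv_prim_comm (hki τ) (integrableOn_one τ) hrm,
        conv_one_left]
      rfl
    have hprimU : ∀ s ∈ Icc 0 t, prim (fun σ => U (min σ T) x) s
        = prim (fun σ => U σ x) (min s T) + ((max (s - T) 0 : ℝ) : ℂ) • U T x := by
      intro s hs
      rcases le_total s T with h | h
      · rw [min_eq_left h, max_eq_right (by linarith)]
        simp only [Complex.ofReal_zero, zero_smul, add_zero]
        refine intervalIntegral.integral_congr fun σ hσ => ?_
        rw [uIcc_of_le hs.1] at hσ
        simp only [min_eq_left (hσ.2.trans h)]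
      · have hsT : s ∈ Icc 0 (T + τ) := ⟨hs.1, hs.2.trans ht.2⟩
        have hTm : T ∈ Icc 0 (T + τ) := ⟨hT, by linarith⟩
        have hi := (hUm x).integrableOn_compact (μ := volume) isCompact_Icc
        rw [min_eq_right h, max_eq_left (by linarith), prim,
          ← intervalIntegral.integral_add_adjacent_intervals
            (intervalIntegrable_of_Icc hi h0t hTm) (intervalIntegrable_of_Icc hi hTm hsT)]
        congr 1
        · refine intervalIntegral.integral_congr fun σ hσ => ?_
          rw [uIcc_of_le hT] at hσ
          simp only [min_eq_left hσ.2]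
        · rw [Complex.coe_smul, ← intervalIntegral.integral_const (E := X)]
          refine intervalIntegral.integral_congr fun σ hσ => ?_
          rw [uIcc_of_le h] at hσ
          simp only [min_eq_right hσ.1]
    have hpe : prim (e x) r = U T (prim (fun s => S s x) r - prim (prim k) r • x)
        + vconv (fun s => l (T + s)) (prim fun s => S s x) r := by
      have i1 : IntervalIntegrable (fun s => S s x) volume 0 r :=
        intervalIntegrable_of_Icc (hS.bddMeasOn x).integrableOn h0τ hrm
      have cK : ContinuousOn (fun s => prim k s • x) (Icc 0 τ) :=
        (continuousOn_prim (hki τ)).smul continuousOn_const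
      have i2 : IntervalIntegrable (fun s => prim k s • x) volume 0 r :=
        intervalIntegrable_of_Icc (cK.integrableOn_compact isCompact_Icc) h0τ hrm
      have i3 : IntervalIntegrable (fun s => U T (S s x - prim k s • x)) volume 0 r :=
        intervalIntegrable_of_Icc (((U T).continuous.comp_continuousOn
          (hrT x)).integrableOn_compact isCompact_Icc) h0τ hrm
      have i4 : IntervalIntegrable (vconv (fun s => l (T + s)) fun s => S s x) volume 0 r :=
        intervalIntegrable_of_Icc ((continuousOn_vconv hlT
          (hS.strongly_continuous x)).integrableOn_compact isCompact_Icc) h0τ hrm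
      rw [← prim_vconv hlT (hS.bddMeasOn x) hrm]
      change ∫ s in (0 : ℝ)..r, (U T (S s x - prim k s • x)
          + vconv (fun s => l (T + s)) (fun s => S s x) s)
        = U T ((∫ s in (0 : ℝ)..r, S s x) - (∫ s in (0 : ℝ)..r, prim k s) • x)
          + ∫ s in (0 : ℝ)..r, vconv (fun s => l (T + s)) (fun s => S s x) s
      rw [intervalIntegral.integral_add i3 i4, (U T).intervalIntegral_comp_comm (i1.sub i2),
        intervalIntegral.integral_sub i1 i2, intervalIntegral.integral_smul_const]
    have hprimV : ∫ s in (0 : ℝ)..t, V s x = U T (prim (fun s => S s x) r)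
        + vconv (fun s => l (T + s)) (prim fun s => S s x) r
        + vconv k (fun s => prim (fun σ => U σ x) (min s T)) t := by
      have hcr : ContinuousOn (fun s => ((max (s - T) 0 : ℝ) : ℂ) • U T x) (Icc 0 (T + τ)) := by
        fun_prop
      have h1 : ∫ s in (0 : ℝ)..t, V s x = prim (fun s => e x (max (s - T) 0)) t
          + prim (vconv k fun s => U (min s T) x) t := by
        rw [prim, prim, ← intervalIntegral.integral_add
          (intervalIntegrable_of_Icc ((hv1 x).integrableOn_compact isCompact_Icc) h0t ht)
          (intervalIntegrable_of_Icc ((hv2 x).integrableOn_compact isCompact_Icc) h0t ht)]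
        refine intervalIntegral.integral_congr fun s hs => ?_
        rw [uIcc_of_le ht.1] at hs
        exact hVe s ⟨hs.1, hs.2.trans ht.2⟩ x
      rw [h1, prim_comp_max hT (hec x) (he0 x) ht, ← hrdef, hpe,
        prim_vconv (hki _) (hUm x).bddMeasOn ht,
        vconv_congr (u := prim _) ht.1 (fun _ _ => rfl) hprimU,
        vconv_add_right (hki _) (hPm x).bddMeasOn hcr.bddMeasOn ht, hramp, map_sub, map_smul]
      abel
    rw [hprimV]
    have g1 := hU.mem_graph ⟨hT, le_rfl⟩ (hS.duhamel r hrm x)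
    have g2 := hS.vconv_prim_mem_graph hk hlT x hrm
    have cLx : ContinuousOn (fun s => prim l (min s T) • x) (Icc 0 (T + τ)) :=
      hLm.smul continuousOn_const
    have c3 : ContinuousOn (fun s => U (min s T) x - prim l (min s T) • x) (Icc 0 (T + τ)) :=
      (hUm x).sub cLx
    have g3 := vconv_mem_graph hS.isClosed (hki _) (hPm x).bddMeasOn c3.bddMeasOn
      (fun s hs => hU.duhamel _ (hm hs) x) ht
    have g := A.graph.add_mem (A.graph.add_mem g1 g2) g3
    rw [vconv_sub_right (hki _) (hUm x).bddMeasOn cLx.bddMeasOn ht, vconv_smul_const] at g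
    -- it remains to identify the multiples of `x`: `1 * k * l` splits at `T` like the primitive of `V`
    have hsc : prim (conv k l) t = conv (fun s => l (T + s)) (prim k) r
        + conv k (fun s => prim l (min s T)) t := by
      have cL : ContinuousOn (prim l) (Icc 0 (T + τ)) := continuousOn_prim (hli _)
      have cd : ContinuousOn (fun s => prim l s - prim l (min s T)) (Icc 0 (T + τ)) := cL.sub hLm
      rw [← conv_prim (hki _) (hli _) ht, ← sub_eq_iff_eq_add]
      simp only [conv_eq_vconv]
      rw [← vconv_sub_right (hki _) cL.bddMeasOn hLm.bddMeasOn ht,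
        vconv_of_eqOn_zero hT ht (hki _) cd.bddMeasOn fun s hs => by simp [min_eq_left hs.2],
        vconv_congr (u' := prim fun s => l (T + s)) hrm.1 (fun _ _ => rfl) fun s hs => by
          rw [prim_add_arg hT hs.1 (hli _), min_eq_right (by linarith [hs.1])]]
      exact conv_prim_comm (hki τ) hlT hrm
    have ew : V t x - prim (conv k l) t • x = U T (S r x - prim k r • x)
        + (vconv (fun s => l (T + s)) (fun s => S s x) r - conv (fun s => l (T + s)) (prim k) r • x)
        + (vconv k (fun s => U (min s T) x) t - conv k (fun s => prim l (min s T)) t • x) := by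
      rw [hV t ht, hsc, add_smul]
      abel
    change (_, V t x - prim (conv k l) t • x) ∈ _
    rw [ew]
    exact g

end IsLocalConvolutedSemigroup

/-- The families `S_{k^{*n}}` are local `k^{*n}`-convoluted semigroups with the same generator. -/
theorem exists_convPow_semigroup {X : Type*} [NormedAddCommGroup X] [NormedSpace ℂ X]
    [CompleteSpace X] {k : ℝ → ℂ} {τ : ℝ} {S : ℝ → X →L[ℂ] X} {A : X →ₗ.[ℂ] X}
    (hS : IsLocalConvolutedSemigroup k τ S A) (hk : LocallyIntegrableOn k (Ici 0)) (hτ : 0 ≤ τ) :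
    ∀ n : ℕ, 1 ≤ n → ∃ U : ℝ → X →L[ℂ] X,
      IsLocalConvolutedSemigroup (convPow k n) (n * τ) U A ∧
      ∀ t ∈ Icc 0 (n * τ), ∀ x, U t x = extend k τ S n t x
  | 1, _ => ⟨S, by rw [Nat.cast_one, one_mul]; exact hS, fun t _ x => rfl⟩
  | n + 2, _ => by
    obtain ⟨U, hU, hUe⟩ := exists_convPow_semigroup hS hk hτ (n + 1) (by omega)
    set T : ℝ := (n + 1 : ℕ) * τ with hT
    have hT0 : 0 ≤ T := by positivity
    have hl := convPow_locallyIntegrableOn hk (n + 1)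
    have hTτ : ((n + 2 : ℕ) : ℝ) * τ = T + τ := by rw [hT]; push_cast; ring
    have hT' : ((n : ℝ) + 1) * τ = T := by rw [hT]; push_cast; ring
    obtain ⟨V, hV, hVe⟩ := hS.exists_extension hU hk hl hτ hT0
    refine ⟨V, by rw [hTτ]; exact hV, fun t ht x => ?_⟩
    rw [hTτ] at ht
    rw [hVe t ht, extend]
    simp only [hT']
    split_ifs with h
    · rw [max_eq_right (by linarith), hS.apply_zero hτ, prim_zero, vconv_zero_right]
      simp only [zero_smul, sub_zero, map_zero, zero_add]
      refine intervalIntegral.integral_congr fun s hs => ?_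
      rw [uIcc_of_le ht.1] at hs
      simp only [min_eq_left (hs.2.trans h)]
      rw [hUe s ⟨hs.1, hs.2.trans h⟩]
    · rw [not_le] at h
      have hc : ContinuousOn (fun s => U (min s T) x) (Icc 0 (T + τ)) :=
        (hU.strongly_continuous x).comp (by fun_prop) fun s hs =>
          ⟨le_min hs.1 hT0, min_le_right _ _⟩
      have e : vconv k (fun s => U (min s T) x) t
          = (∫ s in (0 : ℝ)..T, k (t - s) • extend k τ S (n + 1) s x)
            + prim k (t - T) • U T x := by
        have e0 : T + (t - T) = t := by ring
        have := vconv_add_arg (k := k) (u := fun s => U (min s T) x) hT0 (sub_nonneg.2 h.le)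
          (hk.integrableOn_Icc _) (hc.bddMeasOn.mono (by linarith [ht.2]))
        rw [e0] at this
        rw [this]
        congr 1
        · refine intervalIntegral.integral_congr fun s hs => ?_
          rw [uIcc_of_le hT0] at hs
          simp only [min_eq_left hs.2]
          rw [hUe s hs]
        · rw [← vconv_const]
          refine vconv_congr (by linarith) (fun _ _ => rfl) fun s hs => ?_
          simp only [min_eq_right (show T ≤ T + s by linarith [hs.1])]
      rw [max_eq_left (by linarith), e, ← hUe T ⟨hT0, le_rfl⟩, map_sub, map_smul]
      have e2 : vconv (fun s => convPow k (n + 1) (T + s)) (fun s => S s x) (t - T)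
          = ∫ s in (0 : ℝ)..(t - T), convPow k (n + 1) (t - s) • S s x := by
        refine intervalIntegral.integral_congr fun s _ => ?_
        simp only
        congr 2; ring
      rw [e2]
      abel

/-! ### Test functions on the half-line -/

/-- Smooth functions that vanish far to the right restrict to elements of `𝓓₊`: they can be cut off on
the negative half-line. -/
theorem mem_testPlus_of_contDiff {φ : ℝ → ℂ} (hφ : ContDiff ℝ ∞ φ) {b : ℝ}
    (hb : ∀ t, b < t → φ t = 0) : (Ici (0 : ℝ)).indicator φ ∈ TestPlus := by
  refine ⟨fun t => (Real.smoothTransition (t + 1) : ℂ) * φ t, ?_, ?_, ?_⟩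
  · have h1 : ContDiff ℝ ∞ fun t : ℝ => Real.smoothTransition (t + 1) :=
      Real.smoothTransition.contDiff.comp (contDiff_id.add contDiff_const)
    exact (Complex.ofRealCLM.contDiff.comp h1).mul hφ
  · refine HasCompactSupport.intro (K := Icc (-1) b) isCompact_Icc fun t ht => ?_
    rcases lt_or_ge t (-1) with h | h
    · simp [Real.smoothTransition.zero_of_nonpos (by linarith : t + 1 ≤ 0)]
    · simp [hb t (by by_contra h'; exact ht ⟨h, not_lt.1 h'⟩)]
  · refine indicator_congr fun t ht => ?_
    have h0 : (0 : ℝ) ≤ t := ht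
    simp [Real.smoothTransition.one_of_one_le (by linarith : 1 ≤ t + 1)]

theorem exists_of_mem_testPlus {g : ℝ → ℂ} (hg : g ∈ TestPlus) :
    ∃ (φ : ℝ → ℂ) (b : ℝ), ContDiff ℝ ∞ φ ∧ HasCompactSupport φ ∧ 0 ≤ b ∧
      (∀ t, b < t → φ t = 0) ∧ g = (Ici (0 : ℝ)).indicator φ := by
  obtain ⟨φ, h1, h2, h3⟩ := hg
  obtain ⟨b, hb⟩ := h2.isCompact.bddAbove
  refine ⟨φ, max b 0, h1, h2, le_max_right _ _, fun t ht => ?_, h3⟩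
  by_contra h
  exact absurd (hb (subset_tsupport φ h)) (not_le.2 ((le_max_left _ _).trans_lt ht))

theorem testPlus_of_neg {g : ℝ → ℂ} (hg : g ∈ TestPlus) : ∀ t < 0, g t = 0 := by
  obtain ⟨φ, _, _, rfl⟩ := hg
  exact fun t ht => indicator_of_notMem (not_le.2 ht) _

theorem testPlus_exists_bound {g : ℝ → ℂ} (hg : g ∈ TestPlus) :
    ∃ b, 0 ≤ b ∧ ∀ t, b < t → g t = 0 := by
  obtain ⟨φ, b, _, _, h0, hb, rfl⟩ := exists_of_mem_testPlus hg
  exact ⟨b, h0, fun t ht => by simp [indicator, hb t ht]⟩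

theorem testPlus_continuousOn {g : ℝ → ℂ} (hg : g ∈ TestPlus) : ContinuousOn g (Ici 0) := by
  obtain ⟨φ, h, _, rfl⟩ := hg
  exact h.continuous.continuousOn.congr (fun t ht => indicator_of_mem ht _)

theorem testPlus_continuousOn_Icc {g : ℝ → ℂ} (hg : g ∈ TestPlus) (T : ℝ) :
    ContinuousOn g (Icc 0 T) := (testPlus_continuousOn hg).mono Icc_subset_Ici_self

theorem testPlus_exists_norm_le {g : ℝ → ℂ} (hg : g ∈ TestPlus) : ∃ C, ∀ t, ‖g t‖ ≤ C := by
  obtain ⟨φ, h, hc, rfl⟩ := hg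
  obtain ⟨C, hC⟩ := hc.exists_bound_of_continuous h.continuous
  exact ⟨C, fun t => (norm_indicator_le_norm_self _ _).trans (hC t)⟩

theorem continuousOn_comp_sub_left {g : ℝ → ℂ} (hg : g ∈ TestPlus) {a T : ℝ} (h : T ≤ a) :
    ContinuousOn (fun v => g (a - v)) (Icc 0 T) :=
  (testPlus_continuousOn hg).comp (continuous_const.sub continuous_id).continuousOn
    fun v hv => by simp only [mem_Ici]; linarith [hv.2]

/-- On `[0, ∞)` the dual convolution is the convolution over the whole line with the reflected,
truncated kernel. -/
theorem dualConv_indicator (k : ℝ → ℂ) {φ : ℝ → ℂ} {b : ℝ} (hb : ∀ t, b < t → φ t = 0) :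
    dualConv k ((Ici (0 : ℝ)).indicator φ) = (Ici (0 : ℝ)).indicator
      (convolution (fun v => trunc b k (-v)) φ (ContinuousLinearMap.mul ℝ ℂ) volume) := by
  refine indicator_congr fun t ht => ?_
  have ht0 : (0 : ℝ) ≤ t := ht
  have e := integral_sub_left_eq_self (μ := volume)
    (fun v => trunc b k (-v) * φ (t - v)) t
  rw [convolution_def]
  simp only [ContinuousLinearMap.mul_apply']
  rw [← e, ← integral_Ici_eq_integral_Ioi, ← integral_indicator measurableSet_Ici]
  congr 1 with s
  simp only [sub_sub_cancel, neg_sub]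
  rcases lt_or_ge s t with h | h
  · rw [indicator_of_notMem (show s ∉ Ici t from not_le.2 h), trunc_of_neg _ _ _ (by linarith), zero_mul]
  · rw [indicator_of_mem (show s ∈ Ici t from h),
      indicator_of_mem (show s ∈ Ici (0 : ℝ) from ht0.trans h)]
    rcases lt_or_ge b s with h' | h'
    · simp [hb s h']
    · rw [trunc_eqOn b k ⟨by linarith, by linarith⟩]

theorem locallyIntegrable_trunc_neg {k : ℝ → ℂ} {b : ℝ} (hk : IntegrableOn k (Icc 0 b)) :
    LocallyIntegrable (fun v => trunc b k (-v)) :=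
  (integrable_trunc hk).comp_neg.locallyIntegrable

theorem dualConv_mem_testPlus {k g : ℝ → ℂ} (hk : ∀ T, IntegrableOn k (Icc 0 T))
    (hg : g ∈ TestPlus) : dualConv k g ∈ TestPlus := by
  obtain ⟨φ, b, h1, h2, h0, hb, rfl⟩ := exists_of_mem_testPlus hg
  rw [dualConv_indicator k hb]
  refine mem_testPlus_of_contDiff (b := b) (h2.contDiff_convolution_right (n := ⊤) _
    (locallyIntegrable_trunc_neg (hk b)) h1) fun t ht => ?_
  rw [convolution_def]
  refine integral_eq_zero_of_ae (Eventually.of_forall fun v => ?_)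
  rcases le_or_gt v 0 with h | h
  · simp [hb (t - v) (by linarith)]
  · simp [trunc_of_neg b k (-v) (by linarith)]

/-- The derivative of `g` on `[0, ∞)`, extended by zero. -/
noncomputable def derivPlus (g : ℝ → ℂ) : ℝ → ℂ := derivWithin g (Ici 0)

theorem derivPlus_indicator {φ : ℝ → ℂ} (hφ : Differentiable ℝ φ) :
    derivPlus ((Ici (0 : ℝ)).indicator φ) = (Ici (0 : ℝ)).indicator (deriv φ) := by
  ext t
  by_cases ht : t ∈ Ici (0 : ℝ)
  · rw [indicator_of_mem ht, derivPlus,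
      derivWithin_congr (fun s hs => indicator_of_mem hs φ) (indicator_of_mem ht φ),
      (hφ t).derivWithin (uniqueDiffOn_Ici 0 t ht)]
  · rw [indicator_of_notMem ht, derivPlus, derivWithin_zero_of_notMem_closure]
    rwa [isClosed_Ici.closure_eq]

theorem derivPlus_mem_testPlus {g : ℝ → ℂ} (hg : g ∈ TestPlus) : derivPlus g ∈ TestPlus := by
  obtain ⟨φ, h1, h2, rfl⟩ := hg
  rw [derivPlus_indicator (h1.differentiable (by simp))]
  exact ⟨_, (contDiff_infty_iff_deriv.1 h1).2, h2.deriv, rfl⟩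

theorem hasDerivAt_testPlus {g : ℝ → ℂ} (hg : g ∈ TestPlus) {t : ℝ} (ht : 0 < t) :
    HasDerivAt g (derivPlus g t) t := by
  obtain ⟨φ, h1, h2, rfl⟩ := hg
  rw [derivPlus_indicator (h1.differentiable (by simp)), indicator_of_mem (by exact ht.le)]
  refine ((h1.differentiable (by simp)) t).hasDerivAt.congr_of_eventuallyEq ?_
  filter_upwards [Ioi_mem_nhds ht] with s hs using
    indicator_of_mem (show s ∈ Ici (0 : ℝ) from le_of_lt (show 0 < s from hs)) _

theorem derivPlus_of_gt {g : ℝ → ℂ} (hg : g ∈ TestPlus) {b : ℝ} (hb0 : 0 ≤ b)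
    (hb : ∀ t, b < t → g t = 0) : ∀ t, b < t → derivPlus g t = 0 := by
  intro t ht
  refine (hasDerivAt_testPlus hg (hb0.trans_lt ht)).unique
    ((hasDerivAt_const t (0 : ℂ)).congr_of_eventuallyEq ?_)
  filter_upwards [Ioi_mem_nhds ht] with s hs using hb s hs

theorem derivPlus_dualConv {k g : ℝ → ℂ} (hk : ∀ T, IntegrableOn k (Icc 0 T))
    (hg : g ∈ TestPlus) : derivPlus (dualConv k g) = dualConv k (derivPlus g) := by
  obtain ⟨φ, b, h1, h2, h0, hb, rfl⟩ := exists_of_mem_testPlus hg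
  have hb' : ∀ t, b < t → deriv φ t = 0 := by
    intro t ht
    have : φ =ᶠ[𝓝 t] fun _ => 0 := by
      filter_upwards [Ioi_mem_nhds ht] with s hs using hb s hs
    rw [this.deriv_eq, deriv_const]
  have hd := fun t => h2.hasDerivAt_convolution_right (ContinuousLinearMap.mul ℝ ℂ)
    (locallyIntegrable_trunc_neg (hk b)) (h1.of_le (by simp)) t
  rw [derivPlus_indicator (h1.differentiable (by simp)), dualConv_indicator k hb,
    dualConv_indicator k hb', derivPlus_indicator fun t => (hd t).differentiableAt]
  exact indicator_congr fun t _ => (hd t).deriv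

/-- Left translation of a function on the half-line, extended by zero. -/
noncomputable def leftTranslate (a : ℝ) (g : ℝ → ℂ) : ℝ → ℂ :=
  (Ici (0 : ℝ)).indicator fun t => g (a + t)

theorem leftTranslate_of_gt {a b : ℝ} {g : ℝ → ℂ} (ha : 0 ≤ a) (hb : ∀ t, b < t → g t = 0) :
    ∀ t, b < t → leftTranslate a g t = 0 := fun t ht => by
  simp [leftTranslate, indicator, hb (a + t) (by linarith)]

theorem leftTranslate_mem_testPlus {a : ℝ} (ha : 0 ≤ a) {g : ℝ → ℂ} (hg : g ∈ TestPlus) :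
    leftTranslate a g ∈ TestPlus := by
  obtain ⟨φ, b, h1, h2, h0, hb, rfl⟩ := exists_of_mem_testPlus hg
  have : leftTranslate a ((Ici (0 : ℝ)).indicator φ)
      = (Ici (0 : ℝ)).indicator fun t => φ (a + t) :=
    indicator_congr fun t ht => indicator_of_mem (add_nonneg ha ht) _
  rw [this]
  exact mem_testPlus_of_contDiff (h1.comp (contDiff_const.add contDiff_id)) (b := b - a)
    fun t ht => hb _ (by linarith)

theorem leftTranslate_dualConv {a : ℝ} (ha : 0 ≤ a) (k g : ℝ → ℂ) :
    leftTranslate a (dualConv k g) = dualConv k (leftTranslate a g) := by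
  refine indicator_congr fun t ht => ?_
  have ht0 : (0 : ℝ) ≤ t := ht
  rw [dualConv, indicator_of_mem (by exact add_nonneg ha ht0)]
  have := integral_add_left_eq_self (μ := volume)
    ((Ioi (a + t)).indicator fun s => k (s - (a + t)) * g s) a
  rw [integral_indicator measurableSet_Ioi] at this
  rw [← this, ← integral_indicator measurableSet_Ioi]
  congr 1 with s
  by_cases hs : t < s
  · rw [indicator_of_mem (show a + s ∈ Ioi (a + t) by simpa), indicator_of_mem (by exact hs),
      leftTranslate, indicator_of_mem (by exact (ht0.trans hs.le))]
    ring_nf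
  · rw [indicator_of_notMem (show a + s ∉ Ioi (a + t) by simpa using hs),
      indicator_of_notMem (by exact hs)]

theorem derivPlus_leftTranslate {a : ℝ} (ha : 0 ≤ a) {g : ℝ → ℂ} (hg : g ∈ TestPlus) :
    derivPlus (leftTranslate a g) = leftTranslate a (derivPlus g) := by
  obtain ⟨φ, b, h1, h2, h0, hb, rfl⟩ := exists_of_mem_testPlus hg
  have hd := h1.differentiable (by simp)
  have e : ∀ ψ : ℝ → ℂ, leftTranslate a ((Ici (0 : ℝ)).indicator ψ)
      = (Ici (0 : ℝ)).indicator fun t => ψ (a + t) := fun ψ =>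
    indicator_congr fun t ht => indicator_of_mem (add_nonneg ha ht) _
  have hd' : Differentiable ℝ fun t => φ (a + t) :=
    hd.comp ((differentiable_const a).add differentiable_id)
  rw [e, derivPlus_indicator hd, e, derivPlus_indicator hd']
  exact indicator_congr fun t _ => deriv_comp_const_add _ _ _

theorem conv_eq_integral {f g : ℝ → ℂ} (hf : ∀ t < 0, f t = 0) (hg : ∀ t < 0, g t = 0) (t : ℝ) :
    conv f g t = ∫ s, f (t - s) * g s := by
  rcases le_or_gt 0 t with ht | ht
  · rw [conv, intervalIntegral.integral_of_le ht, ← integral_Icc_eq_integral_Ioc,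
      ← integral_indicator measurableSet_Icc]
    congr 1 with s
    by_cases hs : s ∈ Icc 0 t
    · rw [indicator_of_mem hs]
    · rw [indicator_of_notMem hs]
      rcases lt_or_ge s 0 with h | h
      · rw [hg s h, mul_zero]
      · rw [hf (t - s) (by by_contra h'; exact hs ⟨h, by linarith⟩), zero_mul]
  · rw [integral_eq_zero_of_ae, conv, intervalIntegral.integral_symm,
      intervalIntegral.integral_of_le ht.le, setIntegral_congr_ae (g := fun _ => 0)
        measurableSet_Ioc]
    · simp
    · filter_upwards [Measure.ae_ne volume (0 : ℝ)] with s hs0 hs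
      rw [hg s (lt_of_le_of_ne hs.2 hs0), mul_zero]
    · refine Eventually.of_forall fun s => ?_
      rcases lt_or_ge s 0 with h | h
      · simp [hg s h]
      · simp [hf (t - s) (by linarith)]

/-- The reversal of a convolution of compactly supported functions is the convolution of the
reversals. -/
theorem conv_sub_left {f g : ℝ → ℂ} {a b : ℝ} (hf : ∀ t < 0, f t = 0) (hg : ∀ t < 0, g t = 0)
    (hfa : ∀ t, a < t → f t = 0) (hgb : ∀ t, b < t → g t = 0) (v : ℝ) :
    conv f g (a + b - v) = conv (fun s => f (a - s)) (fun s => g (b - s)) v := by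
  rw [conv_eq_integral hf hg, conv_eq_integral (fun t ht => hfa _ (by linarith))
    fun t ht => hgb _ (by linarith)]
  rw [← integral_sub_left_eq_self _ volume b]
  congr 1 with s
  ring_nf

/-- The space `𝓓₊` is an algebra under convolution. -/
theorem conv_mem_testPlus {f g : ℝ → ℂ} (hf : f ∈ TestPlus) (hg : g ∈ TestPlus) :
    conv f g ∈ TestPlus := by
  obtain ⟨φ, a, hφ, hφc, ha0, ha, rfl⟩ := exists_of_mem_testPlus hf
  obtain ⟨ψ, b, hψ, hψc, hb0, hb, rfl⟩ := exists_of_mem_testPlus hg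
  have hφi : Integrable φ := hφ.continuous.integrable_of_hasCompactSupport hφc
  have hψi : Integrable ψ := hψ.continuous.integrable_of_hasCompactSupport hψc
  set L := ContinuousLinearMap.mul ℝ ℂ
  -- the smooth function extending the convolution to the whole line is the difference of two
  -- convolutions of an integrable function with a smooth one
  set Φ : ℝ → ℂ := fun t => convolution ((Ici (0 : ℝ)).indicator φ) ψ L volume t
    - convolution ((Iio (0 : ℝ)).indicator ψ) φ L volume t
  have hΦ : ContDiff ℝ ∞ Φ := (hψc.contDiff_convolution_right (n := ⊤) L
      (hφi.indicator measurableSet_Ici).locallyIntegrable hψ).sub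
    (hφc.contDiff_convolution_right (n := ⊤) L
      (hψi.indicator measurableSet_Iio).locallyIntegrable hφ)
  have hneg : ∀ χ : ℝ → ℂ, ∀ t < 0, (Ici (0 : ℝ)).indicator χ t = 0 := fun χ t ht =>
    indicator_of_notMem (not_le.2 ht) _
  have key : ∀ t, 0 ≤ t → conv ((Ici (0 : ℝ)).indicator φ) ((Ici (0 : ℝ)).indicator ψ) t = Φ t := by
    intro t ht
    obtain ⟨C, hC⟩ := hψc.exists_bound_of_continuous hψ.continuous
    have e : convolution ((Iio (0 : ℝ)).indicator ψ) φ L volume t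
        = ∫ s, φ s * (Iio (0 : ℝ)).indicator ψ (t - s) := by
      rw [convolution_def, ← integral_sub_left_eq_self _ volume t]
      congr 1 with s
      simp [L, mul_comm]
    rw [conv_comm, conv_eq_integral (hneg _) (hneg _)]
    simp only [Φ]
    rw [e, convolution_def, ← integral_sub]
    · congr 1 with s
      simp only [L, ContinuousLinearMap.mul_apply', indicator, mem_Ici, mem_Iio]
      by_cases h1 : 0 ≤ s
      · by_cases h2 : s ≤ t
        · simp [h1, h2, not_lt.2 h2, mul_comm]
        · simp [h1, h2, not_le.1 h2]
      · have h1' : s < 0 := not_le.1 h1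
        simp [h1, show s ≤ t by linarith]
    · simp only [L, ContinuousLinearMap.mul_apply']
      refine (hφi.indicator measurableSet_Ici).mul_bdd (c := C) ?_
        (Eventually.of_forall fun s => hC _)
      exact (hψ.continuous.comp (continuous_const.sub continuous_id)).aestronglyMeasurable
    · refine hφi.mul_bdd (c := C) ?_ (Eventually.of_forall fun s =>
        (norm_indicator_le_norm_self _ _).trans (hC _))
      exact ((hψi.indicator measurableSet_Iio).comp_sub_left t).aestronglyMeasurable
  have hz : ∀ t, a + b < t →
      conv ((Ici (0 : ℝ)).indicator φ) ((Ici (0 : ℝ)).indicator ψ) t = 0 := by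
    intro t ht
    rw [conv_eq_integral (hneg _) (hneg _)]
    refine integral_eq_zero_of_ae (Eventually.of_forall fun s => ?_)
    rcases lt_or_ge b s with h | h
    · simp [indicator, hb s h]
    · simp [indicator, ha (t - s) (by linarith)]
  have : conv ((Ici (0 : ℝ)).indicator φ) ((Ici (0 : ℝ)).indicator ψ)
      = (Ici (0 : ℝ)).indicator Φ := by
    ext t
    by_cases ht : t ∈ Ici (0 : ℝ)
    · rw [indicator_of_mem ht, key t ht]
    · rw [indicator_of_notMem ht, conv_eq_integral (hneg _) (hneg _)]
      refine integral_eq_zero_of_ae (Eventually.of_forall fun s => ?_)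
      have : t < 0 := not_le.1 ht
      rcases lt_or_ge s 0 with h | h
      · simp [hneg ψ s h]
      · simp [hneg φ (t - s) (by linarith)]
  rw [this]
  refine mem_testPlus_of_contDiff hΦ (b := a + b) fun t ht => ?_
  rw [← key t (by linarith), hz t ht]

/-! ### The dual convolution and its inverse -/

theorem conv_of_gt {f g : ℝ → ℂ} {a b : ℝ} (hf : ∀ t < 0, f t = 0) (hg : ∀ t < 0, g t = 0)
    (ha : ∀ t, a < t → f t = 0) (hb : ∀ t, b < t → g t = 0) : ∀ t, a + b < t → conv f g t = 0 := by
  intro t ht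
  rw [conv_eq_integral hf hg]
  refine integral_eq_zero_of_ae (Eventually.of_forall fun s => ?_)
  rcases lt_or_ge b s with h | h
  · simp [hb s h]
  · simp [ha (t - s) (by linarith)]

theorem testPlus_bddMeasOn {g : ℝ → ℂ} (hg : g ∈ TestPlus) (a T : ℝ) :
    BddMeasOn T fun v => g (a - v) := by
  obtain ⟨C, hC⟩ := testPlus_exists_norm_le hg
  obtain ⟨φ, h, _, rfl⟩ := hg
  refine ⟨?_, C, fun t _ => hC _⟩
  have : Measurable ((Ici (0 : ℝ)).indicator φ) :=
    h.continuous.measurable.indicator measurableSet_Ici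
  exact (this.comp (measurable_const.sub measurable_id)).aestronglyMeasurable

theorem dualConv_of_neg (k g : ℝ → ℂ) : ∀ t < 0, dualConv k g t = 0 := fun _ ht =>
  indicator_of_notMem (not_le.2 ht) _

theorem dualConv_of_ge (k : ℝ → ℂ) {g : ℝ → ℂ} {b : ℝ} (hb : ∀ t, b < t → g t = 0) :
    ∀ t, b ≤ t → dualConv k g t = 0 := by
  intro t ht
  rw [dualConv, indicator]
  split_ifs
  · rw [setIntegral_congr_fun (g := fun _ => 0) measurableSet_Ioi fun s hs => ?_]
    · simp
    · have : b < s := lt_of_le_of_lt ht hs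
      simp [hb s this]
  · rfl

/-- Reversing the time turns the dual convolution into a convolution. -/
theorem dualConv_sub_left (k : ℝ → ℂ) {g : ℝ → ℂ} {T : ℝ} (hg : ∀ t, T < t → g t = 0) {v : ℝ}
    (hv : v ∈ Icc 0 T) : dualConv k g (T - v) = conv k (fun s => g (T - s)) v := by
  rw [dualConv, indicator_of_mem (show T - v ∈ Ici (0 : ℝ) from sub_nonneg.2 hv.2), conv,
    intervalIntegral.integral_of_le hv.1, ← integral_Icc_eq_integral_Ioc,
    ← integral_Ici_eq_integral_Ioi, ← integral_indicator measurableSet_Icc,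
    ← integral_indicator measurableSet_Ici, ← integral_sub_left_eq_self _ volume T]
  congr 1 with s
  simp only [indicator, mem_Ici, mem_Icc]
  by_cases h : 0 ≤ s
  · by_cases h' : s ≤ v
    · rw [if_pos (by linarith), if_pos ⟨h, h'⟩]
      ring_nf
    · rw [if_neg (c := _ ≤ _) (by linarith), if_neg (fun h2 => h' h2.2)]
  · rw [if_neg (c := _ ∧ _) (fun h2 => h h2.1), hg (T - s) (by linarith)]
    simp

section

variable {k : ℝ → ℂ} {g : ℝ → ℂ}

theorem dualConv_add {f : ℝ → ℂ} (hk : LocallyIntegrableOn k (Ici 0)) (hf : f ∈ TestPlus)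
    (hg : g ∈ TestPlus) : dualConv k (f + g) = dualConv k f + dualConv k g := by
  ext t
  by_cases ht : t ∈ Ici (0 : ℝ)
  · simp only [dualConv, Pi.add_apply, indicator_of_mem ht, mul_add]
    exact integral_add (integrableOn_dualConv hk hf ht) (integrableOn_dualConv hk hg ht)
  · simp [dualConv, indicator_of_notMem ht]

theorem dualConv_smul (k : ℝ → ℂ) (c : ℂ) (g : ℝ → ℂ) :
    dualConv k (c • g) = c • dualConv k g := by
  ext t
  by_cases ht : t ∈ Ici (0 : ℝ)
  · simp only [dualConv, Pi.smul_apply, indicator_of_mem ht, smul_eq_mul, mul_left_comm]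
    exact integral_const_mul c _
  · simp [dualConv, indicator_of_notMem ht]

/-- Titchmarsh's theorem for the dual convolution. -/
theorem eq_zero_of_dualConv_eq_zero (hk0 : ZeroMemSupp k) (hk : LocallyIntegrableOn k (Ici 0))
    (hg : g ∈ TestPlus) {b : ℝ} (hb : 0 ≤ b) (h : ∀ t, b < t → dualConv k g t = 0) :
    ∀ t, b ≤ t → g t = 0 := by
  obtain ⟨c, hc0, hc⟩ := testPlus_exists_bound hg
  intro t ht
  set T := max c t + 1
  have hcT : c < T := by have := le_max_left c t; simp only [T]; linarith
  have htT : t < T := by have := le_max_right c t; simp only [T]; linarith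
  have key := eqOn_zero_of_vconv_eq_zero (T := T - b) (u := fun v => g (T - v)) (by linarith) hk0
    (hk.integrableOn_Icc _) (continuousOn_comp_sub_left hg (by linarith)) (fun v hv => ?_)
    (T - t) ⟨by linarith, by linarith⟩
  · simpa using key
  · rw [← conv_eq_vconv, ← dualConv_sub_left k (fun s hs => hc s (hcT.trans hs))
      ⟨hv.1.le, by linarith [hv.2]⟩]
    exact h _ (by linarith [hv.2])

theorem dualConv_injective (hk0 : ZeroMemSupp k) (hk : LocallyIntegrableOn k (Ici 0)) {f : ℝ → ℂ}
    (hf : f ∈ TestPlus) (hg : g ∈ TestPlus) (h : dualConv k f = dualConv k g) : f = g := by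
  have hd := TestPlus.sub_mem hf hg
  have hz : dualConv k (f - g) = 0 := by
    have := dualConv_add hk hd hg
    rw [sub_add_cancel, h] at this
    exact right_eq_add.1 this
  ext t
  rcases lt_or_ge t 0 with ht | ht
  · rw [testPlus_of_neg hf t ht, testPlus_of_neg hg t ht]
  · exact sub_eq_zero.1 (eq_zero_of_dualConv_eq_zero hk0 hk hd le_rfl (fun s _ => by simp [hz]) t ht)

theorem W_dualConv (hk0 : ZeroMemSupp k) (hk : LocallyIntegrableOn k (Ici 0))
    (hg : g ∈ TestPlus) : W k (dualConv k g) = g := by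
  have h : ∃ g' ∈ TestPlus, dualConv k g' = dualConv k g := ⟨g, hg, rfl⟩
  rw [W, dif_pos h]
  exact dualConv_injective hk0 hk h.choose_spec.1 hg h.choose_spec.2

theorem dualConv_conv {l : ℝ → ℂ} (hk : LocallyIntegrableOn k (Ici 0))
    (hl : LocallyIntegrableOn l (Ici 0)) (hg : g ∈ TestPlus) :
    dualConv (conv k l) g = dualConv k (dualConv l g) := by
  obtain ⟨c, hc0, hc⟩ := testPlus_exists_bound hg
  ext t
  rcases lt_or_ge t 0 with ht | ht
  · rw [dualConv_of_neg _ _ t ht, dualConv_of_neg _ _ t ht]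
  obtain ⟨T, v, hcT, hv, rfl⟩ : ∃ T v, c ≤ T ∧ v ∈ Icc 0 T ∧ t = T - v :=
    ⟨max c t, max c t - t, le_max_left _ _, ⟨sub_nonneg.2 (le_max_right _ _), by linarith⟩, by ring⟩
  have hgT : ∀ s, T < s → g s = 0 := fun s hs => hc s (hcT.trans_lt hs)
  rw [dualConv_sub_left _ hgT hv,
    dualConv_sub_left _ (fun s hs => dualConv_of_ge l hgT s hs.le) hv]
  change vconv (conv k l) _ v = vconv k _ v
  rw [← vconv_vconv (hk.integrableOn_Icc T) (hl.integrableOn_Icc T)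
      (testPlus_bddMeasOn hg T T) hv]
  exact vconv_congr hv.1 (fun _ _ => rfl) fun s hs =>
    (dualConv_sub_left l hgT ⟨hs.1, hs.2.trans hv.2⟩).symm

end

/-- The convolution of two dual convolutions with the kernel `k` is again a dual convolution with
the kernel `k`, of the function which also appears in `integral_smul_apply_integral_smul`. -/
theorem conv_dualConv_dualConv {k f g : ℝ → ℂ} (hk : LocallyIntegrableOn k (Ici 0))
    (hf : f ∈ TestPlus) (hg : g ∈ TestPlus) {a b : ℝ} (ha : 0 ≤ a) (hb : 0 ≤ b)
    (hfa : ∀ t, a < t → f t = 0) (hgb : ∀ t, b < t → g t = 0) :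
    conv (dualConv k f) (dualConv k g) = dualConv k (conv (dualConv k f) g
      - dualConv (fun u => conv (fun v => g (b - v)) k (b + u)) f) := by
  have hkT := hk.integrableOn_Icc
  set φ := dualConv k f with hφ
  set ψ := dualConv k g with hψ
  set h : ℝ → ℂ := fun v => g (b - v) with hh
  set F : ℝ → ℂ := fun u => conv h k (b + u) with hF
  have hφP : φ ∈ TestPlus := dualConv_mem_testPlus hkT hf
  have hψP : ψ ∈ TestPlus := dualConv_mem_testPlus hkT hg
  have hhB : ∀ T, BddMeasOn T h := testPlus_bddMeasOn hg b
  have hFT : ∀ T, IntegrableOn F (Icc 0 T) := fun T => by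
    have := integrableOn_comp_add_left hb
      (integrableOn_conv (hhB (b + T)).integrableOn (hkT (b + T)))
    rwa [add_sub_cancel_left] at this
  have hFf : dualConv F f ∈ TestPlus := dualConv_mem_testPlus hFT hf
  have hφa := dualConv_of_ge k hfa
  have hψb := dualConv_of_ge k hgb
  have hφ0 := testPlus_of_neg hφP
  have hψ0 := testPlus_of_neg hψP
  have hHT : ∀ t, a + b < t → (conv φ g - dualConv F f) t = 0 := fun t ht => by
    rw [Pi.sub_apply, conv_of_gt hφ0 (testPlus_of_neg hg) (fun t ht => hφa t ht.le) hgb t ht,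
      dualConv_of_ge F hfa t (by linarith), sub_zero]
  ext t
  rcases lt_or_ge t 0 with ht | ht
  · rw [testPlus_of_neg (conv_mem_testPlus hφP hψP) t ht, dualConv_of_neg _ _ t ht]
  rcases lt_or_ge (a + b) t with htT | htT
  · rw [conv_of_gt hφ0 hψ0 (fun t ht => hφa t ht.le) (fun t ht => hψb t ht.le) t htT,
      dualConv_of_ge k hHT t htT.le]
  obtain ⟨v, hv, rfl⟩ : ∃ v ∈ Icc 0 (a + b), t = a + b - v :=
    ⟨a + b - t, ⟨by linarith, by linarith⟩, by ring⟩
  set P : ℝ → ℂ := fun s => φ (a - s) with hP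
  set Q : ℝ → ℂ := fun s => ψ (b - s) with hQ
  set R : ℝ → ℂ := fun s => dualConv F f (a + b - s) with hR
  have hPB : ∀ T, BddMeasOn T P := testPlus_bddMeasOn hφP a
  have hQB : ∀ T, BddMeasOn T Q := testPlus_bddMeasOn hψP b
  have hRB : ∀ T, BddMeasOn T R := testPlus_bddMeasOn hFf (a + b)
  have hPT := fun T => (hPB T).integrableOn
  have hkh : BddMeasOn (a + b) (vconv k h) := (hhB _).vconv (hkT _)
  have hv0 : (0 : ℝ) ≤ a + b := by linarith
  rw [conv_sub_left hφ0 hψ0 (fun t ht => hφa t ht.le) (fun t ht => hψb t ht.le),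
    dualConv_sub_left k hHT hv]
  have e1 : (fun s => (conv φ g - dualConv F f) (a + b - s)) = fun s => vconv P h s - R s := by
    ext s
    rw [Pi.sub_apply, conv_sub_left hφ0 (testPlus_of_neg hg) (fun t ht => hφa t ht.le) hgb]
    rfl
  rw [e1, conv_eq_vconv k, vconv_sub_right (hkT _) ((hhB _).vconv (hPT _)) (hRB _) hv,
    vconv_vconv (hkT _) (hPT _) (hhB _) hv, conv_comm k P,
    ← vconv_vconv (hPT _) (hkT _) (hhB _) hv, conv_eq_vconv, eq_sub_iff_add_eq, ← eq_sub_iff_add_eq',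
    ← vconv_sub_right (hPT _) hkh (hQB _) hv]
  -- both remaining functions vanish on `[0, b]`; it remains to compare them beyond `b`
  have hu : BddMeasOn (a + b) fun s => vconv k h s - Q s :=
    ⟨hkh.aesm.sub (hQB _).aesm, by
      obtain ⟨C, hC⟩ := hkh.bdd
      obtain ⟨D, hD⟩ := (hQB (a + b)).bdd
      exact ⟨C + D, fun t ht => (norm_sub_le _ _).trans (add_le_add (hC t ht) (hD t ht))⟩⟩
  rw [vconv_of_eqOn_zero hb hv (hkT _) (hRB _) fun s hs => dualConv_of_ge F hfa _ (by linarith [hs.2]),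
    vconv_of_eqOn_zero hb hv (hPT _) hu fun s hs => sub_eq_zero.2 (dualConv_sub_left k hgb hs).symm]
  have hr : max (v - b) 0 ∈ Icc 0 a := ⟨le_max_right _ _, max_le (by linarith [hv.2]) ha⟩
  generalize max (v - b) 0 = r at hr
  have e2 : vconv P (fun s => vconv k h (b + s) - Q (b + s)) r = vconv P F r := by
    refine intervalIntegral.integral_congr_ae (Eventually.of_forall fun s hs => ?_)
    rw [uIoc_of_le hr.1] at hs
    simp only [hQ, hF]
    rw [hψ0 _ (by linarith [hs.1]), sub_zero, conv_comm, conv_eq_vconv]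
  have e3 : vconv k (fun s => R (b + s)) r = vconv k (vconv F fun s => f (a - s)) r := by
    refine vconv_congr hr.1 (fun _ _ => rfl) fun s hs => ?_
    simp only [hR]
    rw [show a + b - (b + s) = a - s by ring, dualConv_sub_left F hfa ⟨hs.1, hs.2.trans hr.2⟩,
      conv_eq_vconv]
  have e4 : vconv P F r = vconv F (vconv k fun s => f (a - s)) r := by
    rw [← conv_eq_vconv, conv_comm, conv_eq_vconv]
    exact vconv_congr hr.1 (fun _ _ => rfl) fun s hs =>
      dualConv_sub_left k hfa ⟨hs.1, hs.2.trans hr.2⟩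
  rw [e2, e3, e4, vconv_vconv (hFT a) (hkT a) (testPlus_bddMeasOn hf a a) hr,
    vconv_vconv (hkT a) (hFT a) (testPlus_bddMeasOn hf a a) hr, conv_comm]

/-! ### The test space of all convolution powers -/

theorem mem_testKInf {k f : ℝ → ℂ} {hk : LocallyIntegrableOn k (Ici 0)} :
    f ∈ TestKInf k hk ↔ ∀ n, 1 ≤ n → ∃ g ∈ TestPlus, dualConv (convPow k n) g = f := by
  simp only [TestKInf, Submodule.mem_iInf]
  rfl

theorem convPow_succ (k : ℝ → ℂ) {n : ℕ} (hn : 1 ≤ n) :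
    convPow k (n + 1) = conv k (convPow k n) := by
  obtain ⟨m, rfl⟩ : ∃ m, n = m + 1 := ⟨n - 1, by omega⟩
  rfl

section

variable {k f : ℝ → ℂ} {hk : LocallyIntegrableOn k (Ici 0)} (hk0 : ZeroMemSupp k)
  (hf : f ∈ TestKInf k hk)

include hf

theorem testKInf_mem_testPlus : f ∈ TestPlus := by
  obtain ⟨g, hg, rfl⟩ := mem_testKInf.1 hf 1 le_rfl
  exact dualConv_mem_testPlus (convPow_locallyIntegrableOn hk 1).integrableOn_Icc hg

theorem tsupport_subset_Icc_iff {b : ℝ} :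
    tsupport f ⊆ Icc 0 b ↔ ∀ t, b < t → f t = 0 := by
  have hf0 := testPlus_of_neg (testKInf_mem_testPlus hf)
  refine ⟨fun h t ht => ?_, fun h => closure_minimal (fun t ht => ?_) isClosed_Icc⟩
  · exact image_eq_zero_of_notMem_tsupport fun h' => absurd (h h').2 (not_le.2 ht)
  · refine ⟨?_, ?_⟩ <;> by_contra h'
    · exact ht (hf0 t (not_le.1 h'))
    · exact ht (h t (not_le.1 h'))

include hk0

theorem dualConv_W {n : ℕ} (hn : 1 ≤ n) :
    W (convPow k n) f ∈ TestPlus ∧ dualConv (convPow k n) (W (convPow k n) f) = f := by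
  obtain ⟨g, hg, rfl⟩ := mem_testKInf.1 hf n hn
  rw [W_dualConv (hk0.convPow hk n hn) (convPow_locallyIntegrableOn hk n) hg]
  exact ⟨hg, rfl⟩

/-- The support of `W_{k^{*n}} f` is not larger than the support of `f`. -/
theorem W_of_ge {n : ℕ} (hn : 1 ≤ n) {b : ℝ} (hb : 0 ≤ b) (h : ∀ t, b < t → f t = 0) :
    ∀ t, b ≤ t → W (convPow k n) f t = 0 :=
  eq_zero_of_dualConv_eq_zero (hk0.convPow hk n hn) (convPow_locallyIntegrableOn hk n)
    (dualConv_W hk0 hf hn).1 hb (by rwa [(dualConv_W hk0 hf hn).2])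

/-- As `k^{*(n+1)} ∘ g = k^{*n} ∘ (k ∘ g)`, one has `W_{k^{*n}} f = k ∘ W_{k^{*(n+1)}} f`. -/
theorem W_succ {n : ℕ} (hn : 1 ≤ n) :
    W (convPow k n) f = dualConv k (W (convPow k (n + 1)) f) := by
  obtain ⟨h1, h2⟩ := dualConv_W hk0 hf (n := n + 1) (by omega)
  have hn' := convPow_locallyIntegrableOn hk n
  rw [convPow_succ k hn, conv_comm, dualConv_conv hn' hk (by rwa [conv_comm, ← convPow_succ k hn])]
    at h2
  rw [conv_comm, ← convPow_succ k hn] at h2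
  conv_lhs => rw [← h2]
  exact W_dualConv (hk0.convPow hk n hn) hn' (dualConv_mem_testPlus hk.integrableOn_Icc h1)

theorem leftTranslate_mem_testKInf {a : ℝ} (ha : 0 ≤ a) : leftTranslate a f ∈ TestKInf k hk :=
  mem_testKInf.2 fun n hn => ⟨leftTranslate a (W (convPow k n) f),
    leftTranslate_mem_testPlus ha (dualConv_W hk0 hf hn).1, by
      rw [← leftTranslate_dualConv ha, (dualConv_W hk0 hf hn).2]⟩

theorem W_leftTranslate {n : ℕ} (hn : 1 ≤ n) {a : ℝ} (ha : 0 ≤ a) :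
    W (convPow k n) (leftTranslate a f) = leftTranslate a (W (convPow k n) f) := by
  conv_lhs => rw [← (dualConv_W hk0 hf hn).2, leftTranslate_dualConv ha]
  exact W_dualConv (hk0.convPow hk n hn) (convPow_locallyIntegrableOn hk n)
    (leftTranslate_mem_testPlus ha (dualConv_W hk0 hf hn).1)

theorem derivPlus_mem_testKInf : derivPlus f ∈ TestKInf k hk :=
  mem_testKInf.2 fun n hn => ⟨derivPlus (W (convPow k n) f),
    derivPlus_mem_testPlus (dualConv_W hk0 hf hn).1, by
      rw [← derivPlus_dualConv (convPow_locallyIntegrableOn hk n).integrableOn_Icc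
        (dualConv_W hk0 hf hn).1, (dualConv_W hk0 hf hn).2]⟩

theorem W_derivPlus {n : ℕ} (hn : 1 ≤ n) :
    W (convPow k n) (derivPlus f) = derivPlus (W (convPow k n) f) := by
  conv_lhs => rw [← (dualConv_W hk0 hf hn).2, derivPlus_dualConv
    (convPow_locallyIntegrableOn hk n).integrableOn_Icc (dualConv_W hk0 hf hn).1]
  exact W_dualConv (hk0.convPow hk n hn) (convPow_locallyIntegrableOn hk n)
    (derivPlus_mem_testPlus (dualConv_W hk0 hf hn).1)

/-- The function `W_{k^{*n}} (f * g)` in terms of `W_{k^{*n}} f` and `W_{k^{*n}} g`. -/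
theorem exists_W_conv {g : ℝ → ℂ} (hg : g ∈ TestKInf k hk) {n : ℕ} (hn : 1 ≤ n) {a b : ℝ}
    (ha : 0 ≤ a) (hb : 0 ≤ b) (hfa : ∀ t, a < t → f t = 0) (hgb : ∀ t, b < t → g t = 0) :
    ∃ h ∈ TestPlus, dualConv (convPow k n) h = conv f g ∧ h = conv f (W (convPow k n) g)
      - dualConv (fun u => conv (fun v => W (convPow k n) g (b - v)) (convPow k n) (b + u))
        (W (convPow k n) f) := by
  have hkn := convPow_locallyIntegrableOn hk n
  obtain ⟨hWf, hf'⟩ := dualConv_W hk0 hf hn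
  obtain ⟨hWg, hg'⟩ := dualConv_W hk0 hg hn
  have key := conv_dualConv_dualConv hkn hWf hWg ha hb
    (fun t ht => W_of_ge hk0 hf hn ha hfa t ht.le) (fun t ht => W_of_ge hk0 hg hn hb hgb t ht.le)
  rw [hf', hg'] at key
  refine ⟨_, ?_, key.symm, rfl⟩
  refine TestPlus.sub_mem (conv_mem_testPlus (testKInf_mem_testPlus hf) hWg)
    (dualConv_mem_testPlus (fun T => ?_) hWf)
  have := integrableOn_comp_add_left hb (integrableOn_conv
    (testPlus_bddMeasOn hWg b (b + T)).integrableOn (hkn.integrableOn_Icc (b + T)))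
  rwa [add_sub_cancel_left] at this

theorem conv_mem_testKInf {g : ℝ → ℂ} (hg : g ∈ TestKInf k hk) : conv f g ∈ TestKInf k hk := by
  obtain ⟨a, ha0, ha⟩ := testPlus_exists_bound (testKInf_mem_testPlus hf)
  obtain ⟨b, hb0, hb⟩ := testPlus_exists_bound (testKInf_mem_testPlus hg)
  refine mem_testKInf.2 fun n hn => ?_
  obtain ⟨h, h1, h2, _⟩ := exists_W_conv hk0 hf hg hn ha0 hb0 ha hb
  exact ⟨h, h1, h2⟩

end

/-! ### Pairing test functions with a convoluted semigroup -/

section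

variable {E : Type*} [NormedAddCommGroup E] [NormedSpace ℂ E]

theorem vconv_comp_sub_left (g : ℝ → ℂ) (u : ℝ → E) (T : ℝ) :
    vconv (fun v => g (T - v)) u T = ∫ t in (0 : ℝ)..T, g t • u t := by
  simp [vconv]

theorem integral_smul_eq_of_ge {g : ℝ → ℂ} (u : ℝ → E) {b T : ℝ} (hb : 0 ≤ b) (hbT : b ≤ T)
    (hg : ∀ t, b ≤ t → g t = 0) :
    ∫ t in (0 : ℝ)..T, g t • u t = ∫ t in (0 : ℝ)..b, g t • u t := by
  rw [intervalIntegral.integral_of_le hb, intervalIntegral.integral_of_le (hb.trans hbT)]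
  refine setIntegral_eq_of_subset_of_forall_sdiff_eq_zero measurableSet_Ioc
    (Ioc_subset_Ioc_right hbT) fun t ht => ?_
  rw [hg t (not_lt.1 fun h => ht.2 ⟨ht.1.1, h.le⟩), zero_smul]

theorem testPlus_intervalIntegrable_smul {g : ℝ → ℂ} (hg : g ∈ TestPlus) {u : ℝ → E} {T : ℝ}
    (hT : 0 ≤ T) (hu : BddMeasOn T u) :
    IntervalIntegrable (fun t => g t • u t) volume 0 T := by
  have := bddMeasOn_integrable_conv (testPlus_bddMeasOn hg T T).integrableOn hu (right_mem_Icc.2 hT)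
  simpa using this

variable [CompleteSpace E]

/-- The dual convolution is the transpose of the convolution. -/
theorem integral_smul_vconv {k g : ℝ → ℂ} {u : ℝ → E} {T : ℝ} (hT : 0 ≤ T)
    (hk : IntegrableOn k (Icc 0 T)) (hu : BddMeasOn T u) (hg : g ∈ TestPlus)
    (hgT : ∀ t, T < t → g t = 0) :
    ∫ t in (0 : ℝ)..T, g t • vconv k u t = ∫ t in (0 : ℝ)..T, dualConv k g t • u t := by
  have hT' : T ∈ Icc 0 T := right_mem_Icc.2 hT
  rw [← vconv_comp_sub_left g, ← vconv_comp_sub_left (dualConv k g),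
    vconv_vconv (testPlus_bddMeasOn hg T T).integrableOn hk hu hT', conv_comm]
  exact vconv_congr hT (fun s hs => (dualConv_sub_left k hgT hs).symm) fun _ _ => rfl

end

theorem dualConv_zero (k : ℝ → ℂ) {g : ℝ → ℂ} {T : ℝ} (hT : 0 ≤ T) (hgT : ∀ t, T < t → g t = 0) :
    dualConv k g 0 = ∫ t in (0 : ℝ)..T, g t * k t := by
  have := dualConv_sub_left k hgT (right_mem_Icc.2 hT)
  rw [sub_self, conv_comm, conv_eq_vconv, vconv_comp_sub_left] at this
  simpa using this

/-- The dual convolution with `e^{ct}` inverts `g ↦ -(c g + g')`. -/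
theorem dualConv_exp {g : ℝ → ℂ} (hg : g ∈ TestPlus) (c : ℂ) :
    dualConv (fun t => Complex.exp (c * t)) (c • g + derivPlus g) = -g := by
  obtain ⟨b, hb0, hb⟩ := testPlus_exists_bound hg
  have hp : c • g + derivPlus g ∈ TestPlus :=
    TestPlus.add_mem (TestPlus.smul_mem c hg) (derivPlus_mem_testPlus hg)
  have hec : Continuous fun t : ℝ => Complex.exp (c * t) := by fun_prop
  ext t
  rcases lt_or_ge t 0 with ht | ht
  · rw [dualConv_of_neg _ _ t ht, Pi.neg_apply, testPlus_of_neg hg t ht, neg_zero]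
  rw [dualConv, indicator_of_mem (show t ∈ Ici (0 : ℝ) from ht)]
  have hd : ∀ s, HasDerivAt (fun s : ℝ => Complex.exp (c * ((s - t : ℝ) : ℂ)))
      (Complex.exp (c * ((s - t : ℝ) : ℂ)) * c) s := fun s => by
    have h1 : HasDerivAt (fun s : ℝ => c * ((s - t : ℝ) : ℂ)) (c * 1) s := by
      have := ((hasDerivAt_id s).sub_const t).ofReal_comp.const_mul c
      simpa using this
    simpa using h1.cexp
  have := integral_Ioi_of_hasDerivAt_of_tendsto (a := t) (m := 0)
    (f := fun s => Complex.exp (c * ((s - t : ℝ) : ℂ)) * g s)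
    (f' := fun s => Complex.exp (c * ((s - t : ℝ) : ℂ)) * (c • g + derivPlus g) s) ?_ ?_ ?_ ?_
  · rw [this]
    simp
  · refine ContinuousWithinAt.mul (hd t).continuousAt.continuousWithinAt ?_
    exact ((testPlus_continuousOn hg) t ht).mono (Ici_subset_Ici.2 ht)
  · intro s hs
    have := (hd s).mul (hasDerivAt_testPlus hg (ht.trans_lt hs))
    refine this.congr_deriv ?_
    simp only [Pi.add_apply, Pi.smul_apply, smul_eq_mul]
    ring
  · exact integrableOn_dualConv (hec.continuousOn.locallyIntegrableOn measurableSet_Ici) hp ht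
  · refine tendsto_const_nhds.congr' ?_
    filter_upwards [Ioi_mem_atTop b] with s hs
    rw [hb s hs, mul_zero]

theorem dualConv_one_derivPlus {g : ℝ → ℂ} (hg : g ∈ TestPlus) :
    dualConv (fun _ => 1) (derivPlus g) = -g := by
  have := dualConv_exp hg 0
  simpa using this

namespace IsLocalConvolutedSemigroup

variable {X : Type*} [NormedAddCommGroup X] [NormedSpace ℂ X] [CompleteSpace X]
  {k : ℝ → ℂ} {T : ℝ} {U : ℝ → X →L[ℂ] X} {A : X →ₗ.[ℂ] X}

theorem exists_clm_integral (hU : IsLocalConvolutedSemigroup k T U A) (hT : 0 ≤ T) {g : ℝ → ℂ}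
    (hg : g ∈ TestPlus) : ∃ L : X →L[ℂ] X, ∀ x, L x = ∫ t in (0 : ℝ)..T, g t • U t x := by
  obtain ⟨L, hL⟩ := hU.exists_clm_vconv (m := fun s => s) continuousOn_id (mapsTo_id _)
    (testPlus_bddMeasOn hg T T).integrableOn (right_mem_Icc.2 hT)
  exact ⟨L, fun x => (hL x).trans (vconv_comp_sub_left g _ T)⟩

/-- The pairing of a test function with a semigroup takes values in the domain of the generator. -/
theorem integral_smul_mem_graph (hU : IsLocalConvolutedSemigroup k T U A) (hT : 0 ≤ T)
    (hk : LocallyIntegrableOn k (Ici 0)) {g : ℝ → ℂ} (hg : g ∈ TestPlus)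
    (hgT : ∀ t, T < t → g t = 0) (x : X) :
    (∫ t in (0 : ℝ)..T, g t • U t x,
      -(∫ t in (0 : ℝ)..T, derivPlus g t • U t x) - dualConv k g 0 • x) ∈ A.graph := by
  have hg' := derivPlus_mem_testPlus hg
  have hgT' := derivPlus_of_gt hg hT hgT
  have hT' : T ∈ Icc 0 T := right_mem_Icc.2 hT
  have h1 : LocallyIntegrableOn (fun _ : ℝ => (1 : ℂ)) (Ici 0) :=
    locallyIntegrableOn_of_forall_Icc integrableOn_one
  have key := A.graph.neg_mem (hU.vconv_prim_mem_graph hk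
    (testPlus_bddMeasOn hg' T T).integrableOn x hT')
  have e1 : ∫ t in (0 : ℝ)..T, g t • U t x
      = -vconv (fun v => derivPlus g (T - v)) (prim fun s => U s x) T := by
    rw [vconv_comp_sub_left, prim_eq_vconv, integral_smul_vconv hT (integrableOn_one T)
      (hU.bddMeasOn x) hg' hgT', dualConv_one_derivPlus hg]
    simp
  have e2 : dualConv k g 0 = -conv (fun v => derivPlus g (T - v)) (prim k) T := by
    have : g = dualConv (fun _ => 1) ((-1 : ℂ) • derivPlus g) := by
      rw [dualConv_smul, dualConv_one_derivPlus hg]; simp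
    rw [this, ← dualConv_conv hk h1 (TestPlus.smul_mem _ hg'), dualConv_smul, Pi.smul_apply,
      dualConv_zero _ hT hgT', ← this, conv_eq_vconv _ (prim k), vconv_comp_sub_left, conv_comm,
      prim_eq_vconv k]
    simp [conv_eq_vconv]
  rw [e1, e2]
  rw [vconv_comp_sub_left (derivPlus g) (fun s => U s x) T] at key
  convert key using 1
  ext
  · rfl
  · simp only [Prod.snd_neg]
    module

theorem integral_smul_mem_graph_of_mem_graph (hU : IsLocalConvolutedSemigroup k T U A) (hT : 0 ≤ T)
    {g : ℝ → ℂ} (hg : g ∈ TestPlus) {x y : X} (h : (x, y) ∈ A.graph) :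
    (∫ t in (0 : ℝ)..T, g t • U t x, ∫ t in (0 : ℝ)..T, g t • U t y) ∈ A.graph := by
  rw [← vconv_comp_sub_left, ← vconv_comp_sub_left]
  exact vconv_mem_graph hU.isClosed (testPlus_bddMeasOn hg T T).integrableOn (hU.bddMeasOn x)
    (hU.bddMeasOn y) (fun s hs => hU.mem_graph hs h) (right_mem_Icc.2 hT)

/-- The product of two pairings of test functions with a semigroup, in the form which corresponds
to the convolution of the dual convolutions of the test functions. -/
theorem integral_smul_apply_integral_smul {a b : ℝ}
    (hU : IsLocalConvolutedSemigroup k (a + b) U A) (hk0 : ZeroMemSupp k)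
    (hk : LocallyIntegrableOn k (Ici 0)) (ha : 0 ≤ a) (hb : 0 ≤ b) {f g : ℝ → ℂ}
    (hf : f ∈ TestPlus) (hg : g ∈ TestPlus) (hfa : ∀ t, a < t → f t = 0)
    (hgb : ∀ t, b < t → g t = 0) (x : X) :
    ∫ t in (0 : ℝ)..a, f t • U t (∫ s in (0 : ℝ)..b, g s • U s x)
      = ∫ t in (0 : ℝ)..(a + b), (conv (dualConv k f) g
          - dualConv (fun u => conv (fun v => g (b - v)) k (b + u)) f) t • U t x := by
  have hkT := hk.integrableOn_Icc
  have hab : 0 ≤ a + b := by linarith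
  have haT : a ≤ a + b := by linarith
  set φ := dualConv k f with hφ
  set h : ℝ → ℂ := fun v => g (b - v) with hh
  set F : ℝ → ℂ := fun u => conv h k (b + u) with hF
  set P : ℝ → ℂ := fun s => φ (a - s) with hP
  have hφP : φ ∈ TestPlus := dualConv_mem_testPlus hkT hf
  have hφa := dualConv_of_ge k hfa
  have hhT : ∀ T, IntegrableOn h (Icc 0 T) := fun T => (testPlus_bddMeasOn hg b T).integrableOn
  have hFT : ∀ T, IntegrableOn F (Icc 0 T) := fun T => by
    have := integrableOn_comp_add_left hb (integrableOn_conv (hhT (b + T)) (hkT (b + T)))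
    rwa [add_sub_cancel_left] at this
  have hFf : dualConv F f ∈ TestPlus := dualConv_mem_testPlus hFT hf
  have hFfa := dualConv_of_ge F hfa
  have hUx := hU.bddMeasOn x
  have hUa : BddMeasOn a fun s => U s x := hUx.mono haT
  set q := vconv h fun s => U s x with hq
  have hqc : ContinuousOn q (Icc 0 (a + b)) := continuousOn_vconv (hhT _) (hU.strongly_continuous x)
  have hqb : BddMeasOn a fun r => q (b + r) :=
    (hqc.comp (continuous_const.add continuous_id).continuousOn fun r hr =>
      ⟨show (0 : ℝ) ≤ b + r by linarith [hr.1],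
        show b + r ≤ a + b by linarith [hr.2]⟩).bddMeasOn
  have hPT : ∀ T, IntegrableOn P (Icc 0 T) := fun T => (testPlus_bddMeasOn hφP a T).integrableOn
  have e1 : ∫ t in (0 : ℝ)..a, f t • U t (∫ s in (0 : ℝ)..b, g s • U s x)
      = (∫ t in (0 : ℝ)..a, f t • vconv k (fun r => q (b + r)) t)
        - ∫ t in (0 : ℝ)..a, f t • vconv F (fun s => U s x) t := by
    rw [← intervalIntegral.integral_sub
      (testPlus_intervalIntegrable_smul hf ha (hqb.vconv (hkT a)))
      (testPlus_intervalIntegrable_smul hf ha (hUa.vconv (hFT a)))]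
    refine intervalIntegral.integral_congr fun t ht => ?_
    rw [uIcc_of_le ha] at ht
    rw [← smul_sub, ← vconv_comp_sub_left, hU.apply_vconv hk0 hk hb le_rfl hhT x ht]
  have e2 : ∫ t in (0 : ℝ)..(a + b), conv φ g t • U t x = ∫ t in (0 : ℝ)..a, φ t • q (b + t) := by
    rw [← vconv_comp_sub_left, ← vconv_comp_sub_left φ]
    have e3 : vconv (fun v => conv φ g (a + b - v)) (fun t => U t x) (a + b)
        = vconv P q (b + a) := by
      rw [hq, vconv_vconv (T := a + b) (hPT _) (hhT _) hUx (by constructor <;> linarith),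
        add_comm b a]
      refine vconv_congr hab (fun v _ => ?_) fun _ _ => rfl
      exact conv_sub_left (testPlus_of_neg hφP) (testPlus_of_neg hg) (fun t ht => hφa t ht.le) hgb v
    rw [e3, vconv_add_arg hb ha (hPT _) (by rw [add_comm]; exact hqc.bddMeasOn), add_eq_right]
    -- the first integral vanishes since `P` is supported in `[0, a]`
    refine intervalIntegral.integral_zero_ae ?_
    filter_upwards [Measure.ae_ne volume b] with s hsb hs
    rw [uIoc_of_le hb] at hs
    simp only [hP]
    rw [testPlus_of_neg hφP _ (by linarith [lt_of_le_of_ne hs.2 hsb]), zero_smul]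
  rw [e1, integral_smul_vconv ha (hkT a) hqb hf hfa, integral_smul_vconv ha (hFT a) hUa hf hfa, ← e2,
    ← integral_smul_eq_of_ge _ ha haT hFfa, ← intervalIntegral.integral_sub
      (testPlus_intervalIntegrable_smul (conv_mem_testPlus hφP hg) hab hUx)
      (testPlus_intervalIntegrable_smul hFf hab hUx)]
  simp only [Pi.sub_apply, sub_smul]

end IsLocalConvolutedSemigroup

/-! ### The induced map -/

section

variable {k f g : ℝ → ℂ} {hk : LocallyIntegrableOn k (Ici 0)}

theorem W_add (hk0 : ZeroMemSupp k) (hf : f ∈ TestKInf k hk) (hg : g ∈ TestKInf k hk) {n : ℕ}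
    (hn : 1 ≤ n) : W (convPow k n) (f + g) = W (convPow k n) f + W (convPow k n) g := by
  have hkn := convPow_locallyIntegrableOn hk n
  obtain ⟨h1, h2⟩ := dualConv_W hk0 hf hn
  obtain ⟨h3, h4⟩ := dualConv_W hk0 hg hn
  conv_lhs => rw [← h2, ← h4, ← dualConv_add hkn h1 h3]
  exact W_dualConv (hk0.convPow hk n hn) hkn (TestPlus.add_mem h1 h3)

theorem W_smul (hk0 : ZeroMemSupp k) (hf : f ∈ TestKInf k hk) {n : ℕ} (hn : 1 ≤ n) (c : ℂ) :
    W (convPow k n) (c • f) = c • W (convPow k n) f := by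
  obtain ⟨h1, h2⟩ := dualConv_W hk0 hf hn
  conv_lhs => rw [← h2, ← dualConv_smul]
  exact W_dualConv (hk0.convPow hk n hn) (convPow_locallyIntegrableOn hk n)
    (TestPlus.smul_mem c h1)

theorem exists_forall_gt_eq_zero {τ : ℝ} (hτ : 0 < τ) (hf : f ∈ TestPlus) (hg : g ∈ TestPlus) :
    ∃ n : ℕ, 1 ≤ n ∧ (∀ t, n * τ < t → f t = 0) ∧ ∀ t, n * τ < t → g t = 0 := by
  obtain ⟨a, _, ha⟩ := testPlus_exists_bound hf
  obtain ⟨b, _, hb⟩ := testPlus_exists_bound hg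
  obtain ⟨n, hn⟩ := exists_nat_ge (max a b / τ)
  rw [div_le_iff₀ hτ] at hn
  have hle : (n : ℝ) * τ ≤ (n + 1 : ℕ) * τ := by
    have : (n : ℝ) ≤ (n + 1 : ℕ) := by exact_mod_cast n.le_succ
    exact mul_le_mul_of_nonneg_right this hτ.le
  exact ⟨n + 1, by omega,
    fun t ht => ha t (((le_max_left _ _).trans (hn.trans hle)).trans_lt ht),
    fun t ht => hb t (((le_max_right _ _).trans (hn.trans hle)).trans_lt ht)⟩

end

section

variable {X : Type*} [NormedAddCommGroup X] [NormedSpace ℂ X] [CompleteSpace X]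
  {k : ℝ → ℂ} {hk : LocallyIntegrableOn k (Ici 0)} {τ : ℝ} {S : ℝ → X →L[ℂ] X} {A : X →ₗ.[ℂ] X}

theorem extend_succ_of_le (k : ℝ → ℂ) (S : ℝ → X →L[ℂ] X) {n : ℕ} (hn : 1 ≤ n) {t : ℝ}
    (ht : t ≤ n * τ) (x : X) :
    extend k τ S (n + 1) t x = vconv k (fun s => extend k τ S n s x) t := by
  obtain ⟨m, rfl⟩ : ∃ m, n = m + 1 := ⟨n - 1, by omega⟩
  push_cast at ht
  rw [extend]
  exact if_pos ht

/-- The integrals defining `𝒢ₖ(f) x` for `n` and `n + 1` agree, by transposition of one convolution with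
`k`. -/
theorem integral_smul_extend_succ (hk0 : ZeroMemSupp k)
    (hS : IsLocalConvolutedSemigroup k τ S A) (hτ : 0 ≤ τ) {f : ℝ → ℂ} (hf : f ∈ TestKInf k hk)
    {n : ℕ} (hn : 1 ≤ n) (hfn : ∀ t, n * τ < t → f t = 0) (x : X) :
    ∫ t in (0 : ℝ)..((n + 1 : ℕ) * τ), W (convPow k (n + 1)) f t • extend k τ S (n + 1) t x
      = ∫ t in (0 : ℝ)..(n * τ), W (convPow k n) f t • extend k τ S n t x := by
  obtain ⟨U, hU, hUe⟩ := exists_convPow_semigroup hS hk hτ n hn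
  have hnτ : 0 ≤ n * τ := by positivity
  have hW := W_of_ge hk0 hf (n := n + 1) (by omega) hnτ hfn
  have hu : BddMeasOn (n * τ) fun s => extend k τ S n s x :=
    ((hU.strongly_continuous x).congr fun t ht => (hUe t ht x).symm).bddMeasOn
  rw [integral_smul_eq_of_ge _ hnτ (by push_cast; linarith) hW, W_succ hk0 hf hn,
    ← integral_smul_vconv hnτ (hk.integrableOn_Icc _) hu (dualConv_W hk0 hf (by omega)).1
      fun t ht => hW t ht.le]
  refine intervalIntegral.integral_congr fun t ht => ?_
  rw [uIcc_of_le hnτ] at ht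
  simp only [extend_succ_of_le k S hn ht.2 x]

theorem integral_smul_extend_of_le (hk0 : ZeroMemSupp k)
    (hS : IsLocalConvolutedSemigroup k τ S A) (hτ : 0 ≤ τ) {f : ℝ → ℂ} (hf : f ∈ TestKInf k hk)
    {m n : ℕ} (hm : 1 ≤ m) (hmn : m ≤ n) (hfm : ∀ t, m * τ < t → f t = 0) (x : X) :
    ∫ t in (0 : ℝ)..(n * τ), W (convPow k n) f t • extend k τ S n t x
      = ∫ t in (0 : ℝ)..(m * τ), W (convPow k m) f t • extend k τ S m t x := by
  induction n, hmn using Nat.le_induction with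
  | base => rfl
  | succ n hmn ih =>
    rw [← ih]
    have h : (m : ℝ) * τ ≤ n * τ := mul_le_mul_of_nonneg_right (by exact_mod_cast hmn) hτ
    exact integral_smul_extend_succ hk0 hS hτ hf (hm.trans hmn)
      (fun t ht => hfm t (h.trans_lt ht)) x

theorem existsUnique_isInducedMap (hk0 : ZeroMemSupp k) (hS : IsLocalConvolutedSemigroup k τ S A)
    (hτ : 0 < τ) : ∃! G : TestKInf k hk → X →L[ℂ] X, IsInducedMap k hk τ S G := by
  have hN : ∀ f : TestKInf k hk, ∃ n : ℕ, 1 ≤ n ∧ ∀ t, n * τ < t → (f : ℝ → ℂ) t = 0 := fun f => by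
    have hf := testKInf_mem_testPlus f.2
    obtain ⟨n, h1, h2, -⟩ := exists_forall_gt_eq_zero hτ hf hf
    exact ⟨n, h1, h2⟩
  choose N hN1 hN2 using hN
  have hL : ∀ f : TestKInf k hk, ∃ L : X →L[ℂ] X, ∀ x, L x
      = ∫ t in (0 : ℝ)..(N f * τ), W (convPow k (N f)) f t • extend k τ S (N f) t x := fun f => by
    obtain ⟨U, hU, hUe⟩ := exists_convPow_semigroup hS hk hτ.le (N f) (hN1 f)
    have h0 : 0 ≤ N f * τ := by positivity
    obtain ⟨L, hL⟩ := hU.exists_clm_integral h0 (dualConv_W hk0 f.2 (hN1 f)).1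
    refine ⟨L, fun x => (hL x).trans (intervalIntegral.integral_congr fun t ht => ?_)⟩
    rw [uIcc_of_le h0] at ht
    simp only [hUe t ht x]
  choose G hG using hL
  refine ⟨G, fun f n hn hf x => ?_, fun G' hG' => ?_⟩
  · rw [tsupport_subset_Icc_iff f.2] at hf
    rw [hG]
    rcases le_total n (N f) with h | h
    · exact integral_smul_extend_of_le hk0 hS hτ.le f.2 hn h hf x
    · exact (integral_smul_extend_of_le hk0 hS hτ.le f.2 (hN1 f) h (hN2 f) x).symm
  · ext f x
    rw [hG f x, hG' f (N f) (hN1 f) ((tsupport_subset_Icc_iff f.2).2 (hN2 f)) x]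

namespace IsInducedMap

variable {G : TestKInf k hk → X →L[ℂ] X}

/-- The families `S_{k^{*n}}` in the defining formula of `𝒢ₖ` may be taken to be families of bounded
operators. -/
theorem exists_semigroup (hG : IsInducedMap k hk τ S G) (hS : IsLocalConvolutedSemigroup k τ S A)
    (hτ : 0 ≤ τ) {n : ℕ} (hn : 1 ≤ n) :
    ∃ U : ℝ → X →L[ℂ] X, IsLocalConvolutedSemigroup (convPow k n) (n * τ) U A ∧
      ∀ f : TestKInf k hk, (∀ t, n * τ < t → (f : ℝ → ℂ) t = 0) → ∀ x,
        G f x = ∫ t in (0 : ℝ)..(n * τ), W (convPow k n) f t • U t x := by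
  obtain ⟨U, hU, hUe⟩ := exists_convPow_semigroup hS hk hτ n hn
  refine ⟨U, hU, fun f hf x => ?_⟩
  rw [hG f n hn ((tsupport_subset_Icc_iff f.2).2 hf) x]
  refine intervalIntegral.integral_congr fun t ht => ?_
  rw [uIcc_of_le (by positivity)] at ht
  simp only [hUe t ht x]

theorem apply_of_gt (hG : IsInducedMap k hk τ S G) {f : TestKInf k hk}
    (hf : ∀ t, τ < t → (f : ℝ → ℂ) t = 0) (x : X) :
    G f x = ∫ t in (0 : ℝ)..τ, W k f t • S t x := by
  have := hG f 1 le_rfl ((tsupport_subset_Icc_iff f.2).2 (by simpa using hf)) x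
  rwa [Nat.cast_one, one_mul] at this

theorem isLinearMap (hG : IsInducedMap k hk τ S G) (hk0 : ZeroMemSupp k)
    (hS : IsLocalConvolutedSemigroup k τ S A) (hτ : 0 < τ) : IsLinearMap ℂ G := by
  refine ⟨fun f g => ?_, fun c f => ?_⟩
  · obtain ⟨n, hn, hf, hg⟩ := exists_forall_gt_eq_zero hτ (testKInf_mem_testPlus f.2)
      (testKInf_mem_testPlus g.2)
    obtain ⟨U, hU, hGU⟩ := hG.exists_semigroup hS hτ.le hn
    have h0 : 0 ≤ n * τ := by positivity
    ext x
    rw [add_apply, hGU f hf, hGU g hg, hGU (f + g) fun t ht => by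
        simp [hf t ht, hg t ht],
      ← intervalIntegral.integral_add
        (testPlus_intervalIntegrable_smul (dualConv_W hk0 f.2 hn).1 h0 (hU.bddMeasOn x))
        (testPlus_intervalIntegrable_smul (dualConv_W hk0 g.2 hn).1 h0 (hU.bddMeasOn x)),
      Submodule.coe_add, W_add hk0 f.2 g.2 hn]
    simp only [Pi.add_apply, add_smul]
  · obtain ⟨n, hn, hf, -⟩ := exists_forall_gt_eq_zero hτ (testKInf_mem_testPlus f.2)
      (testKInf_mem_testPlus f.2)
    obtain ⟨U, hU, hGU⟩ := hG.exists_semigroup hS hτ.le hn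
    ext x
    rw [smul_apply, hGU f hf, hGU (c • f) fun t ht => by simp [hf t ht],
      Submodule.coe_smul, W_smul hk0 f.2 hn, ← intervalIntegral.integral_smul]
    simp only [Pi.smul_apply, smul_assoc]

/-- Continuity of `𝒢ₖ` on the functions supported in `[0, b]`: uniform convergence of `W_{k^{*n}} f` for one
`n` with `b ≤ n τ` is enough. -/
theorem continuous_comp_val (hG : IsInducedMap k hk τ S G) (hk0 : ZeroMemSupp k)
    (hS : IsLocalConvolutedSemigroup k τ S A) (hτ : 0 < τ) (b : ℝ) :
    Continuous[topOn k hk b, inferInstance] fun f : TestKInfOn k hk b => G f.1 := by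
  let := topOn k hk b
  obtain ⟨n, hn⟩ := exists_nat_ge (b / τ)
  rw [div_le_iff₀ hτ] at hn
  have hbn : b ≤ (n + 1 : ℕ) * τ := by push_cast; linarith
  obtain ⟨U, hU, hGU⟩ := hG.exists_semigroup hS hτ.le (n := n + 1) (by omega)
  obtain ⟨C, hC0, hC⟩ := hU.exists_bound
  set T : ℝ := (n + 1 : ℕ) * τ with hT
  have hT0 : 0 < T := by positivity
  have hsupp : ∀ f : TestKInfOn k hk b, ∀ t, T < t → (f.1 : ℝ → ℂ) t = 0 := fun f t ht =>
    (tsupport_subset_Icc_iff f.1.2).1 f.2 t (hbn.trans_lt ht)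
  have hcoord : Continuous fun f : TestKInfOn k hk b =>
      (UniformFun.ofFun fun t : Ici (0 : ℝ) =>
        W (convPow k (n + 1)) (f.1 : ℝ → ℂ) t : UniformFun (Ici (0 : ℝ)) ℂ) := by
    have := (continuous_apply ((n, 0) : ℕ × ℕ)).comp (continuous_induced_dom (f :=
      (fun (f : TestKInfOn k hk b) (p : ℕ × ℕ) => (UniformFun.ofFun fun t : Ici (0 : ℝ) =>
      iteratedDerivWithin p.2 (W (convPow k (p.1 + 1)) (f.1 : ℝ → ℂ)) (Ici 0) t :
        UniformFun (Ici (0 : ℝ)) ℂ))))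
    simpa [Function.comp_def] using this
  rw [continuous_iff_continuousAt]
  intro f
  have hf := UniformFun.tendsto_iff_tendstoUniformly.1 (hcoord.tendsto f)
  rw [Metric.tendstoUniformly_iff] at hf
  rw [ContinuousAt, Metric.tendsto_nhds]
  intro ε hε
  have hδ : 0 < ε / 2 / (T * (C + 1)) := by positivity
  filter_upwards [hf _ hδ] with f' hf'
  have hle : ‖G f'.1 - G f.1‖ ≤ ε / 2 := by
    refine ContinuousLinearMap.opNorm_le_bound _ (by positivity) fun x => ?_
    rw [sub_apply, hGU _ (hsupp f'), hGU _ (hsupp f),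
      ← intervalIntegral.integral_sub
        (testPlus_intervalIntegrable_smul (dualConv_W hk0 f'.1.2 (by omega)).1 hT0.le
          (hU.bddMeasOn x))
        (testPlus_intervalIntegrable_smul (dualConv_W hk0 f.1.2 (by omega)).1 hT0.le
          (hU.bddMeasOn x))]
    refine (intervalIntegral.norm_integral_le_of_norm_le_const
      (C := ε / 2 / (T * (C + 1)) * (C + 1) * ‖x‖) fun t ht => ?_).trans (le_of_eq ?_)
    · rw [uIoc_of_le hT0.le] at ht
      rw [← sub_smul, norm_smul, mul_assoc]
      have h1 := hf' ⟨t, ht.1.le⟩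
      simp only [UniformFun.toFun_ofFun, Function.comp_apply, dist_eq_norm] at h1
      rw [norm_sub_rev] at h1
      refine mul_le_mul h1.le ?_ (norm_nonneg _) hδ.le
      refine ((U t).le_opNorm x).trans ?_
      gcongr
      linarith [hC t ⟨ht.1.le, ht.2⟩]
    · rw [sub_zero, abs_of_pos hT0]
      field_simp
  rw [dist_eq_norm]
  linarith

theorem continuous (hG : IsInducedMap k hk τ S G) (hk0 : ZeroMemSupp k)
    (hS : IsLocalConvolutedSemigroup k τ S A) (hτ : 0 < τ) :
    Continuous[testTop k hk, inferInstance] G := by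
  set L : TestKInf k hk →ₗ[ℂ] X →L[ℂ] X := (hG.isLinearMap hk0 hS hτ).mk' G with hL
  have hLG : (L : TestKInf k hk → X →L[ℂ] X) = G := rfl
  -- the topology induced by `G` takes part in the infimum defining the inductive limit topology
  refine continuous_sInf_dom (t₁ := _) (t := TopologicalSpace.induced G inferInstance) ?_
    continuous_induced_dom
  refine ⟨?_, ?_, ?_, fun b => ?_⟩
  · exact topologicalAddGroup_induced L
  · exact continuousSMul_induced L
  · exact LocallyConvexSpace.induced (L.restrictScalars ℝ)
  · rw [continuous_induced_rng]
    exact hG.continuous_comp_val hk0 hS hτ b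

theorem apply_conv (hG : IsInducedMap k hk τ S G) (hk0 : ZeroMemSupp k)
    (hS : IsLocalConvolutedSemigroup k τ S A) (hτ : 0 < τ) (φ ψ : TestKInf k hk) :
    G ⟨conv φ ψ, conv_mem_testKInf hk0 φ.2 ψ.2⟩ = G φ ∘L G ψ := by
  obtain ⟨m, hm, hφ, hψ⟩ := exists_forall_gt_eq_zero hτ (testKInf_mem_testPlus φ.2)
    (testKInf_mem_testPlus ψ.2)
  have hn : 1 ≤ m + m := by omega
  obtain ⟨U, hU, hGU⟩ := hG.exists_semigroup hS hτ.le hn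
  have ha : 0 ≤ m * τ := by positivity
  have hT : ((m + m : ℕ) : ℝ) * τ = m * τ + m * τ := by push_cast; ring
  rw [hT] at hU hGU
  set a : ℝ := m * τ
  have haT : a ≤ a + a := by linarith
  have hkn := convPow_locallyIntegrableOn hk (m + m)
  have hkn0 := hk0.convPow hk (m + m) hn
  obtain ⟨h, hh, h1, h2⟩ := exists_W_conv hk0 φ.2 ψ.2 hn ha ha hφ hψ
  obtain ⟨hWφ, hφ'⟩ := dualConv_W hk0 φ.2 hn
  obtain ⟨hWψ, hψ'⟩ := dualConv_W hk0 ψ.2 hn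
  have hWφa := W_of_ge hk0 φ.2 hn ha hφ
  have hWψa := W_of_ge hk0 ψ.2 hn ha hψ
  have hW : W (convPow k (m + m)) (conv φ ψ) = h := by
    rw [← h1]; exact W_dualConv hkn0 hkn hh
  ext x
  rw [ContinuousLinearMap.comp_apply, hGU φ (fun t ht => hφ t (haT.trans_lt ht)),
    hGU ψ (fun t ht => hψ t (haT.trans_lt ht)), hGU ⟨conv φ ψ, _⟩ (conv_of_gt
      (testPlus_of_neg (testKInf_mem_testPlus φ.2)) (testPlus_of_neg (testKInf_mem_testPlus ψ.2))
      hφ hψ), hW, h2, integral_smul_eq_of_ge _ ha haT hWφa, integral_smul_eq_of_ge _ ha haT hWψa,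
    hU.integral_smul_apply_integral_smul hkn0 hkn ha ha hWφ hWψ (fun t ht => hWφa t ht.le)
      (fun t ht => hWψa t ht.le), hφ']

end IsInducedMap

end

/-! ### Density of translates -/

theorem testPlus_measurable {g : ℝ → ℂ} (hg : g ∈ TestPlus) : Measurable g := by
  obtain ⟨φ, h, _, rfl⟩ := hg
  exact h.continuous.measurable.indicator measurableSet_Ici

theorem derivPlus_add {f g : ℝ → ℂ} (hf : f ∈ TestPlus) (hg : g ∈ TestPlus) :
    derivPlus (f + g) = derivPlus f + derivPlus g := by
  obtain ⟨φ, h1, _, rfl⟩ := hf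
  obtain ⟨ψ, h2, _, rfl⟩ := hg
  have hφ := h1.differentiable (by simp)
  have hψ := h2.differentiable (by simp)
  rw [← indicator_add', derivPlus_indicator hφ, derivPlus_indicator hψ,
    derivPlus_indicator (hφ.add hψ), ← indicator_add']
  exact indicator_congr fun t _ => deriv_add (hφ t) (hψ t)

theorem derivPlus_smul {g : ℝ → ℂ} (hg : g ∈ TestPlus) (c : ℂ) :
    derivPlus (c • g) = c • derivPlus g := by
  obtain ⟨φ, h1, _, rfl⟩ := hg
  have hφ := h1.differentiable (by simp)
  have e : ∀ χ : ℝ → ℂ, c • (Ici (0 : ℝ)).indicator χ = (Ici (0 : ℝ)).indicator (c • χ) :=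
    fun χ => (indicator_const_smul (Ici (0 : ℝ)) c χ).symm
  rw [e, derivPlus_indicator hφ, e, derivPlus_indicator (hφ.const_smul c)]
  exact indicator_congr fun t _ => deriv_const_smul_field c φ

theorem integral_leftTranslate_smul {E : Type*} [NormedAddCommGroup E] [NormedSpace ℂ E]
    {g : ℝ → ℂ} (u : ℝ → E) {a b T : ℝ} (ha : a ∈ Icc 0 b) (hbT : b ≤ T)
    (hg : ∀ t, b ≤ t → g t = 0) :
    ∫ t in (0 : ℝ)..T, leftTranslate a g t • u t = vconv (fun v => g (b - v)) u (b - a) := by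
  have h0 : 0 ≤ b - a := sub_nonneg.2 ha.2
  rw [integral_smul_eq_of_ge u h0 (by linarith [ha.1]) fun t ht => by
    rw [leftTranslate, indicator]
    split_ifs
    · exact hg _ (by linarith)
    · rfl]
  refine intervalIntegral.integral_congr fun t ht => ?_
  rw [uIcc_of_le h0] at ht
  simp only [leftTranslate]
  rw [indicator_of_mem (show t ∈ Ici (0 : ℝ) from ht.1)]
  ring_nf

/-- A nonzero test function has a last point `c` of its support; reversing the time moves it to the
origin. -/
theorem exists_zeroMemSupp_reverse {g : ℝ → ℂ} (hg : g ∈ TestPlus) (hg0 : g ≠ 0) :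
    ∃ c, 0 < c ∧ (∀ t, c ≤ t → g t = 0) ∧ ZeroMemSupp fun v => g (c - v) := by
  set B : Set ℝ := {b | 0 ≤ b ∧ ∀ t, b < t → g t = 0}
  have hBne : B.Nonempty := testPlus_exists_bound hg
  have hBb : BddBelow B := ⟨0, fun b hb => hb.1⟩
  set c := sInf B
  have hc0 : 0 ≤ c := le_csInf hBne fun b hb => hb.1
  have hcgt : ∀ t, c < t → g t = 0 := fun t ht => by
    obtain ⟨b, hb, hbt⟩ := exists_lt_of_csInf_lt hBne ht
    exact hb.2 t hbt
  have hgc : g c = 0 := by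
    have h1 : Tendsto g (𝓝[>] c) (𝓝 (g c)) :=
      ((testPlus_continuousOn hg) c hc0).mono (fun t ht => hc0.trans (le_of_lt ht))
    refine tendsto_nhds_unique h1 (tendsto_const_nhds.congr' ?_)
    filter_upwards [self_mem_nhdsWithin] with t ht using (hcgt t ht).symm
  have hcge : ∀ t, c ≤ t → g t = 0 := fun t ht => by
    rcases ht.eq_or_lt with rfl | h
    · exact hgc
    · exact hcgt t h
  have hcpos : 0 < c := by
    refine lt_of_le_of_ne hc0 fun h => hg0 ?_
    ext t
    rcases lt_or_ge t 0 with ht | ht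
    · exact testPlus_of_neg hg t ht
    · exact hcge t (h ▸ ht)
  refine ⟨c, hcpos, hcge, fun ε hε h => ?_⟩
  have hδ : 0 < min ε c := lt_min hε hcpos
  have h1 : (fun v => g (c - v)) =ᵐ[volume.restrict (Ioo 0 (min ε c))] fun _ => 0 :=
    ae_mono (Measure.restrict_mono (Ioo_subset_Ioo_right (min_le_left _ _)) le_rfl) h
  have h2 := Measure.eqOn_open_of_ae_eq h1 isOpen_Ioo
    ((continuousOn_comp_sub_left hg le_rfl).mono fun v hv =>
      ⟨hv.1.le, hv.2.le.trans (min_le_right _ _)⟩) continuousOn_const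
  have h3 : c - min ε c ∈ B := by
    refine ⟨sub_nonneg.2 (min_le_right _ _), fun t ht => ?_⟩
    rcases lt_or_ge t c with h' | h'
    · have := h2 (x := c - t) ⟨by linarith, by linarith⟩
      simpa using this
    · exact hcge t h'
  linarith [csInf_le hBb h3]

/-- If the support of `p₀` ends at `b`, then the translates of `p₀` span a dense subspace of
`L²(0, b)`, by Titchmarsh's theorem; in particular the constant function can be approximated. -/
theorem exists_integral_norm_sub_one_lt {b : ℝ} (hb : 0 < b) {p₀ : ℝ → ℂ} (hp : p₀ ∈ TestPlus)
    (hpb : ∀ t, b ≤ t → p₀ t = 0) (hp0 : ZeroMemSupp fun v => p₀ (b - v))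
    {V : Submodule ℂ (ℝ → ℂ)} (hV : V ≤ TestPlus) (hpV : ∀ a ∈ Icc 0 b, leftTranslate a p₀ ∈ V)
    {δ : ℝ} (hδ : 0 < δ) : ∃ p ∈ V, ∫ t in (0 : ℝ)..b, ‖p t - 1‖ < δ := by
  set μ : Measure ℝ := volume.restrict (Ioc 0 b) with hμ
  have hmem : ∀ q ∈ TestPlus, MemLp q 2 μ := fun q hq => by
    obtain ⟨C, hC⟩ := testPlus_exists_norm_le hq
    exact MemLp.of_bound (testPlus_measurable hq).aestronglyMeasurable C (Eventually.of_forall hC)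
  let V' : Submodule ℂ (Lp ℂ 2 μ) :=
    { carrier := {F | ∃ p ∈ V, F =ᵐ[μ] p}
      zero_mem' := ⟨0, V.zero_mem, Lp.coeFn_zero _ _ _⟩
      add_mem' := by
        rintro F F' ⟨p, hp, h⟩ ⟨p', hp', h'⟩
        exact ⟨p + p', V.add_mem hp hp', (Lp.coeFn_add F F').trans (h.add h')⟩
      smul_mem' := by
        rintro c F ⟨p, hp, h⟩
        exact ⟨c • p, V.smul_mem c hp, (Lp.coeFn_smul c F).trans (h.const_smul c)⟩ }
  have hperp : V'ᗮ = ⊥ := by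
    rw [Submodule.eq_bot_iff]
    intro u hu
    rw [Submodule.mem_orthogonal] at hu
    set w : ℝ → ℂ := fun t => (starRingEnd ℂ) (u t) with hw
    have hui : Integrable u μ := (Lp.memLp u).integrable (by norm_num)
    have hwi : Integrable w μ := by
      have := Complex.conjCLE.toContinuousLinearMap.integrable_comp hui
      exact this
    have hconv : ∀ a ∈ Icc 0 b, conv (fun v => p₀ (b - v)) w (b - a) = 0 := by
      intro a ha
      have hq := hmem _ (hV (hpV a ha))
      have h0 := hu (hq.toLp _) ⟨_, hpV a ha, hq.coeFn_toLp⟩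
      rw [L2.inner_def] at h0
      have h1 : ∫ t, (starRingEnd ℂ) (leftTranslate a p₀ t • w t) ∂μ = 0 := by
        rw [← h0]
        refine integral_congr_ae ?_
        filter_upwards [hq.coeFn_toLp] with t ht
        rw [ht]
        simp [hw, mul_comm]
      rw [integral_conj] at h1
      have h2 := (map_eq_zero (starRingEnd ℂ)).1 h1
      rw [← intervalIntegral.integral_of_le hb.le,
        integral_leftTranslate_smul w ha le_rfl hpb] at h2
      exact h2
    have hwI : IntegrableOn w (Icc 0 b) := (integrableOn_Icc_iff_integrableOn_Ioc (by simp)).2 hwi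
    have hz := ae_eq_zero_of_conv_eq_zero hp0 (testPlus_bddMeasOn hp b b).integrableOn hwI
      ((ae_restrict_iff' measurableSet_Ioo).2 (Eventually.of_forall fun t ht => by
        have := hconv (b - t) ⟨by linarith [ht.2], by linarith [ht.1]⟩
        rwa [sub_sub_cancel] at this))
    rw [restrict_Ioo_eq_restrict_Ioc] at hz
    refine Lp.ext ?_
    filter_upwards [hz, Lp.coeFn_zero ℂ 2 μ] with t h1 h2
    rw [h2]
    exact (map_eq_zero (starRingEnd ℂ)).1 h1
  have hone : MemLp (fun _ : ℝ => (1 : ℂ)) 2 μ := memLp_const 1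
  have hcl : hone.toLp _ ∈ closure (V' : Set (Lp ℂ 2 μ)) := by
    have := (Submodule.topologicalClosure_eq_top_iff (K := V')).2 hperp
    rw [← Submodule.topologicalClosure_coe, this]
    trivial
  set c : ENNReal := μ univ ^ (1 / (1 : ENNReal).toReal - 1 / (2 : ENNReal).toReal) + 1 with hc
  have hctop : c ≠ ⊤ := by
    refine ENNReal.add_ne_top.2 ⟨ENNReal.rpow_ne_top_of_nonneg (by norm_num) (measure_ne_top μ _),
      ENNReal.one_ne_top⟩
  obtain ⟨F, ⟨p, hpV', hFp⟩, hF⟩ := EMetric.mem_closure_iff.1 hcl (ENNReal.ofReal δ / c)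
    (ENNReal.div_pos (by simpa using hδ) hctop)
  refine ⟨p, hpV', ?_⟩
  have hpm : AEStronglyMeasurable (fun t => p t - 1) μ :=
    ((testPlus_measurable (hV hpV')).sub_const 1).aestronglyMeasurable
  rw [edist_comm, Lp.edist_def] at hF
  have e : eLpNorm (⇑F - ⇑(hone.toLp _)) 2 μ = eLpNorm (fun t => p t - 1) 2 μ := by
    refine eLpNorm_congr_ae ?_
    filter_upwards [hFp, hone.coeFn_toLp] with t h1 h2
    rw [Pi.sub_apply, h1, h2]
  rw [e] at hF
  have h1 : eLpNorm (fun t => p t - 1) 1 μ < ENNReal.ofReal δ :=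
    calc eLpNorm (fun t => p t - 1) 1 μ
        ≤ eLpNorm (fun t => p t - 1) 2 μ * μ univ ^
          (1 / (1 : ENNReal).toReal - 1 / (2 : ENNReal).toReal) :=
          eLpNorm_le_eLpNorm_mul_rpow_measure_univ (by norm_num) hpm
      _ ≤ eLpNorm (fun t => p t - 1) 2 μ * c := by gcongr; exact le_self_add
      _ < ENNReal.ofReal δ := ENNReal.mul_lt_of_lt_div hF
  rw [eLpNorm_one_eq_lintegral_enorm] at h1
  rw [intervalIntegral.integral_of_le hb.le, integral_norm_eq_lintegral_enorm hpm]
  exact ENNReal.toReal_lt_of_lt_ofReal h1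

/-! ### A test function with dominant value at the origin -/

section

variable {k : ℝ → ℂ} {hk : LocallyIntegrableOn k (Ici 0)}

theorem not_ae_prim_eq_zero (hk0 : ZeroMemSupp k) (hk : LocallyIntegrableOn k (Ici 0)) {b : ℝ}
    (hb : 0 < b) : ¬ ∀ᵐ t ∂(volume.restrict (Ioo 0 b)), prim k t = 0 := fun h => by
  rw [prim_eq_vconv, ← conv_eq_vconv] at h
  exact hk0 b hb (ae_eq_zero_of_conv_eq_zero zeroMemSupp_one (integrableOn_one b)
    (hk.integrableOn_Icc b) h)

theorem eq_zero_of_W_eq_zero (hk0 : ZeroMemSupp k) {f : ℝ → ℂ} (hf : f ∈ TestKInf k hk) {b τ : ℝ}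
    (hbτ : b ≤ τ) (hW : ∀ t, b ≤ t → W k f t = 0) : ∀ t, τ < t → f t = 0 := by
  intro t ht
  rw [← (dualConv_W hk0 hf le_rfl).2]
  exact dualConv_of_ge _ (fun s hs => hW s hs.le) t (hbτ.trans ht.le)

/-- There is a test function `θ` for which the support of `Wₖ θ` ends at a point `b ≤ τ`: a translate of
any nonzero test function. -/
theorem exists_testFunction (hk0 : ZeroMemSupp k) (hD : TestKInf k hk ≠ ⊥) {τ : ℝ} (hτ : 0 < τ) :
    ∃ θ ∈ TestKInf k hk, ∃ b, 0 < b ∧ b ≤ τ ∧ (∀ t, b ≤ t → W k θ t = 0) ∧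
      ZeroMemSupp fun v => W k θ (b - v) := by
  obtain ⟨θ, hθ, hθ0⟩ := (Submodule.ne_bot_iff _).1 hD
  obtain ⟨hW, hWθ⟩ := dualConv_W hk0 hθ (n := 1) le_rfl
  have hW0 : W k θ ≠ 0 := fun h => hθ0 (by
    change dualConv k (W k θ) = θ at hWθ
    rw [← hWθ, h]
    ext t
    simp [dualConv])
  obtain ⟨c, hc, hc1, hc2⟩ := exists_zeroMemSupp_reverse hW hW0
  have hb : 0 < min c τ := lt_min hc hτ
  have ha : 0 ≤ c - min c τ := sub_nonneg.2 (min_le_left _ _)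
  have hWl : W k (leftTranslate (c - min c τ) θ) = leftTranslate (c - min c τ) (W k θ) :=
    W_leftTranslate hk0 hθ le_rfl ha
  refine ⟨_, leftTranslate_mem_testKInf hk0 hθ ha, min c τ, hb, min_le_right _ _, fun t ht => ?_,
    fun ε hε h => ?_⟩
  · rw [hWl, leftTranslate, indicator]
    split_ifs
    · exact hc1 _ (by linarith)
    · rfl
  · refine hc2 (min ε (min c τ)) (lt_min hε hb) ?_
    have := ae_mono (Measure.restrict_mono (Ioo_subset_Ioo_right (min_le_left ε (min c τ))) le_rfl) h
    filter_upwards [this, ae_restrict_mem measurableSet_Ioo] with v hv hv'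
    rw [hWl, leftTranslate, indicator_of_mem (show min c τ - v ∈ Ici (0 : ℝ) from
      sub_nonneg.2 (hv'.2.le.trans (min_le_right _ _)))] at hv
    rw [← hv]
    congr 1
    ring

/-- For a suitable `c` the primitive of `k * e^{ct}` at `b` exceeds any given bound; otherwise
the Laplace transform of the primitive of `k` would decay too fast. -/
theorem exists_lt_norm_integral_conv_exp (hk0 : ZeroMemSupp k) (hk : LocallyIntegrableOn k (Ici 0))
    {b : ℝ} (hb : 0 < b) (C : ℝ) :
    ∃ c : ℝ, C < ‖∫ t in (0 : ℝ)..b, conv k (fun t => Complex.exp (c * t)) t‖ := by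
  by_contra! h
  have hkb := hk.integrableOn_Icc b
  have hb' : b ∈ Icc 0 b := right_mem_Icc.2 hb.le
  refine not_ae_prim_eq_zero hk0 hk hb (ae_eq_zero_of_laplace_le (T := b) (C := C)
    (intervalIntegrable_of_Icc (continuousOn_prim hkb).bddMeasOn.integrableOn (left_mem_Icc.2 hb.le)
      hb') hb.le le_rfl fun x _ => ?_)
  have hec : Continuous fun t : ℝ => Complex.exp (x * t) := by fun_prop
  have heb : IntegrableOn (fun t : ℝ => Complex.exp (x * t)) (Icc 0 b) :=
    hec.continuousOn.bddMeasOn.integrableOn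
  have e1 : ∫ t in (0 : ℝ)..b, conv k (fun t => Complex.exp (x * t)) t
      = Complex.exp (x * b) * ∫ t in (0 : ℝ)..b, Complex.exp (x * -t) * prim k t := by
    change prim (conv k fun t => Complex.exp (x * t)) b = _
    rw [← conv_prim hkb heb hb', conv_prim_comm hkb heb hb', conv, ← intervalIntegral.integral_const_mul]
    congr 1 with t
    rw [← mul_assoc, ← Complex.exp_add]
    congr 2
    push_cast
    ring
  have e2 := h x
  rw [e1, norm_mul, Complex.norm_exp] at e2
  have e3 : ((x : ℂ) * b).re = x * b := by simp
  rw [e3] at e2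
  rw [neg_mul, Real.exp_neg, ← div_eq_mul_inv, le_div_iff₀ (Real.exp_pos _), mul_comm b x, mul_comm]
  exact e2

/-- There are a test function `η` and a number `c` for which the value `η(0)` dominates the function
`p = c W η + (W η)'`.  This makes the operator `(c - A) 𝒢ₖ(η) = η(0) + ∫₀ᵇ p(t) S(t) dt` invertible. -/
theorem exists_dominant_testFunction (hk0 : ZeroMemSupp k) (hD : TestKInf k hk ≠ ⊥) {τ : ℝ}
    (hτ : 0 < τ) {M : ℝ} (hM : 0 ≤ M) :
    ∃ η ∈ TestKInf k hk, ∃ b, 0 < b ∧ b ≤ τ ∧ (∀ t, b ≤ t → W k η t = 0) ∧ ∃ c : ℂ,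
      M * (∫ t in (0 : ℝ)..b, ‖(c • W k η + derivPlus (W k η)) t‖) < ‖η 0‖ := by
  obtain ⟨θ, hθ, b, hb, hbτ, hWb, hW0⟩ := exists_testFunction hk0 hD hτ
  obtain ⟨c, hc⟩ := exists_lt_norm_integral_conv_exp hk0 hk hb (M * b)
  set e : ℝ → ℂ := fun t => Complex.exp (c * t) with he
  have hec : Continuous e := by fun_prop
  have hel : LocallyIntegrableOn e (Ici 0) := hec.continuousOn.locallyIntegrableOn measurableSet_Ici
  set g := W k θ with hg
  have hgP : g ∈ TestPlus := (dualConv_W hk0 hθ le_rfl).1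
  -- the functions `Q (W η)` form a space `V` that contains the translates of `Q (W θ)`, and hence
  -- functions close to `1`
  set Q : (ℝ → ℂ) → ℝ → ℂ := fun q => (c : ℂ) • q + derivPlus q with hQ
  have hQP : ∀ q ∈ TestPlus, Q q ∈ TestPlus := fun q hq =>
    TestPlus.add_mem (TestPlus.smul_mem _ hq) (derivPlus_mem_testPlus hq)
  have hQge : ∀ q ∈ TestPlus, (∀ t, b ≤ t → q t = 0) → ∀ t, b ≤ t → Q q t = 0 := by
    intro q hq hqb t ht
    have hz : ∀ t, b < t → Q q t = 0 := fun t ht => by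
      simp [hQ, hqb t ht.le, derivPlus_of_gt hq hb.le (fun t ht => hqb t ht.le) t ht]
    rcases ht.eq_or_lt with rfl | h
    · have h1 : Tendsto (Q q) (𝓝[>] b) (𝓝 (Q q b)) :=
        ((testPlus_continuousOn (hQP q hq)) b hb.le).mono fun t ht => hb.le.trans (le_of_lt ht)
      refine tendsto_nhds_unique h1 (tendsto_const_nhds.congr' ?_)
      filter_upwards [self_mem_nhdsWithin] with t ht using (hz t ht).symm
    · exact hz t h
  have hWP : ∀ η ∈ TestKInf k hk, W k η ∈ TestPlus := fun η hη => (dualConv_W hk0 hη le_rfl).1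
  let V : Submodule ℂ (ℝ → ℂ) :=
    { carrier := {p | ∃ η ∈ TestKInf k hk, (∀ t, b ≤ t → W k η t = 0) ∧ p = Q (W k η)}
      zero_mem' := by
        have h0 : W k 0 = 0 := by
          have := W_smul hk0 hθ (n := 1) le_rfl 0
          simp only [zero_smul] at this
          exact this
        refine ⟨0, Submodule.zero_mem _, fun t _ => by rw [h0]; rfl, ?_⟩
        have := derivPlus_smul hgP 0
        simp only [zero_smul] at this
        simp [hQ, h0, this]
      add_mem' := by
        rintro _ _ ⟨η, hη, h1, rfl⟩ ⟨η', hη', h1', rfl⟩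
        have hadd : W k (η + η') = W k η + W k η' := W_add hk0 hη hη' le_rfl
        refine ⟨η + η', Submodule.add_mem _ hη hη', fun t ht => ?_, ?_⟩
        · rw [hadd, Pi.add_apply, h1 t ht, h1' t ht, add_zero]
        · simp only [hQ]
          rw [hadd, derivPlus_add (hWP η hη) (hWP η' hη')]
          module
      smul_mem' := by
        rintro a _ ⟨η, hη, h1, rfl⟩
        have hsmul : W k (a • η) = a • W k η := W_smul hk0 hη le_rfl a
        refine ⟨a • η, Submodule.smul_mem _ a hη, fun t ht => ?_, ?_⟩
        · rw [hsmul, Pi.smul_apply, h1 t ht, smul_zero]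
        · simp only [hQ]
          rw [hsmul, derivPlus_smul (hWP η hη)]
          module }
  have hQ0 : ZeroMemSupp fun v => Q g (b - v) := by
    intro ε hε h
    -- if `c g + g'` vanished near `b`, then so would `g`
    set δ := min ε b with hδ
    have hδ0 : 0 < δ := lt_min hε hb
    have h1 : (fun v => Q g (b - v)) =ᵐ[volume.restrict (Ioo 0 δ)] fun _ => 0 :=
      ae_mono (Measure.restrict_mono (Ioo_subset_Ioo_right (min_le_left _ _)) le_rfl) h
    have h2 := Measure.eqOn_open_of_ae_eq h1 isOpen_Ioo
      ((continuousOn_comp_sub_left (hQP g hgP) le_rfl).mono fun v hv =>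
        ⟨hv.1.le, hv.2.le.trans (min_le_right _ _)⟩) continuousOn_const
    have h3 : ∀ t, b - δ < t → Q g t = 0 := fun t ht => by
      rcases lt_or_ge t b with h' | h'
      · have := h2 (x := b - t) ⟨by linarith, by linarith⟩
        simpa using this
      · exact hQge g hgP hWb t h'
    have h4 : ∀ t, b - δ ≤ t → g t = 0 := fun t ht => by
      have := congrFun (dualConv_exp hgP c) t
      rw [dualConv_of_ge _ h3 t ht] at this
      simpa using this.symm
    refine hW0 δ hδ0 ((ae_restrict_iff' measurableSet_Ioo).2 (Eventually.of_forall fun v hv => ?_))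
    exact h4 _ (by linarith [hv.2])
  have hV : V ≤ TestPlus := by
    rintro _ ⟨η, hη, _, rfl⟩
    exact hQP _ (hWP η hη)
  have htr : ∀ a ∈ Icc 0 b, leftTranslate a (Q g) ∈ V := by
    intro a ha
    have hWl : W k (leftTranslate a θ) = leftTranslate a g := W_leftTranslate hk0 hθ le_rfl ha.1
    refine ⟨leftTranslate a θ, leftTranslate_mem_testKInf hk0 hθ ha.1, fun t ht => ?_, ?_⟩
    · rw [hWl, leftTranslate, indicator]
      split_ifs
      · exact hWb _ (by linarith [ha.1])
      · rfl
    · simp only [hQ]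
      rw [hWl, derivPlus_leftTranslate ha.1 hgP]
      ext t
      by_cases ht : t ∈ Ici (0 : ℝ) <;> simp [leftTranslate, ht, indicator_of_mem, indicator_of_notMem]
  set E := conv k e with hE
  have hEc : ContinuousOn E (Icc 0 b) := continuousOn_vconv (hk.integrableOn_Icc b) hec.continuousOn
  obtain ⟨D, hD'⟩ := isCompact_Icc.exists_bound_of_continuousOn hEc
  have hD0 : 0 ≤ D := (norm_nonneg _).trans (hD' 0 (left_mem_Icc.2 hb.le))
  set J := ‖∫ t in (0 : ℝ)..b, E t‖ with hJ
  have hδ : 0 < (J - M * b) / (M + D + 1) := div_pos (by linarith) (by positivity)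
  obtain ⟨_, ⟨η, hη, hηb, rfl⟩, hlt⟩ :=
    exists_integral_norm_sub_one_lt hb (hQP g hgP) (hQge g hgP hWb) hQ0 hV htr hδ
  refine ⟨η, hη, b, hb, hbτ, hηb, c, ?_⟩
  set q := W k η with hq
  have hqP := hWP η hη
  set p := Q q with hp
  have hpP : p ∈ TestPlus := hQP q hqP
  have hpc : ContinuousOn p (Icc 0 b) := testPlus_continuousOn_Icc hpP b
  change M * (∫ t in (0 : ℝ)..b, ‖p t‖) < ‖η 0‖
  rw [lt_div_iff₀ (by positivity)] at hlt
  have hint : ∀ {F : Type} [NormedAddCommGroup F] {u : ℝ → F}, ContinuousOn u (Icc 0 b) →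
      IntervalIntegrable u volume 0 b := fun {F} _ {u} hu =>
    ContinuousOn.intervalIntegrable (by rwa [uIcc_of_le hb.le])
  have hdc : ContinuousOn (fun t => ‖p t - 1‖) (Icc 0 b) := (hpc.sub continuousOn_const).norm
  -- `η(0)` is the integral of `-p E`
  have hη0 : η 0 = -∫ t in (0 : ℝ)..b, p t * E t := by
    have h1 : η = dualConv k q := (dualConv_W hk0 hη le_rfl).2.symm
    have h2 : q = dualConv e ((-1 : ℂ) • p) := by
      rw [dualConv_smul, hp, dualConv_exp hqP, neg_one_smul, neg_neg]
    have h3 : dualConv k q = dualConv E ((-1 : ℂ) • p) := by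
      conv_lhs => rw [h2]
      exact (dualConv_conv hk hel (TestPlus.smul_mem _ hpP)).symm
    rw [h1, h3, dualConv_smul, Pi.smul_apply,
      dualConv_zero _ hb.le fun t ht => hQge q hqP hηb t ht.le]
    simp [hp]
  have i1 : ∫ t in (0 : ℝ)..b, ‖p t‖ ≤ b + ∫ t in (0 : ℝ)..b, ‖p t - 1‖ := by
    have : ∫ t in (0 : ℝ)..b, (1 + ‖p t - 1‖) = b + ∫ t in (0 : ℝ)..b, ‖p t - 1‖ := by
      rw [intervalIntegral.integral_add (hint continuousOn_const) (hint hdc)]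
      simp
    rw [← this]
    refine intervalIntegral.integral_mono_on hb.le (hint hpc.norm)
      (hint (continuousOn_const.add hdc)) fun t _ => ?_
    have := norm_add_le (1 : ℂ) (p t - 1)
    simpa using this
  have i2 : J ≤ ‖η 0‖ + D * ∫ t in (0 : ℝ)..b, ‖p t - 1‖ := by
    have h1 : ∫ t in (0 : ℝ)..b, E t = -η 0 - ∫ t in (0 : ℝ)..b, (p t - 1) * E t := by
      have j1 : IntervalIntegrable (fun t => p t * E t) volume 0 b := hint (hpc.mul hEc)
      have j2 : IntervalIntegrable (fun t => (p t - 1) * E t) volume 0 b :=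
        hint ((hpc.sub continuousOn_const).mul hEc)
      rw [hη0, neg_neg, ← intervalIntegral.integral_sub j1 j2]
      congr 1 with t
      ring
    have h2 : ‖∫ t in (0 : ℝ)..b, (p t - 1) * E t‖ ≤ D * ∫ t in (0 : ℝ)..b, ‖p t - 1‖ := by
      rw [← intervalIntegral.integral_const_mul]
      refine intervalIntegral.norm_integral_le_of_norm_le hb.le
        (Eventually.of_forall fun t ht => ?_) (hint (continuousOn_const.mul hdc))
      rw [norm_mul, mul_comm]
      exact mul_le_mul_of_nonneg_right (hD' t ⟨ht.1.le, ht.2⟩) (norm_nonneg _)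
    rw [hJ, h1]
    refine (norm_sub_le _ _).trans ?_
    rw [norm_neg]
    linarith
  set d := ∫ t in (0 : ℝ)..b, ‖p t - 1‖
  have hd0 : 0 ≤ d := intervalIntegral.integral_nonneg hb.le fun _ _ => norm_nonneg _
  nlinarith [mul_le_mul_of_nonneg_left i1 hM]

end

/-! ### Injectivity and the generator -/

namespace IsInducedMap

variable {X : Type*} [NormedAddCommGroup X] [NormedSpace ℂ X] [CompleteSpace X]
  {k : ℝ → ℂ} {hk : LocallyIntegrableOn k (Ici 0)} {τ : ℝ} {S : ℝ → X →L[ℂ] X} {A : X →ₗ.[ℂ] X}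
  {G : TestKInf k hk → X →L[ℂ] X}

/-- The operators `𝒢ₖ(θ)` have no common null vector: the translates of a single test function and
Titchmarsh's theorem show that the orbit of such a vector vanishes near the origin. -/
theorem eq_zero_of_forall_apply_eq_zero (hG : IsInducedMap k hk τ S G) (hk0 : ZeroMemSupp k)
    (hD : TestKInf k hk ≠ ⊥) (hS : IsLocalConvolutedSemigroup k τ S A) (hτ : 0 < τ) {x : X}
    (hx : ∀ θ, G θ x = 0) : x = 0 := by
  obtain ⟨θ, hθ, b, hb, hbτ, hWb, hW0⟩ := exists_testFunction hk0 hD hτ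
  have hWP : W k θ ∈ TestPlus := (dualConv_W hk0 hθ le_rfl).1
  have hθτ := eq_zero_of_W_eq_zero hk0 hθ hbτ hWb
  -- applying `G` to the translates of `θ` gives the convolution of `W θ`, reversed, with the orbit
  have hSx : ∀ t ∈ Icc 0 b, S t x = 0 := by
    refine eqOn_zero_of_vconv_eq_zero hb hW0 (testPlus_bddMeasOn hWP b b).integrableOn
      ((hS.strongly_continuous x).mono (Icc_subset_Icc_right hbτ)) fun t ht => ?_
    have ha : b - t ∈ Icc 0 b := ⟨by linarith [ht.2], by linarith [ht.1]⟩
    have h1 := hx ⟨_, leftTranslate_mem_testKInf hk0 hθ ha.1⟩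
    have hWl : W k (leftTranslate (b - t) θ) = leftTranslate (b - t) (W k θ) :=
      W_leftTranslate hk0 hθ le_rfl ha.1
    rw [hG.apply_of_gt (leftTranslate_of_gt ha.1 hθτ), hWl,
      integral_leftTranslate_smul _ ha hbτ hWb, sub_sub_cancel] at h1
    exact h1
  by_contra hx0
  refine not_ae_prim_eq_zero hk0 hk hb ((ae_restrict_iff' measurableSet_Ioo).2
    (Eventually.of_forall fun t ht => ?_))
  have h1 := hS.duhamel t ⟨ht.1.le, ht.2.le.trans hbτ⟩ x
  have h2 : ∫ s in (0 : ℝ)..t, S s x = 0 := by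
    refine (intervalIntegral.integral_congr fun s hs => ?_).trans intervalIntegral.integral_zero
    rw [uIcc_of_le ht.1.le] at hs
    exact hSx s ⟨hs.1, hs.2.trans ht.2.le⟩
  rw [h2, hSx t ⟨ht.1.le, ht.2.le⟩, zero_sub] at h1
  have h3 := A.graph_fst_eq_zero_snd h1 rfl
  exact (smul_eq_zero.1 (neg_eq_zero.1 h3)).resolve_right hx0

/-- The formula `A 𝒢ₖ(θ) x = -𝒢ₖ(θ') x - θ(0) x`. -/
theorem mem_graph (hG : IsInducedMap k hk τ S G) (hk0 : ZeroMemSupp k)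
    (hS : IsLocalConvolutedSemigroup k τ S A) (hτ : 0 < τ) {θ θ' : TestKInf k hk}
    (h : (θ' : ℝ → ℂ) = derivPlus θ) (x : X) :
    (G θ x, -G θ' x - (θ : ℝ → ℂ) 0 • x) ∈ A.graph := by
  have hθ := testKInf_mem_testPlus θ.2
  obtain ⟨n, hn, hθn, -⟩ := exists_forall_gt_eq_zero hτ hθ hθ
  obtain ⟨U, hU, hGU⟩ := hG.exists_semigroup hS hτ.le hn
  have h0 : 0 ≤ n * τ := by positivity
  obtain ⟨hW, hWθ⟩ := dualConv_W hk0 θ.2 hn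
  have key := hU.integral_smul_mem_graph h0 (convPow_locallyIntegrableOn hk n) hW
    (fun t ht => W_of_ge hk0 θ.2 hn h0 hθn t ht.le) x
  rwa [hWθ, ← W_derivPlus hk0 θ.2 hn, ← h, ← hGU θ hθn,
    ← hGU θ' (by rw [h]; exact derivPlus_of_gt hθ h0 hθn)] at key

theorem norm_apply_le (hG : IsInducedMap k hk τ S G) (hk0 : ZeroMemSupp k)
    {M : ℝ} (hM0 : 0 ≤ M) (hM : ∀ t ∈ Icc 0 τ, ‖S t‖ ≤ M) {χ : TestKInf k hk} {b : ℝ}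
    (hb : 0 ≤ b) (hbτ : b ≤ τ) (hW : ∀ t, b ≤ t → W k χ t = 0) :
    ‖G χ‖ ≤ M * ∫ t in (0 : ℝ)..b, ‖W k χ t‖ := by
  have hWP : W k χ ∈ TestPlus := (dualConv_W hk0 χ.2 le_rfl).1
  have hc : IntervalIntegrable (fun t => ‖W k χ t‖) volume 0 b :=
    ContinuousOn.intervalIntegrable (by
      rw [uIcc_of_le hb]; exact (testPlus_continuousOn_Icc hWP b).norm)
  refine ContinuousLinearMap.opNorm_le_bound _ (mul_nonneg hM0
    (intervalIntegral.integral_nonneg hb fun _ _ => norm_nonneg _)) fun x => ?_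
  rw [hG.apply_of_gt (eq_zero_of_W_eq_zero hk0 χ.2 hbτ hW), integral_smul_eq_of_ge _ hb hbτ hW,
    mul_right_comm, ← intervalIntegral.integral_const_mul]
  refine intervalIntegral.norm_integral_le_of_norm_le hb (Eventually.of_forall fun t ht => ?_)
    (hc.const_mul _)
  rw [norm_smul, mul_comm]
  refine mul_le_mul_of_nonneg_right (((S t).le_opNorm x).trans ?_) (norm_nonneg _)
  exact mul_le_mul_of_nonneg_right (hM t ⟨ht.1.le, ht.2.trans hbτ⟩) (norm_nonneg _)

theorem commute (hG : IsInducedMap k hk τ S G) (hk0 : ZeroMemSupp k)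
    (hS : IsLocalConvolutedSemigroup k τ S A) (hτ : 0 < τ) (φ ψ : TestKInf k hk) :
    Commute (G φ) (G ψ) := by
  change G φ ∘L G ψ = G ψ ∘L G φ
  rw [← hG.apply_conv hk0 hS hτ, ← hG.apply_conv hk0 hS hτ]
  congr 2
  exact conv_comm _ _

/-- The domain of `A` is contained in the range of `𝒢ₖ(η)` for a single test function `η`. -/
theorem exists_range_eq_domain (hG : IsInducedMap k hk τ S G) (hk0 : ZeroMemSupp k)
    (hD : TestKInf k hk ≠ ⊥) (hS : IsLocalConvolutedSemigroup k τ S A) (hτ : 0 < τ) :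
    ∃ η : TestKInf k hk, ∀ x y, (x, y) ∈ A.graph → ∃ z, G η z = x := by
  obtain ⟨M, hM0, hM⟩ := hS.exists_bound
  obtain ⟨η, hη, b, hb, hbτ, hWb, c, hc⟩ := exists_dominant_testFunction hk0 hD hτ hM0
  have hWP : W k η ∈ TestPlus := (dualConv_W hk0 hη le_rfl).1
  have hlin := hG.isLinearMap hk0 hS hτ
  set η₀ : TestKInf k hk := ⟨η, hη⟩
  set η₁ : TestKInf k hk := ⟨derivPlus η, derivPlus_mem_testKInf hk0 hη⟩
  set χ : TestKInf k hk := c • η₀ + η₁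
  have hχ : W k χ = c • W k η + derivPlus (W k η) := by
    have h1 := W_add hk0 (c • η₀).2 η₁.2 (n := 1) le_rfl
    have h2 := W_smul hk0 hη (n := 1) le_rfl c
    have h3 := W_derivPlus hk0 hη (n := 1) le_rfl
    change W k (c • η + derivPlus η) = _
    change W k (c • η + derivPlus η) = W k (c • η) + W k (derivPlus η) at h1
    rw [h1]
    exact congrArg₂ _ h2 h3
  have hWχ : ∀ t, b ≤ t → W k χ t = 0 := by
    refine W_of_ge hk0 χ.2 (n := 1) le_rfl hb.le fun t ht => ?_
    have hηb : ∀ t, b < t → η t = 0 := fun t ht => by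
      rw [← (dualConv_W hk0 hη le_rfl).2]
      exact dualConv_of_ge _ (fun s hs => hWb s hs.le) t ht.le
    change c • η t + derivPlus η t = 0
    rw [hηb t ht, derivPlus_of_gt (testKInf_mem_testPlus hη) hb.le hηb t ht, smul_zero, add_zero]
  have hnorm : ‖G χ‖ < ‖η 0‖ := by
    have := hG.norm_apply_le hk0 hM0 hM hb.le hbτ hWχ
    rw [hχ] at this
    exact this.trans_lt hc
  -- `(c - A) G(η) = G(χ) + η(0)` is invertible
  have hunit : IsUnit (algebraMap ℂ (X →L[ℂ] X) (η 0) - -G χ) := by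
    refine spectrum.mem_resolventSet_of_norm_lt_mul ?_
    rw [norm_neg]
    refine lt_of_le_of_lt ?_ hnorm
    exact mul_le_of_le_one_right (norm_nonneg _) ContinuousLinearMap.norm_id_le
  obtain ⟨u, hu⟩ := hunit
  have hux : ∀ x, (u : X →L[ℂ] X) x = η 0 • x + G χ x := fun x => by
    rw [hu, sub_neg_eq_add, Algebra.algebraMap_eq_smul_one]
    rfl
  have hGχ : ∀ x, G χ x = c • G η₀ x + G η₁ x := fun x => by
    simp only [χ]
    rw [hlin.map_add, hlin.map_smul]
    rfl
  have hcomm : Commute (G η₀) (u : X →L[ℂ] X) := by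
    rw [hu]
    exact (Algebra.commute_algebraMap_right _ _).sub_right (hG.commute hk0 hS hτ η₀ χ).neg_right
  refine ⟨η₀, fun x y hxy => ⟨(↑u⁻¹ : X →L[ℂ] X) (c • x - y), ?_⟩⟩
  have h1 := hG.mem_graph hk0 hS hτ (θ := η₀) (θ' := η₁) rfl x
  have hτη := eq_zero_of_W_eq_zero hk0 hη hbτ hWb
  have h2 := hS.integral_smul_mem_graph_of_mem_graph hτ.le hWP hxy
  rw [← hG.apply_of_gt (f := η₀) hτη, ← hG.apply_of_gt (f := η₀) hτη] at h2
  have h3 := A.mem_graph_snd_inj h2 h1 rfl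
  have h4 : G η₀ (c • x - y) = (u : X →L[ℂ] X) x := by
    rw [map_sub, map_smul, h3, hux, hGχ]
    module
  have h5 := congrArg (fun L : X →L[ℂ] X => L (c • x - y)) hcomm.units_inv_right.eq
  change G η₀ ((↑u⁻¹ : X →L[ℂ] X) (c • x - y)) = (↑u⁻¹ : X →L[ℂ] X) (G η₀ (c • x - y)) at h5
  rw [h5, h4]
  change ((↑u⁻¹ * ↑u : X →L[ℂ] X)) x = x
  rw [Units.inv_mul]
  rfl

theorem isGenerator (hG : IsInducedMap k hk τ S G) (hk0 : ZeroMemSupp k)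
    (hD : TestKInf k hk ≠ ⊥) (hS : IsLocalConvolutedSemigroup k τ S A) (hτ : 0 < τ) :
    IsGenerator G A := by
  refine Subset.antisymm ?_ (closure_minimal ?_ hS.isClosed)
  · obtain ⟨η, hη⟩ := hG.exists_range_eq_domain hk0 hD hS hτ
    rintro ⟨x, y⟩ hxy
    obtain ⟨z, rfl⟩ := hη x y hxy
    refine subset_closure ⟨η, ⟨derivPlus η, derivPlus_mem_testKInf hk0 η.2⟩, z, rfl, ?_⟩
    exact Prod.ext rfl (A.mem_graph_snd_inj hxy (hG.mem_graph hk0 hS hτ rfl z) rfl)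
  · rintro _ ⟨θ, θ', x, h, rfl⟩
    exact hG.mem_graph hk0 hS hτ h x

theorem isKDistributionSemigroup (hG : IsInducedMap k hk τ S G) (hk0 : ZeroMemSupp k)
    (hD : TestKInf k hk ≠ ⊥) (hS : IsLocalConvolutedSemigroup k τ S A) (hτ : 0 < τ) :
    IsKDistributionSemigroup k hk G where
  linear := hG.isLinearMap hk0 hS hτ
  continuous := hG.continuous hk0 hS hτ
  map_conv φ ψ := ⟨conv_mem_testKInf hk0 φ.2 ψ.2, hG.apply_conv hk0 hS hτ φ ψ⟩
  ker_inter := by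
    ext x
    simp only [mem_iInter, mem_ofPred_eq, mem_singleton_iff]
    refine ⟨hG.eq_zero_of_forall_apply_eq_zero hk0 hD hS hτ, ?_⟩
    rintro rfl θ
    exact map_zero _

end IsInducedMap

end KConv

theorem mainTheorem3 {X : Type*} [NormedAddCommGroup X] [NormedSpace ℂ X] [CompleteSpace X]
    (k : ℝ → ℂ) (hk : LocallyIntegrableOn k (Ici 0)) (hk0 : KConv.ZeroMemSupp k)
    (hD : KConv.TestKInf k hk ≠ ⊥)
    (τ : ℝ) (hτ : 0 < τ) (S : ℝ → X →L[ℂ] X) (A : X →ₗ.[ℂ] X)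
    (hS : KConv.IsLocalConvolutedSemigroup k τ S A) (hnd : KConv.NonDegenerate τ S) :
    (∃! G : KConv.TestKInf k hk → X →L[ℂ] X, KConv.IsInducedMap k hk τ S G) ∧
    ∀ G : KConv.TestKInf k hk → X →L[ℂ] X, KConv.IsInducedMap k hk τ S G →
      KConv.IsKDistributionSemigroup k hk G ∧ KConv.IsGenerator G A :=
  ⟨KConv.existsUnique_isInducedMap hk0 hS hτ, fun _ hG =>
    ⟨hG.isKDistributionSemigroup hk0 hD hS hτ, hG.isGenerator hk0 hD hS hτ⟩⟩
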